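/- All graphs are finite and simple. The matching complex $M(G)$ of a graph $G$ is the simplicial complex whose faces are the matchings of $G$ (sets of edges, no two sharing an endpoint). A simplicial complex is a \emph{two-dimensional Buchsbaum complex} if its largest faces have exactly three elements and the link of each of its vertices is a connected graph with at least one edge. A star is a graph $K_{1,n}$ with $n\ge 1$. \textbf{Families given by diagrams.} A diagram consists of vertices $0,\dots,n-1$, a set of required edges, a set of optional edges, and a set $U$ of \emph{unfilled} vertices. Its family consists, up to isomorphism, of all graphs obtained by taking all required edges, any subset of the optional edges, and then adding any finite number (possibly zero) of new vertices, each of them joined to a nonempty set of vertices of $U$ and to nothing else (so no vertices are added when $U=\emptyset$). Writing $ij$ for the edge $\{i,j\}$: - $\mathcal G_1$ ($n=5$): required $01,12,23,34$; optional $03,14$; $U=\{1,3\}$. - $\mathcal G_2$ ($n=5$): required $01,12,02,23,34$; optional $03,13$; $U=\{3\}$. - $\mathcal G_3$ ($n=5$): required $01,12,23,34,04$; all other edges optional; $U=\emptyset$. - Bowtie $B$ ($n=5$): required $01,12,02,23,34,24$; no optional edges; $U=\emptyset$. - $\mathcal B_1$ ($n=6$): required $03,14,25$; no optional edges; $U=\{0,1,2\}$.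 - $\mathcal B_2$ ($n=7$): required $03,13,05,15,14,24,16,26$; no optional edges; $U=\{0,1,2\}$. - $\mathcal B_3$ ($n=7$): required $04,14,15,25,26,06,03,13,23$; optional $05,16,24$; $U=\{0,1,2\}$. - $\mathcal B_4$ ($n=8$): required $04,14,15,25,26,06,07,13,23$; optional $05,16,24$; $U=\{0,1,2\}$. - $\mathcal B_5$ ($n=8$): required $03,04,05,13,15,17,25,26,27$; optional $14,16,07,23$; $U=\{0,1,2\}$. - $\mathcal B_6$ ($n=8$): required $03,04,14,15,17,26,27$; optional $24,25,16$; $U=\{0,1,2\}$. - $\mathcal B_7$ ($n=8$): required $12,23,13,45,56,46,01,04,07$; optional $02,03,05,06$; $U=\{0\}$. - $\mathcal B_8$ ($n=8$): required $23,34,24,02,05,06,15,17$; optional $03,04,07,16$; $U=\{0,1\}$. - $\mathcal B_9$ ($n=8$): required $23,34,24,02,12,05,07,16,17$; optional $06,15$; $U=\{0,1\}$. - $E_1$ ($n=7$): two copies of $K_4$ sharing exactly one vertex. - $E_2$ ($n=7$): a $K_4$ and a $C_4$ sharing exactly one vertex. \textbf{Two further families.} $\mathcal B_{C_7}$ is the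 family of all graphs that contain $C_7$ as a (not necessarily induced) subgraph and have a two-dimensional Buchsbaum matching complex. $\mathcal B_P$ is the family of petal graphs: those obtained from three graphs, each a $K_3$ or a star with at least two edges, by gluing them together at a single vertex, which must be a non-central vertex of each star used. \textbf{Theorem.} Let $G$ be a graph without isolated vertices. Then $M(G)$ is a two-dimensional Buchsbaum complex if and only if one of the following holds: (a) $G$ belongs to $\mathcal B_{C_7}$, to $\mathcal B_P$, or to $\mathcal B_i$ for some $i\in\{1,\dots,9\}$; (b) $G$ is isomorphic to $E_1$ or $E_2$; (c) (i) $G$ has exactly three connected components, each of which is $K_3$ or a star; or (ii) $G$ has exactly two connected components, one of which is $K_3$ or a star and the other of which is the bowtie graph $B$ or a graph in $\mathcal G_1$, $\mathcal G_2$ or $\mathcal G_3$. -/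

import Mathlib

namespace MatchingBuchsbaum

/-! ### Simplicial complexes -/

section Complexes

variable {ι : Type*}

/-- `Δ` has dimension `d`: the largest number of elements of a face is `d + 1`. -/
def HasDim (Δ : PreAbstractSimplicialComplex ι) (d : ℕ) : Prop :=
  (∃ s ∈ Δ, s.card = d + 1) ∧ ∀ s ∈ Δ, s.card ≤ d + 1

/-- The link of `σ` in `Δ` (only nonempty faces are recorded). -/
def link [DecidableEq ι] (Δ : PreAbstractSimplicialComplex ι) (σ : Finset ι) :
    PreAbstractSimplicialComplex ι where
  faces := {τ | τ ∈ Δ ∧ τ ∪ σ ∈ Δ ∧ Disjoint τ σ}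
  isRelLowerSet_faces := by
    rintro τ ⟨h1, h2, h3⟩
    refine ⟨(Δ.isRelLowerSet_faces h1).1, fun ρ hρ hne => ⟨?_, ?_, ?_⟩⟩
    · exact (Δ.isRelLowerSet_faces h1).2 hρ hne
    · exact (Δ.isRelLowerSet_faces h2).2 (Finset.union_subset_union_left hρ)
        (hne.mono Finset.subset_union_left)
    · exact Finset.disjoint_of_subset_left hρ h3

/-- The graph of vertices and edges of a complex. -/
def oneSkeleton [DecidableEq ι] (Δ : PreAbstractSimplicialComplex ι) :
    SimpleGraph {x : ι // {x} ∈ Δ} where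
  Adj x y := x ≠ y ∧ ({x.1, y.1} : Finset ι) ∈ Δ
  symm := ⟨fun x y h => ⟨h.1.symm, by rw [Finset.pair_comm]; exact h.2⟩⟩
  loopless := ⟨fun x h => h.1 rfl⟩

/-- `Δ` is a connected graph with at least one edge, i.e. a connected one-dimensional complex. -/
def IsConnectedGraph [DecidableEq ι] (Δ : PreAbstractSimplicialComplex ι) : Prop :=
  HasDim Δ 1 ∧ (oneSkeleton Δ).Connected

/-- `Δ` is a two-dimensional Buchsbaum complex: it has dimension two and the link of each vertex
is a connected graph with at least one edge. -/
def IsTwoDimBuchsbaum [DecidableEq ι] (Δ : PreAbstractSimplicialComplex ι) : Prop :=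
  HasDim Δ 2 ∧ ∀ v : ι, {v} ∈ Δ → IsConnectedGraph (link Δ {v})

end Complexes

section Graphs

variable {V : Type*}

/-- A matching: a set of edges of `G`, no two of which share an endpoint. -/
def IsMatching (G : SimpleGraph V) (s : Finset (Sym2 V)) : Prop :=
  (∀ e ∈ s, e ∈ G.edgeSet) ∧ ∀ e ∈ s, ∀ f ∈ s, ∀ v : V, v ∈ e → v ∈ f → e = f

/-- The matching complex: its faces are the (nonempty) matchings of `G`. -/
def matchingComplex (G : SimpleGraph V) : PreAbstractSimplicialComplex (Sym2 V) where
  faces := {s | s.Nonempty ∧ IsMatching G s}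
  isRelLowerSet_faces := by
    rintro s ⟨h1, h2, h3⟩
    exact ⟨h1, fun t ht hne => ⟨hne, fun e he => h2 e (ht he),
      fun e he f hf => h3 e (ht he) f (ht hf)⟩⟩

/-! ### Families of graphs given by diagrams -/

/-- A diagram on the vertices `0, …, n - 1`: solid (required) edges, dotted (optional) edges, and
the set of unfilled vertices (all others are filled). -/
structure Diagram (n : ℕ) where
  solid : Finset (Sym2 (Fin n))
  dotted : Finset (Sym2 (Fin n))
  unfilled : Finset (Fin n)

/-- `G` belongs to the family of the diagram `D`, up to isomorphism: `f` places the diagram's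
vertices in `G`; between them all solid edges and any dotted edges are present and no others; every
further vertex of `G` is joined to a nonzero number of unfilled vertices and to nothing else.
If `D` has no unfilled vertex, there are no further vertices. -/
def Diagram.Family {n : ℕ} (D : Diagram n) (G : SimpleGraph V) : Prop :=
  ∃ f : Fin n ↪ V,
    (∀ i j, s(i, j) ∈ D.solid → G.Adj (f i) (f j)) ∧
    (∀ i j, G.Adj (f i) (f j) → s(i, j) ∈ D.solid ∨ s(i, j) ∈ D.dotted) ∧
    ∀ w, w ∉ Set.range f →
      (∃ v, G.Adj w v) ∧ ∀ v, G.Adj w v → ∃ i ∈ D.unfilled, v = f i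

/-- The family `𝒢₁`: a path `0-1-2-3-4`; new vertices attach to `1` and `3`. -/
def diagG1 : Diagram 5 where
  solid := {s(0, 1), s(1, 2), s(2, 3), s(3, 4)}
  dotted := {s(0, 3), s(1, 4)}
  unfilled := {1, 3}

/-- The family `𝒢₂`: a triangle `0,1,2` and the path `2-3-4`; new vertices attach to `3`. -/
def diagG2 : Diagram 5 where
  solid := {s(0, 1), s(1, 2), s(2, 3), s(3, 4), s(0, 2)}
  dotted := {s(0, 3), s(1, 3)}
  unfilled := {3}

/-- The family `𝒢₃`: graphs on five vertices with a Hamiltonian cycle. -/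
def diagG3 : Diagram 5 where
  solid := {s(0, 1), s(1, 2), s(2, 3), s(3, 4), s(0, 4)}
  dotted := {s(0, 2), s(2, 4), s(1, 4), s(1, 3), s(0, 3)}
  unfilled := ∅

/-- The bowtie graph: two triangles sharing exactly the vertex `2`. -/
def bowtie : Diagram 5 where
  solid := {s(0, 1), s(1, 2), s(2, 3), s(3, 4), s(0, 2), s(2, 4)}
  dotted := ∅
  unfilled := ∅

/-- In this family the unfilled vertices are `0`, `1` and `2`. -/
def diagB1 : Diagram 6 where
  solid := {s(0, 3), s(1, 4), s(2, 5)}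
  dotted := ∅
  unfilled := {0, 1, 2}

/-- In this family the unfilled vertices are `0`, `1` and `2`. -/
def diagB2 : Diagram 7 where
  solid := {s(0, 3), s(1, 3), s(1, 4), s(2, 4), s(2, 6), s(1, 6), s(1, 5), s(0, 5)}
  dotted := ∅
  unfilled := {0, 1, 2}

/-- In this family the unfilled vertices are `0`, `1` and `2`. -/
def diagB3 : Diagram 7 where
  solid := {s(0, 4), s(1, 4), s(1, 5), s(2, 5), s(2, 6),
    s(0, 6), s(0, 3), s(1, 3), s(2, 3)}
  dotted := {s(0, 5), s(1, 6), s(2, 4)}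
  unfilled := {0, 1, 2}

/-- In this family the unfilled vertices are `0`, `1` and `2`. -/
def diagB4 : Diagram 8 where
  solid := {s(0, 4), s(1, 4), s(1, 5), s(2, 5), s(2, 6),
    s(0, 6), s(0, 7), s(1, 3), s(2, 3)}
  dotted := {s(0, 5), s(1, 6), s(2, 4)}
  unfilled := {0, 1, 2}

/-- In this family the unfilled vertices are `0`, `1` and `2`. -/
def diagB5 : Diagram 8 where
  solid := {s(0, 4), s(0, 3), s(1, 3), s(1, 5), s(0, 5),
    s(2, 5), s(2, 6), s(2, 7), s(1, 7)}
  dotted := {s(1, 6), s(1, 4), s(0, 7), s(2, 3)}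
  unfilled := {0, 1, 2}

/-- In this family the unfilled vertices are `0`, `1` and `2`. -/
def diagB6 : Diagram 8 where
  solid := {s(0, 3), s(0, 4), s(1, 4), s(1, 7), s(2, 7), s(2, 6), s(1, 5)}
  dotted := {s(2, 4), s(2, 5), s(1, 6)}
  unfilled := {0, 1, 2}

/-- Vertex `0` is unfilled; `{1,2,3}` and `{4,5,6}` are triangles. -/
def diagB7 : Diagram 8 where
  solid := {s(1, 2), s(2, 3), s(1, 3), s(0, 1), s(0, 4),
    s(4, 5), s(5, 6), s(4, 6), s(0, 7)}
  dotted := {s(0, 2), s(0, 3), s(0, 5), s(0, 6)}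
  unfilled := {0}

/-- Vertices `0` and `1` are unfilled; `{2,3,4}` is a triangle. -/
def diagB8 : Diagram 8 where
  solid := {s(2, 3), s(3, 4), s(2, 4), s(0, 2), s(0, 5), s(1, 5), s(1, 7), s(0, 6)}
  dotted := {s(0, 3), s(0, 4), s(1, 6), s(0, 7)}
  unfilled := {0, 1}

/-- Vertices `0` and `1` are unfilled; `{2,3,4}` is a triangle whose vertex `2` is joined to both. -/
def diagB9 : Diagram 8 where
  solid := {s(1, 2), s(0, 2), s(2, 3), s(3, 4), s(2, 4),
    s(0, 7), s(1, 7), s(1, 6), s(0, 5)}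
  dotted := {s(1, 5), s(0, 6)}
  unfilled := {0, 1}

/-- The first exceptional graph: two copies of `K₄` sharing exactly the vertex `0`. -/
def diagE1 : Diagram 7 where
  solid := {s(1, 2), s(2, 3), s(1, 3), s(0, 1), s(0, 4), s(4, 5),
    s(5, 6), s(4, 6), s(0, 2), s(0, 3), s(0, 5), s(0, 6)}
  dotted := ∅
  unfilled := ∅

/-- The second exceptional graph: a `K₄` on `0,2,3,4` and a four-cycle `0-5-1-6`
sharing exactly the vertex `0`. -/
def diagE2 : Diagram 7 where
  solid := {s(2, 3), s(3, 4), s(2, 4), s(0, 2), s(0, 5),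
    s(1, 5), s(1, 6), s(0, 3), s(0, 4), s(0, 6)}
  dotted := ∅
  unfilled := ∅

/-! ### The remaining graphs -/

/-- `G` is isomorphic to `K₃`. -/
def IsK3 (G : SimpleGraph V) : Prop :=
  Nonempty (G ≃g (⊤ : SimpleGraph (Fin 3)))

/-- `G` is a star graph with at least one edge. -/
def IsStar (G : SimpleGraph V) : Prop :=
  Nontrivial V ∧ ∃ z : V, G = SimpleGraph.starGraph z

/-- The family `ℬ_{C₇}`: graphs containing `C₇` as a (not necessarily induced) subgraph whose
matching complex is a two-dimensional Buchsbaum complex. -/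
def FamilyC7 [DecidableEq V] (G : SimpleGraph V) : Prop :=
  (SimpleGraph.cycleGraph 7).IsContained G ∧ IsTwoDimBuchsbaum (matchingComplex G)

/-- `H` is a petal with gluing vertex `c`: a `K₃`, or a star with at least two edges in which `c`
is not the center. -/
def IsPetal (H : SimpleGraph V) (c : V) : Prop :=
  IsK3 H ∨ ∃ z : V, z ≠ c ∧ H = SimpleGraph.starGraph z ∧ 2 ≤ H.edgeSet.ncard

/-- The family `ℬ_P` of petal graphs: three petals, with vertex sets `A 0`, `A 1`, `A 2`, glued
together at the single vertex `c`. -/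
def FamilyPetal (G : SimpleGraph V) : Prop :=
  ∃ (c : V) (A : Fin 3 → Set V) (hc : ∀ i, c ∈ A i),
    (∀ i j, i ≠ j → A i ∩ A j = {c}) ∧
    (⋃ i, A i) = Set.univ ∧
    (∀ u v, G.Adj u v → ∃ i, u ∈ A i ∧ v ∈ A i) ∧
    ∀ i, IsPetal (G.induce (A i)) ⟨c, hc i⟩

/-- `G` has exactly three components, each of which is `K₃` or a star. -/
def ThreeComponents (G : SimpleGraph V) : Prop :=
  Nat.card G.ConnectedComponent = 3 ∧
    ∀ C : G.ConnectedComponent, IsK3 C.toSimpleGraph ∨ IsStar C.toSimpleGraph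

/-- `G` has exactly two components, one of which is `K₃` or a star and the other one is the bowtie
graph or belongs to `𝒢₁`, `𝒢₂` or `𝒢₃`. -/
def TwoComponents (G : SimpleGraph V) : Prop :=
  ∃ C D : G.ConnectedComponent, C ≠ D ∧ (∀ X : G.ConnectedComponent, X = C ∨ X = D) ∧
    (IsK3 C.toSimpleGraph ∨ IsStar C.toSimpleGraph) ∧
    (bowtie.Family D.toSimpleGraph ∨ diagG1.Family D.toSimpleGraph ∨
      diagG2.Family D.toSimpleGraph ∨ diagG3.Family D.toSimpleGraph)

end Graphs

end MatchingBuchsbaum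

open MatchingBuchsbaum

/-! The vertices of the link of an edge `e` in the matching complex are the edges of `G` disjoint
from `e`, two of them being adjacent when they are disjoint. Dimension two means that some matching
has three edges and none has four. For the link of `e` to be connected, every matching of size one
or two must extend. Once this holds there is one further obstruction. If two edges `X`, `Y` of the
link have partners `g`, `g'` there and no path `X - Y`, `X - g - Y`, `X - g' - Y` or `X - g - g' -
Y` exists, then the four edges form a four-cycle. They are joined in the link as soon as some edge
disjoint from `e` leaves the vertex set of that cycle, and they lie in different components
otherwise. The resulting conditions on edges are `Bu`, and `isTwoDimBuchsbaum_iff` is the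
equivalence.

Every family except the one of `C₇` is described by finitely many patterns: a core with required and
optional edges, plus arbitrarily many independent vertices attached to prescribed blocks of the
core. An edge of a realization matters only through its trace on the core, and there are finitely
many traces. Hence one finite condition, `Pattern.good`, yields `Bu` for all realizations at once
(`Pattern.bu_of_good`). Petal graphs and disconnected graphs are patterns glued along one or no
vertex; `RealizesOn.split` and `RealizesOn.glue` translate between the glued pattern and its parts.

Conversely, let `G` satisfy `Bu` and not contain `C₇`. Three disjoint edges meet every edge, so all
but a bounded number of vertices form an independent set attached to a core. Three starting
configurations suffice: a five-cycle with a disjoint edge; failing that, a triangle with two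
disjoint edges; failing that, a maximum matching in which each edge has an end without neighbours
outside the matching. From each of them a case search settles adjacencies, the existence of further
neighbours of a core vertex, and the existence of common further neighbours of two core vertices. It
is driven by the fact that the complement of a three-edge matching is independent. A case ends with
a violation of `Bu`, with an excluded subgraph, or with a pattern of the catalogue. The kernel
evaluates the search. Only its certificates are proved sound (`Valid.search`); the heuristics that
find them need no proof. -/

namespace MatchingBuchsbaum

/-! ### Patterns

A pattern is a diagram with numbered vertices whose further vertices attach to one block each. -/

/-- Vertices `0, …, size - 1`, required edges, optional edges, and blocks of vertices; a further
vertex is joined to a nonempty set of vertices of one block. -/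
structure Pattern where
  size : ℕ
  must : List (ℕ × ℕ)
  may : List (ℕ × ℕ)
  attach : List (List ℕ)

namespace Search

/-! ### Arithmetic of bit masks

All functions of the search are evaluated by the kernel. They are written with recursors and the
basic operations on `ℕ`, and `force` makes the kernel evaluate a number before passing it on. -/

/-- Apply `k` to the value of `x`. -/
def force {α : Type} (x : ℕ) (k : ℕ → α) : α := Nat.rec (k 0) (fun m _ => k (Nat.succ m)) x

/-- `if c then a else b` for a Boolean `c`. -/
def sel {α : Type} (c : Bool) (a b : α) : α := Bool.rec b a c

def disj (a b : ℕ) : Bool := Nat.beq (Nat.land a b) 0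

def diff (a b : ℕ) : ℕ := Nat.xor a (Nat.land a b)

def bit (i : ℕ) : ℕ := Nat.shiftLeft 1 i

/-- The bit of the entry `(i, j)` of a matrix with rows of 16 bits, preceded by 16 empty bits. -/
def cell (i j : ℕ) : ℕ := Nat.shiftLeft 1 (Nat.add (Nat.mul 16 (Nat.succ i)) j)

def row (M i : ℕ) : ℕ := Nat.land (Nat.shiftRight M (Nat.mul 16 (Nat.succ i))) 65535

def allB {α : Type} (p : α → Bool) (l : List α) : Bool :=
  List.rec true (fun a _ ih => sel (p a) ih false) l

def anyB {α : Type} (p : α → Bool) (l : List α) : Bool :=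
  List.rec false (fun a _ ih => sel (p a) true ih) l

def allBelow (p : ℕ → Bool) (n : ℕ) : Bool := Nat.rec true (fun i ih => sel (p i) ih false) n

def memB (a : ℕ) (l : List ℕ) : Bool := anyB (Nat.beq a) l

def nodupB (l : List ℕ) : Bool := List.rec true (fun b l ih => sel (memB b l) false ih) l

def nth (l : List ℕ) : ℕ → ℕ :=
  List.rec (fun _ => 0) (fun a _ ih k => Nat.rec a (fun k _ => ih k) k) l

def maskOf (l : List ℕ) : ℕ := List.rec 0 (fun a _ ih => Nat.lor (bit a) ih) l

def hasBit (M i j : ℕ) : Bool := not (disj M (cell i j))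

/-! ### Partial knowledge of a graph -/

/-- Partial knowledge about a graph with `n` distinguished vertices: edges (as masks of two bits,
and as entries of the matrix `yes`), non-edges (the matrix `non`), vertices all of whose neighbours
are distinguished (`closed`), and pairs without common undistinguished neighbour (`common`). The
lists `kills` and `pending` only guide the search: they contain, for each edge, the rows and columns
of its ends, and the pairs of disjoint edges not known to extend to a matching of size three. -/
structure State where
  n : ℕ
  edges : List ℕ
  kills : List ℕ
  pending : List (ℕ × ℕ)
  yes : ℕ
  non : ℕ
  closed : ℕ
  common : List ℕ

def State.full (s : State) : ℕ := Nat.pred (bit s.n)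

def avoiding (e : ℕ) (l : List ℕ) : List ℕ :=
  List.rec [] (fun f _ ih => sel (disj f e) (f :: ih) ih) l

/-- The sets `U \ (m ∪ g)` for the members `g` of `l` disjoint from `m`, added to `acc`. -/
def outsideAux (U m : ℕ) (l acc : List ℕ) : List ℕ :=
  List.rec acc (fun g _ ih => sel (disj g m) (force (diff U (Nat.lor g m)) fun o => o :: ih) ih) l

/-- The sets `U \ (e ∪ f ∪ g)` for disjoint members `f`, `g` of a list of sets disjoint from `e`. -/
def outside (U e : ℕ) (l : List ℕ) : List ℕ :=
  List.rec [] (fun f l ih => outsideAux U (Nat.lor f e) l ih) l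

/-- Add all entries with both indices in `O` to the matrix `N`. -/
def square (O N n : ℕ) : ℕ :=
  Nat.rec N (fun i ih => sel (disj O (bit i)) ih
    (force ih fun N => Nat.lor N (Nat.shiftLeft O (Nat.mul 16 (Nat.succ i))))) n

def squares (n N : ℕ) (l : List ℕ) : ℕ :=
  -- A set with at most one element contributes no pair of distinct vertices and is skipped.
  List.rec N (fun O _ ih => sel (Nat.beq (Nat.land O (Nat.pred O)) 0) ih
    (force ih fun N => square O N n)) l

def union (N : ℕ) (l : List ℕ) : ℕ := List.rec N (fun O _ ih => force ih fun N => Nat.lor N O) l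

/-- The edge `e = {i, j}` together with the rows and columns of its ends. -/
def kill (i j e : ℕ) : ℕ :=
  -- Multiplication by 65535 fills the rows of `i` and `j`. The large constant is the sum of `2 ^
  -- (16 * r)` for `1 ≤ r ≤ 16`, so its product with `e` copies `e` into every row and covers the
  -- two columns. The 16 empty low bits of a matrix leave room for `e` itself.
  Nat.lor e (Nat.lor (Nat.mul 65535 (Nat.lor (cell i 0) (cell j 0))) (Nat.mul
    115793856111341331857467735920185713421406907988821545813533107889564276555776 e))

/-- A pair is dropped once a known edge survives the removal of the rows and columns of both
members, since that edge completes the matching. -/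
def oldPending (Y : ℕ) (l : List (ℕ × ℕ)) : List (ℕ × ℕ) :=
  List.rec [] (fun p _ ih => Prod.rec (fun a b =>
    sel (Nat.beq (diff (diff Y a) b) 0) ((a, b) :: ih) ih) p) l

/-- `Y` consists of the edges disjoint from the edge `e`, which belongs to `q`. -/
def newPending (Y e q : ℕ) (l : List ℕ) (acc : List (ℕ × ℕ)) : List (ℕ × ℕ) :=
  -- The mask `e` has only low bits, and the low 16 bits of `f` are the mask of its edge, so `disj e
  -- f` says that the two edges are disjoint.
  List.rec acc (fun f _ ih => sel (disj e f) (sel (Nat.beq (diff Y f) 0) ((q, f) :: ih) ih) ih) l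

def addEdge {α : Type} (s : State) (i j : ℕ) (k : State → α) : α :=
  force (Nat.lor (bit i) (bit j)) fun e =>
  force (kill i j e) fun q =>
  force (Nat.lor s.yes (Nat.lor (cell i j) (cell j i))) fun Y =>
  force (diff Y q) fun Y' =>
  -- Each member of `o` is the complement, among the distinguished vertices, of a three-edge
  -- matching through the new edge. As there is no fourth disjoint edge, it is independent and its
  -- vertices have no undistinguished neighbours.
  let o := outside s.full e (avoiding e s.edges)
  force (squares s.n s.non o) fun N =>
  force (union s.closed o) fun c =>
  k ⟨s.n, e :: s.edges, q :: s.kills, newPending Y' e q s.kills (oldPending Y s.pending),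
    Y, N, c, s.common⟩

def addNon {α : Type} (s : State) (i j : ℕ) (k : State → α) : α :=
  force (Nat.lor s.non (Nat.lor (cell i j) (cell j i))) fun N =>
  k ⟨s.n, s.edges, s.kills, s.pending, s.yes, N, s.closed, s.common⟩

def addClosed {α : Type} (s : State) (i : ℕ) (k : State → α) : α :=
  force (Nat.lor s.closed (bit i)) fun c =>
  k ⟨s.n, s.edges, s.kills, s.pending, s.yes, s.non, c, s.common⟩

def addCommon {α : Type} (s : State) (i j : ℕ) (k : State → α) : α :=
  force (Nat.lor (bit i) (bit j)) fun c =>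
  k ⟨s.n, s.edges, s.kills, s.pending, s.yes, s.non, s.closed, c :: s.common⟩

/-- Add the entries `(i, c)` with `i` in `m` to the matrix `N`. -/
def column (c m N n : ℕ) : ℕ :=
  Nat.rec N (fun i ih => sel (disj m (bit i)) ih (force ih fun N => Nat.lor N (cell i c))) n

/-- Add to `c` the vertices that have no common undistinguished neighbour with `i`. -/
def apart (i c : ℕ) (l : List ℕ) : ℕ :=
  List.rec c (fun m _ ih => sel (disj m (bit i)) ih
    (force ih fun c => Nat.lor c (Nat.xor m (bit i)))) l

/-- A new distinguished neighbour of `i`. -/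
def addVertex {α : Type} (s : State) (i : ℕ) (k : State → α) : α :=
  -- The new vertex was undistinguished so far. It is therefore not joined to closed vertices, nor
  -- to those without common undistinguished neighbour with `i`. It is itself closed because
  -- undistinguished vertices are pairwise non-adjacent.
  force (apart i s.closed s.common) fun m =>
  force (Nat.lor (column s.n m s.non s.n) (Nat.shiftLeft m (Nat.mul 16 (Nat.succ s.n)))) fun N =>
  force (Nat.lor s.closed (bit s.n)) fun c =>
  force (Nat.succ s.n) fun n' =>
  addEdge ⟨n', s.edges, s.kills, s.pending, s.yes, N, c, s.common⟩ i s.n k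

/-! ### Certificates -/

/-- The distinguished vertices in `l` form a copy of the graph `pat` on `k` vertices. -/
def isCopy (k : ℕ) (pat : List (ℕ × ℕ)) (s : State) (l : List ℕ) : Bool :=
  Nat.beq l.length k && (nodupB l && (allB (fun i => Nat.blt i s.n) l &&
    allB (fun p => hasBit s.yes (nth l p.1) (nth l p.2)) pat))

/-- Every edge with both ends in `R` or undistinguished lies inside `X`. -/
def isolated (s : State) (R X : ℕ) : Bool :=
  allBelow (fun i => sel (disj R (bit i)) true
    (not (disj s.closed (bit i)) && Nat.beq
      (diff (diff (diff R (row s.non i)) (bit i)) (sel (disj X (bit i)) 0 X)) 0)) s.n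

def cycleSeven : List (ℕ × ℕ) := [(0, 1), (1, 2), (2, 3), (3, 4), (4, 5), (5, 6), (0, 6)]

def cycleFiveEdge : List (ℕ × ℕ) := [(0, 1), (1, 2), (2, 3), (3, 4), (0, 4), (5, 6)]

def triangleEdges : List (ℕ × ℕ) := [(0, 1), (1, 2), (0, 2), (3, 4), (5, 6)]

/-- A matching of size two that cannot be extended. -/
def isStuck (s : State) (l : List ℕ) : Bool :=
  isCopy 4 [(0, 1), (2, 3)] s l && isolated s (diff s.full (maskOf l)) 0

/-- A four-cycle and an edge disjoint from it such that all edges disjoint from that edge lie in the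
vertex set of the cycle. -/
def isSquare (s : State) (l : List ℕ) : Bool :=
  isCopy 6 [(0, 1), (1, 2), (2, 3), (0, 3), (4, 5)] s l &&
    isolated s (diff s.full (maskOf (l.drop 4))) (maskOf (l.take 4))

def hasPair (l : List (ℕ × ℕ)) (a b : ℕ) : Bool :=
  anyB (fun p => (Nat.beq p.1 a && Nat.beq p.2 b) || (Nat.beq p.1 b && Nat.beq p.2 a)) l

/-- `0` for a required edge, `1` for an optional edge, `2` for a non-edge. -/
def _root_.MatchingBuchsbaum.Pattern.code (X : Pattern) (a b : ℕ) : ℕ :=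
  sel (hasPair X.must a b) 0 (sel (hasPair X.may a b) 1 2)

/-- The codes of the pairs `(a, b)` where `b` comes after `a` in `l`. -/
def codes (X : Pattern) (l : List ℕ) : List (List ℕ) :=
  List.rec [] (fun a l ih => l.map (X.code a) :: ih) l

/-- The vertices `ws` agree with the codes `r` for a vertex whose rows are `Y` and `N`. -/
def matchRow (Y N : ℕ) (r ws : List ℕ) : Bool :=
  List.rec (fun _ => true) (fun c _ ih ws => List.rec false (fun w ws _ =>
    Nat.rec (sel (disj Y (bit w)) false (ih ws)) (fun c _ =>
      Nat.rec (ih ws) (fun _ _ => sel (disj N (bit w)) false (ih ws)) c) c) ws) r ws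

/-- The vertices in `l` are distinct, distinguished, outside `used`, and agree with the codes. -/
def matchCodes (s : State) (rs : List (List ℕ)) (used : ℕ) (l : List ℕ) : Bool :=
  List.rec (fun _ l => List.rec true (fun _ _ _ => false) l) (fun r _ ih used l =>
    List.rec false (fun v vs _ => force (bit v) fun b => sel (Nat.blt v s.n && disj used b)
      (force (row s.yes v) fun Y => force (row s.non v) fun N =>
        sel (matchRow Y N r vs) (force (Nat.lor used b) fun u => ih u vs) false) false) l) rs used l

/-- Conditions on the vertices outside the image of a pattern: a distinguished one is joined to one
block only, and an undistinguished one can be joined to one block only. -/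
def isSpread (s : State) (im : ℕ) (blocks : List ℕ) : Bool :=
  Nat.beq (diff (diff s.full s.closed) (union 0 blocks)) 0 &&
  ((Nat.beq im s.full || allBelow (fun w => sel (disj im (bit w))
    (not (disj s.closed (bit w)) && anyB (fun b =>
      Nat.beq (diff (diff (diff s.full (row s.non w)) (bit w)) b) 0) blocks)
    true) s.n) &&
  allB (fun b => allB (fun c => Nat.beq b c ||
    allBelow (fun i => disj b (bit i) || (not (disj s.closed (bit i)) ||
      allBelow (fun j => disj c (bit j) || (not (disj s.closed (bit j)) ||
        memB (Nat.lor (bit i) (bit j)) s.common)) s.n)) s.n) blocks) blocks)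

/-- Placing the vertices of the pattern at the distinguished vertices `l` realizes the pattern. -/
def isPlacement (X : Pattern) (s : State) (l : List ℕ) : Bool :=
  matchCodes s (codes X (List.range X.size)) 0 l &&
  force (maskOf l) fun im => isSpread s im (X.attach.map fun b => maskOf (b.map (nth l)))

/-! ### Finding certificates and branching

The functions of this section need no proof of correctness. They represent a vertex by the mask with
a single bit. -/

def low (m : ℕ) : ℕ := Nat.xor m (Nat.land m (Nat.pred m))

/-- The exponent of a power of two below `2 ^ 16`. -/
def index (v : ℕ) : ℕ :=
  -- Since 2 is a primitive root modulo 19, the relevant powers of two have distinct residues. The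
  -- constant is a table of exponents, four bits for each residue.
  Nat.land (Nat.shiftRight 45539777865417620640000 (Nat.mul 4 (Nat.mod v 19))) 15

/-- For `v = 2 ^ i` the factor `v ^ 16` is `2 ^ (16 * i)`, so the division is a shift to row `i`. -/
def rowOf (M v : ℕ) : ℕ := Nat.land (Nat.div M (Nat.mul 65536 (Nat.pow v 16))) 65535

def orElse (l k : List ℕ) : List ℕ := List.rec k (fun a l _ => a :: l) l

def andThen (l : List ℕ) (k : List ℕ → List ℕ) : List ℕ := List.rec [] (fun a l _ => k (a :: l)) l

/-- The first nonempty value of `p` at a vertex of `m`. -/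
def firstBit (m : ℕ) (p : ℕ → List ℕ) : List ℕ :=
  Nat.rec (fun _ => []) (fun _ ih m => sel (Nat.beq m 0) []
    (force (low m) fun v => orElse (p v) (force (Nat.xor m v) fun m => ih m))) 16 m

def ends (e : ℕ) : List ℕ := force (low e) fun v => [v, Nat.xor e v]

def findDisj (u : ℕ) (E : List ℕ) : List ℕ :=
  List.rec [] (fun e _ ih => sel (disj e u) (ends e) ih) E

def findTwoDisj (u : ℕ) (E : List ℕ) : List ℕ :=
  List.rec [] (fun e l ih => sel (disj e u)
    (orElse (andThen (findDisj (Nat.lor e u) l) fun p => ends e ++ p) ih) ih) E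

/-- Paths from `v` with `k` edges that avoid `used` and end in a neighbour of `t`. -/
def findPath (Y t : ℕ) (fin : ℕ → List ℕ → List ℕ) (k v used : ℕ) (l : List ℕ) : List ℕ :=
  Nat.rec (fun v used l => sel (disj (rowOf Y v) t) [] (fin used l))
    (fun _ ih v used l => force (diff (rowOf Y v) used) fun m => firstBit m
      fun w => force (Nat.lor used w) fun u => ih w u (w :: l)) k v used l

def findTriangle (Y : ℕ) (E l : List ℕ) : List ℕ :=
  List.rec [] (fun e _ ih => force (low e) fun v => force (Nat.xor e v) fun w =>
    force (Nat.land (rowOf Y v) (rowOf Y w)) fun m => sel (Nat.beq m 0) ih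
    (orElse (firstBit m fun x =>
      andThen (findTwoDisj (Nat.lor e x) E) fun p => v :: w :: x :: p) ih)) l

def forceList (l : List ℕ) (k : List ℕ → List ℕ) : List ℕ :=
  List.rec (fun k => k []) (fun a _ ih k => force a fun a => ih fun l => k (a :: l)) l k

def certify (k : ℕ) (pat : List (ℕ × ℕ)) (s : State) (l : List ℕ) : Bool :=
  List.rec false (fun a l _ => isCopy k pat s ((a :: l).map index)) l

/-- The known edges contain one of the graphs excluded at the given level; `{v, w}` is the edge
found last. -/
def isExcluded (level : ℕ) (s : State) (v w : ℕ) : Bool :=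
  force s.yes fun Y => force (Nat.lor v w) fun e =>
  sel (certify 7 cycleSeven s (findPath Y w (fun _ l => w :: l) 5 v e [v])) true
  (sel (Nat.ble level 0) false
  (sel (certify 7 cycleFiveEdge s (findPath Y w (fun u l =>
    andThen (findDisj u s.edges) fun p => w :: l ++ p) 3 v e [v])) true
  (sel (Nat.ble level 1) false (certify 7 triangleEdges s (findTriangle Y s.edges [e])))))

inductive Choice where
  | none : Choice
  | edge : ℕ → ℕ → Choice
  | vertex : ℕ → Choice
  | common : ℕ → ℕ → Choice

def openEdge (Y N R n : ℕ) : Choice :=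
  Nat.rec .none (fun i ih => sel (disj R (bit i)) ih
    (force (diff (diff (Nat.land R (Nat.pred (bit i))) (row Y i)) (row N i)) fun u =>
      sel (Nat.beq u 0) ih (Choice.edge i (Nat.log2 u)))) n

def openVertex (cl R : ℕ) : Choice :=
  force (diff R cl) fun u => sel (Nat.beq u 0) .none (.vertex (Nat.log2 u))

def popcount (m : ℕ) : ℕ :=
  Nat.rec (fun _ => 0) (fun _ ih m => sel (Nat.beq m 0) 0
    (force (Nat.land m (Nat.pred m)) fun m => Nat.succ (ih m))) 16 m

/-- The shifts fold the sixteen rows by halving, until the first row holds their union. -/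
def support (Y : ℕ) : ℕ :=
  force (Nat.lor Y (Nat.shiftRight Y 128)) fun Y =>
  force (Nat.lor Y (Nat.shiftRight Y 64)) fun Y =>
  force (Nat.lor Y (Nat.shiftRight Y 32)) fun Y =>
  Nat.land (Nat.shiftRight (Nat.lor Y (Nat.shiftRight Y 16)) 16) 65535

/-- An edge such that the edges disjoint from it form a four-cycle or a complete graph. -/
def findSquare (Y : ℕ) (K : List ℕ) : List ℕ :=
  List.rec [] (fun q _ ih => force (diff Y q) fun Y' => force (support Y') fun m =>
    sel (Nat.beq (popcount m) 4)
    (force (low m) fun a => force (rowOf Y' a) fun r => force (low r) fun b =>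
      force (low (Nat.xor r b)) fun d => sel (Nat.beq d 0) ih
        (force (Nat.xor m (Nat.lor a (Nat.lor b d))) fun c =>
          a :: b :: c :: d :: ends (Nat.land q 65535))) ih) K

/-- The constraints from placing a vertex of a pattern on those placed later: rows of the vertices
joined to it, of those not joined to it, and of the undetermined ones; bounds for its degree. -/
structure Slot where
  solid : ℕ
  blank : ℕ
  loose : ℕ
  free : Bool
  lo : ℕ
  hi : ℕ

structure Target where
  pat : Pattern
  pos : List ℕ
  slots : List Slot
  frees : ℕ

def isFree (X : Pattern) (a : ℕ) : Bool := anyB (memB a) X.attach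

def count (p : ℕ → Bool) (l : List ℕ) : ℕ :=
  List.rec 0 (fun a _ ih => sel (p a) (force ih fun n => Nat.succ n) ih) l

def rowsOf (p : ℕ → Bool) (l : List ℕ) : ℕ :=
  List.rec 0 (fun a _ ih => force ih fun n => Nat.add (Nat.mul 65536 n) (sel (p a) 1 0)) l

def slotsOf (X : Pattern) (all l : List ℕ) : List Slot :=
  List.rec [] (fun a l ih =>
    let solid := hasPair X.must a
    let loose := hasPair X.may a
    let blank := fun b => not (solid b || loose b)
    force (rowsOf solid l) fun A => force (rowsOf blank l) fun B => force (rowsOf loose l) fun C =>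
    force (count solid all) fun lo =>
    -- An unfilled vertex can have any number of further neighbours. Its degree is bounded only
    -- through the pattern vertices to which it is not joined, itself included, so these are counted
    -- instead.
    force (sel (isFree X a) (count blank all) (Nat.add lo (count loose all))) fun hi =>
    ⟨A, B, Nat.mul 65535 C, isFree X a, lo, hi⟩ :: ih) l

/-- The pattern `X`, whose vertices are to be placed in the given order. -/
def target (X : Pattern) (order : List ℕ) : Target where
  pat := X
  pos := (List.range X.size).map fun a => order.idxOf a
  slots := slotsOf X order order
  frees := X.attach.flatten.length

/-- Candidates for each slot; `deg` packs the sets of vertices of degree at least `d`. -/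
def domains (cl deg n : ℕ) (ts : List Slot) : ℕ :=
  -- The leading 1 keeps a successful value positive; 0 signals that some slot has no candidate.
  List.rec 1 (fun t _ ih => force ih fun D => sel (Nat.beq D 0) 0
    (force (diff (row deg t.lo) (row deg (Nat.succ (sel t.free (Nat.sub n t.hi) t.hi)))) fun m =>
    force (sel t.free m (Nat.land m cl)) fun m => sel (Nat.beq m 0) 0
    (Nat.add (Nat.mul 65536 D) m))) ts

def place (Y : ℕ) (fin : List ℕ → List ℕ) (ts : List Slot) (D : ℕ) (l : List ℕ) : List ℕ :=
  List.rec (fun _ l => fin l) (fun t _ ih D l =>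
    force (Nat.shiftRight D 16) fun D' =>
    firstBit (Nat.land D 65535) fun v => force (rowOf Y v) fun r =>
      -- `solid` and `blank` have one bit per later slot, so multiplying by a row copies it into the
      -- blocks of those slots. Later slots joined to this one are restricted to neighbours of `v`,
      -- those not joined to it to non-neighbours. The constant, the sum of `2 ^ (16 * r)` for `r <
      -- 10`, removes `v` from all blocks.
      force (diff (Nat.land D' (Nat.add (Nat.mul t.solid r) (Nat.add
        (Nat.mul t.blank (Nat.xor r 65535)) t.loose)))
        (Nat.mul 22301085486089920167905467806764065303363585 v)) fun D' => ih D' (v :: l)) ts D l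

def packRows (d v : ℕ) : ℕ :=
  Nat.rec 0 (fun i ih => force ih fun m =>
    Nat.lor m (Nat.shiftLeft v (Nat.mul 16 (Nat.succ i)))) (Nat.succ d)

def degrees (Y n : ℕ) : ℕ :=
  Nat.rec 0 (fun i ih => force ih fun D => force (popcount (row Y i)) fun d =>
    force (packRows d (bit i)) fun b => Nat.lor D b) n

def acceptAny (s : State) (Y deg opens : ℕ) (Ts : List Target) : Bool :=
  List.rec false (fun T _ ih => sel (Nat.ble T.pat.size s.n && Nat.ble opens T.frees)
    (force (domains s.closed deg s.n T.slots) fun D =>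
      List.rec ih (fun _ _ _ => true)
        (place Y (fun l =>
          forceList (l.reverse.map index) fun l' => forceList (T.pos.map (nth l')) fun l' =>
          sel (isPlacement T.pat s l') l []) T.slots D []))
    ih) Ts

/-- The distinguished vertices realize one of the patterns. -/
def accept (Ts : List Target) (s : State) : Bool :=
  force s.yes fun Y => force (degrees Y s.n) fun deg =>
  force (popcount (diff s.full s.closed)) fun o => acceptAny s Y deg o Ts

def minOpen (s : State) : ℕ × ℕ :=
  Nat.rec (99, 0) (fun i ih => sel (disj s.closed (bit i))
    (force (popcount (row s.yes i)) fun d => sel (Nat.blt d ih.1) (d, i) ih) ih) s.n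

def minCommon (s : State) : ℕ × ℕ × ℕ :=
  Nat.rec (99, 0, 0) (fun j ih => sel (disj s.closed (bit j))
    (Nat.rec ih (fun i ih => sel (disj s.closed (bit i))
      (sel (memB (Nat.lor (bit i) (bit j)) s.common) ih
        (force (popcount (Nat.land (row s.yes i) (row s.yes j))) fun d =>
          sel (Nat.blt d ih.1) (d, i, j) ih)) ih) j) ih) s.n

/-- Open vertices without known neighbours are settled first, then common neighbours of pairs of
open vertices, then the open vertex of least known degree. The order influences only the size of the
search. -/
def choose (s : State) : Choice :=
  match minOpen s with
  | (d, v) => sel (Nat.ble d 1) (.vertex v) (match minCommon s with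
    | (c, i, j) => sel (Nat.blt c 99) (.common i j) (sel (Nat.blt d 99) (.vertex v) .none))

/-- Decide whether an edge is present, whether a vertex has an undistinguished neighbour, or whether
two vertices have a common one. -/
def branch (level : ℕ) (s : State) : Choice → List State
  | .none => [s]
  | .edge i j => sel (Nat.blt i s.n && Nat.blt j i)
      (addEdge s i j (fun t => sel (isExcluded level t (bit i) (bit j))
        (addNon s i j fun r => [r]) (t :: addNon s i j fun r => [r]))) [s]
  | .vertex i => sel (Nat.blt i s.n && Nat.blt s.n 15)
      (addVertex s i (fun t => sel (isExcluded level t (bit i) (bit s.n))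
        (addClosed s i fun r => [r]) (t :: addClosed s i fun r => [r]))) [s]
  | .common i j => sel (Nat.blt i j && (Nat.blt j s.n && Nat.blt s.n 15))
      (addVertex s i (fun t => addEdge t j s.n fun t => sel (isExcluded level t (bit i) (bit s.n))
        (addCommon s i j fun r => [r]) (t :: addCommon s i j fun r => [r]))) [s]

def orIfNone (c : Choice) (a : List State) (b : Choice → List State) : List State :=
  match c with
  | .none => a
  | c => b c

/-- The cases that arise from a state in which neither a contradiction nor a pattern is found. -/
def expand (level : ℕ) (Ts : List Target) (s : State) : List State :=
  -- A pair not known to extend goes first: it forces an edge among the remaining vertices, a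
  -- further vertex, or a contradiction.
  match s.pending with
  | [] => orIfNone (openEdge s.yes s.non s.full s.n)
      (match findSquare s.yes s.kills with
        | [] => sel (Nat.ble 2 level &&
              certify 7 triangleEdges s (findTriangle s.yes s.edges s.edges)) []
            (sel (accept Ts s) [] (branch level s (choose s)))
        | a :: l =>
          let l := (a :: l).map index
          orIfNone (openVertex s.closed (diff s.full (maskOf (l.drop 4))))
            (sel (isSquare s l) [] [s]) (branch level s))
      (branch level s)
  | (a, b) :: _ =>
    force (diff s.full (Nat.lor (Nat.land a 65535) (Nat.land b 65535))) fun R =>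
    orIfNone (openEdge s.yes s.non R s.n)
      (orIfNone (openVertex s.closed R)
        (sel (isStuck s ((ends (Nat.land a 65535) ++ ends (Nat.land b 65535)).map index)) [] [s])
        (branch level s))
      (branch level s)

/-- All cases end after at most `fuel` steps. -/
def search (level : ℕ) (Ts : List Target) (fuel : ℕ) : State → Bool :=
  Nat.rec (fun _ => false) (fun _ next s => allB next (expand level Ts s)) fuel

/-- The cases after `d` steps. -/
def frontier (level : ℕ) (Ts : List Target) (d : ℕ) (s : State) : List State :=
  Nat.rec [s] (fun _ ih => ih.flatMap (expand level Ts)) d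

def start (n closed : ℕ) (es : List (ℕ × ℕ)) : State :=
  List.rec ⟨n, [], [], [], 0, 0, closed, []⟩ (fun p _ ih => addEdge ih p.1 p.2 id) es

end Search

end MatchingBuchsbaum

/-! ### The Buchsbaum property as a condition on edges, and correctness of the bit arithmetic. -/

namespace MatchingBuchsbaum

variable {V : Type*}

/-- The pairs `{a, b}` and `{c, d}` are disjoint. -/
def Apart (a b c d : V) : Prop := a ≠ c ∧ a ≠ d ∧ b ≠ c ∧ b ≠ d

/-- The two-dimensional Buchsbaum property in terms of the edges of the graph. -/
structure Bu (G : SimpleGraph V) : Prop where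
  edge : ∃ a b, G.Adj a b
  extend_one : ∀ a b, G.Adj a b → ∃ c d, G.Adj c d ∧ Apart a b c d
  extend_two : ∀ a b c d, G.Adj a b → G.Adj c d → Apart a b c d →
    ∃ x y, G.Adj x y ∧ Apart x y a b ∧ Apart x y c d
  four : ∀ a b c d e f g h, G.Adj a b → G.Adj c d → G.Adj e f → G.Adj g h → Apart a b c d →
    Apart a b e f → Apart c d e f → Apart g h a b → Apart g h c d → Apart g h e f → False
  -- If every edge disjoint from `{x, y}` had both ends on the four-cycle, its two perfect matchings
  -- would lie in different components of the link of `{x, y}`.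
  square : ∀ a b c d x y, G.Adj a b → G.Adj b c → G.Adj c d → G.Adj a d → a ≠ c → b ≠ d →
    G.Adj x y → Apart x y a b → Apart x y c d →
    ∃ u v, G.Adj u v ∧ Apart u v x y ∧
      ¬ ((u = a ∨ u = b ∨ u = c ∨ u = d) ∧ (v = a ∨ v = b ∨ v = c ∨ v = d))

/-- `G` contains the graph with edges `pat` on the vertices `0, …, k - 1`. -/
def HasCopy (G : SimpleGraph V) (k : ℕ) (pat : List (ℕ × ℕ)) : Prop :=
  ∃ g : ℕ → V, (∀ a < k, ∀ b < k, g a = g b → a = b) ∧ ∀ p ∈ pat, G.Adj (g p.1) (g p.2)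

/-- `G` is obtained from the pattern `X`. -/
def Pattern.Realizes (X : Pattern) (G : SimpleGraph V) : Prop :=
  ∃ g : ℕ → V, (∀ a < X.size, ∀ b < X.size, g a = g b → a = b) ∧
    (∀ a b, a < b → b < X.size → (X.code a b = 0 → G.Adj (g a) (g b)) ∧
      (X.code a b = 2 → ¬ G.Adj (g a) (g b))) ∧
    ∀ w, (∀ a < X.size, w ≠ g a) → (∃ v, G.Adj w v) ∧
      ∃ b ∈ X.attach, ∀ v, G.Adj w v → ∃ a ∈ b, v = g a

namespace Search

/-! ### Soundness of the search -/

@[simp] lemma force_eq {α : Type} (x : ℕ) (k : ℕ → α) : force x k = k x := by cases x <;> rfl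

@[simp] lemma sel_true {α : Type} (a b : α) : sel true a b = a := rfl

@[simp] lemma sel_false {α : Type} (a b : α) : sel false a b = b := rfl

lemma sel_eq_ite {α : Type} (c : Bool) (a b : α) : sel c a b = if c = true then a else b := by
  cases c <;> rfl

lemma disj_iff {a b : ℕ} : disj a b = true ↔ ∀ k, ¬ (a.testBit k = true ∧ b.testBit k = true) := by
  rw [disj, Nat.beq_eq]
  constructor
  · intro h k hk
    have : (a &&& b).testBit k = true := by rw [Nat.testBit_and]; simp [hk]
    have h' : a &&& b = 0 := h
    simp [h'] at this
  · intro h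
    apply Nat.eq_of_testBit_eq
    intro k
    have := h k
    change (a &&& b).testBit k = _
    rw [Nat.testBit_and]
    cases h1 : a.testBit k <;> cases h2 : b.testBit k <;> simp_all

lemma testBit_diff (a b k : ℕ) : (diff a b).testBit k = (a.testBit k && !b.testBit k) := by
  change (a ^^^ (a &&& b)).testBit k = _
  rw [Nat.testBit_xor, Nat.testBit_and]
  cases a.testBit k <;> cases b.testBit k <;> rfl

@[simp] lemma testBit_bit (i k : ℕ) : (bit i).testBit k = decide (i = k) := by
  change (1 <<< i).testBit k = _
  rw [Nat.one_shiftLeft, Nat.testBit_two_pow]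

@[simp] lemma testBit_lor (a b k : ℕ) : (Nat.lor a b).testBit k = (a.testBit k || b.testBit k) :=
  Nat.testBit_or a b k

lemma disj_bit {a i : ℕ} : disj a (bit i) = !a.testBit i := by
  cases h : a.testBit i
  · rw [Bool.not_false, disj_iff]
    rintro k ⟨h1, h2⟩
    simp only [testBit_bit, decide_eq_true_eq] at h2
    subst h2; simp_all
  · rw [Bool.not_true, Bool.eq_false_iff, ne_eq, disj_iff]
    exact fun h' => h' i ⟨h, by simp⟩

lemma eq_zero_iff {a : ℕ} : Nat.beq a 0 = true ↔ ∀ k, a.testBit k = false := by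
  rw [Nat.beq_eq]
  exact ⟨fun h => by simp [h], fun h => Nat.eq_of_testBit_eq (by simpa using h)⟩

lemma testBit_full (s : State) (k : ℕ) : s.full.testBit k = decide (k < s.n) := by
  change (Nat.pred (1 <<< s.n)).testBit k = _
  rw [Nat.one_shiftLeft, Nat.pred_eq_sub_one, Nat.testBit_two_pow_sub_one]

/-- The entry `(i, j)` of the matrix `M`. -/
def entry (M i j : ℕ) : Bool := M.testBit (16 * (i + 1) + j)

lemma entry_lor (M N i j : ℕ) : entry (Nat.lor M N) i j = (entry M i j || entry N i j) :=
  testBit_lor _ _ _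

lemma entry_cell {a b i j : ℕ} (hb : b < 16) (hj : j < 16) :
    entry (cell a b) i j = true ↔ i = a ∧ j = b := by
  change (1 <<< (16 * (a + 1) + b)).testBit _ = true ↔ _
  rw [Nat.one_shiftLeft, Nat.testBit_two_pow, decide_eq_true_eq]
  omega

lemma testBit_row (M i j : ℕ) (hj : j < 16) : (row M i).testBit j = entry M i j := by
  change ((M >>> (16 * (i + 1))) &&& (2 ^ 16 - 1)).testBit j = _
  rw [Nat.testBit_and, Nat.testBit_two_pow_sub_one, Nat.testBit_shiftRight, entry]
  simp [hj]

/-- The bound on the bits of `O` keeps the shifted row from spilling into the next one. -/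
lemma entry_shift {O i' i j : ℕ} (hO : ∀ k, O.testBit k = true → k < 16) (hj : j < 16)
    (h : entry (Nat.shiftLeft O (Nat.mul 16 (Nat.succ i'))) i j = true) :
    i = i' ∧ O.testBit j = true := by
  change (O <<< (16 * (i' + 1))).testBit (16 * (i + 1) + j) = true at h
  rw [Nat.testBit_shiftLeft] at h
  simp only [ge_iff_le, Bool.and_eq_true, decide_eq_true_eq] at h
  have := hO _ h.2
  have e : i = i' := by omega
  subst e
  refine ⟨rfl, ?_⟩
  have := h.2
  rwa [Nat.add_sub_cancel_left] at this

lemma hasBit_iff {M i j : ℕ} : hasBit M i j = entry M i j := by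
  rw [hasBit, cell, entry]
  have : disj M (bit (16 * (i + 1) + j)) = !M.testBit (16 * (i + 1) + j) := disj_bit
  rw [bit] at this
  change (!disj M (Nat.shiftLeft 1 (16 * (i + 1) + j))) = _
  rw [this, Bool.not_not]

lemma allB_iff {α : Type} {p : α → Bool} {l : List α} :
    allB p l = true ↔ ∀ a ∈ l, p a = true := by
  induction l with
  | nil => simp [allB]
  | cons a l ih =>
    change sel (p a) (allB p l) false = true ↔ _
    rw [sel_eq_ite, List.forall_mem_cons, ← ih]
    split_ifs with h <;> simp [h]

lemma anyB_iff {α : Type} {p : α → Bool} {l : List α} :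
    anyB p l = true ↔ ∃ a ∈ l, p a = true := by
  induction l with
  | nil => simp [anyB]
  | cons a l ih =>
    change sel (p a) true (anyB p l) = true ↔ _
    rw [sel_eq_ite, List.exists_mem_cons_iff, ← ih]
    split_ifs with h <;> simp [h]

lemma allBelow_iff {p : ℕ → Bool} {n : ℕ} : allBelow p n = true ↔ ∀ i < n, p i = true := by
  induction n with
  | zero => simp [allBelow]
  | succ n ih =>
    change sel (p n) (allBelow p n) false = true ↔ _
    rw [sel_eq_ite, Nat.forall_lt_succ_right, ← ih]
    split_ifs with h <;> simp [h]

lemma memB_iff {a : ℕ} {l : List ℕ} : memB a l = true ↔ a ∈ l := by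
  rw [memB, anyB_iff]
  simp [Nat.beq_eq]

lemma nodupB_iff {l : List ℕ} : nodupB l = true ↔ l.Nodup := by
  induction l with
  | nil => simp [nodupB]
  | cons a l ih =>
    change sel (memB a l) false (nodupB l) = true ↔ _
    rw [sel_eq_ite, List.nodup_cons, ← ih, ← memB_iff]
    split_ifs with h <;> simp [h]

@[simp] lemma nth_cons_zero (a : ℕ) (l : List ℕ) : nth (a :: l) 0 = a := rfl

@[simp] lemma nth_cons_succ (a k : ℕ) (l : List ℕ) : nth (a :: l) (k + 1) = nth l k := rfl

lemma nth_eq_getD (l : List ℕ) (k : ℕ) : nth l k = l.getD k 0 := by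
  induction l generalizing k with
  | nil => rfl
  | cons a l ih => cases k with
    | zero => rfl
    | succ k => simp [ih]

lemma nth_eq_getElem (l : List ℕ) (k : ℕ) (h : k < l.length) : nth l k = l[k] := by
  rw [nth_eq_getD, List.getD_eq_getElem _ _ h]

lemma testBit_maskOf {l : List ℕ} {k : ℕ} : (maskOf l).testBit k = true ↔ k ∈ l := by
  induction l with
  | nil => simp [maskOf]
  | cons a l ih =>
    change (Nat.lor (bit a) (maskOf l)).testBit k = true ↔ _
    rw [testBit_lor, Bool.or_eq_true, ih, List.mem_cons, testBit_bit, decide_eq_true_eq,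
      eq_comm]

lemma testBit_union {N : ℕ} {l : List ℕ} {k : ℕ} :
    (union N l).testBit k = true ↔ N.testBit k = true ∨ ∃ O ∈ l, O.testBit k = true := by
  induction l with
  | nil => simp [union]
  | cons a l ih =>
    change (force (union N l) fun N => Nat.lor N a).testBit k = true ↔ _
    rw [force_eq, testBit_lor, Bool.or_eq_true, ih, List.exists_mem_cons_iff, or_assoc,
      or_comm (a := a.testBit k = true)]

lemma entry_square {O N n i j : ℕ} (hO : ∀ k, O.testBit k = true → k < 16) (hj : j < 16)
    (h : entry (square O N n) i j = true) :
    entry N i j = true ∨ (O.testBit i = true ∧ O.testBit j = true) := by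
  induction n with
  | zero => exact .inl h
  | succ n ih =>
    change entry (sel (disj O (bit n)) (square O N n) (force (square O N n)
      fun N => Nat.lor N (Nat.shiftLeft O (Nat.mul 16 (Nat.succ n))))) i j = true at h
    rw [disj_bit] at h
    cases hn : O.testBit n with
    | false => rw [hn] at h; exact ih h
    | true =>
      rw [hn] at h
      simp only [Bool.not_true, sel_false, force_eq, entry_lor, Bool.or_eq_true] at h
      rcases h with h | h
      · exact ih h
      · obtain ⟨rfl, h'⟩ := entry_shift hO hj h
        exact .inr ⟨hn, h'⟩

lemma entry_squares {n N i j : ℕ} {l : List ℕ} (hl : ∀ O ∈ l, ∀ k, O.testBit k = true → k < 16)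
    (hj : j < 16) (h : entry (squares n N l) i j = true) :
    entry N i j = true ∨ ∃ O ∈ l, O.testBit i = true ∧ O.testBit j = true := by
  induction l with
  | nil => exact .inl h
  | cons O l ih =>
    change entry (sel _ (squares n N l) (force (squares n N l) fun N => square O N n)) i j =
      true at h
    rw [List.forall_mem_cons] at hl
    rw [List.exists_mem_cons_iff]
    rw [sel_eq_ite] at h
    split_ifs at h
    · rcases ih hl.2 h with h | h <;> tauto
    · rw [force_eq] at h
      rcases entry_square hl.1 hj h with h | h
      · rcases ih hl.2 h with h | h <;> tauto
      · tauto

lemma entry_column {c m N n i j : ℕ} (hc : c < 16) (hj : j < 16)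
    (h : entry (column c m N n) i j = true) :
    entry N i j = true ∨ (j = c ∧ m.testBit i = true) := by
  induction n with
  | zero => exact .inl h
  | succ n ih =>
    change entry (sel (disj m (bit n)) (column c m N n) (force (column c m N n)
      fun N => Nat.lor N (cell n c))) i j = true at h
    rw [disj_bit] at h
    cases hn : m.testBit n with
    | false => rw [hn] at h; exact ih h
    | true =>
      rw [hn] at h
      simp only [Bool.not_true, sel_false, force_eq, entry_lor, Bool.or_eq_true] at h
      rcases h with h | h
      · exact ih h
      · obtain ⟨rfl, h'⟩ := (entry_cell hc hj).1 h
        exact .inr ⟨h', hn⟩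

lemma testBit_apart {i c k : ℕ} {l : List ℕ} (h : (apart i c l).testBit k = true) :
    c.testBit k = true ∨ ∃ m ∈ l, m.testBit i = true ∧ m.testBit k = true ∧ k ≠ i := by
  induction l with
  | nil => exact .inl h
  | cons m l ih =>
    change (sel (disj m (bit i)) (apart i c l) (force (apart i c l)
      fun c => Nat.lor c (Nat.xor m (bit i)))).testBit k = true at h
    rw [List.exists_mem_cons_iff]
    rw [disj_bit] at h
    cases hi : m.testBit i with
    | false => rw [hi] at h; rcases ih h with h | h <;> tauto
    | true =>
      rw [hi] at h
      simp only [Bool.not_true, sel_false, force_eq, testBit_lor, Bool.or_eq_true] at h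
      rcases h with h | h
      · rcases ih h with h | h <;> tauto
      · change (m ^^^ bit i).testBit k = true at h
        rw [Nat.testBit_xor, testBit_bit] at h
        by_cases hk : i = k
        · subst hk; simp [hi] at h
        · exact .inr (.inl ⟨rfl, by simpa [hk] using h, Ne.symm hk⟩)

lemma mem_avoiding {e f : ℕ} {l : List ℕ} (h : f ∈ avoiding e l) : f ∈ l ∧ disj f e = true := by
  induction l with
  | nil => simp [avoiding] at h
  | cons a l ih =>
    change f ∈ sel (disj a e) (a :: avoiding e l) (avoiding e l) at h
    rw [sel_eq_ite] at h
    split_ifs at h with ha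
    · rcases List.mem_cons.1 h with rfl | h
      · exact ⟨by simp, ha⟩
      · exact ⟨by simp [ih h], (ih h).2⟩
    · exact ⟨by simp [ih h], (ih h).2⟩

lemma mem_outsideAux {U m O : ℕ} {l acc : List ℕ} (h : O ∈ outsideAux U m l acc) :
    O ∈ acc ∨ ∃ g ∈ l, disj g m = true ∧ O = diff U (Nat.lor g m) := by
  induction l with
  | nil => exact .inl h
  | cons a l ih =>
    change O ∈ sel (disj a m) (force (diff U (Nat.lor a m)) fun o => o :: outsideAux U m l acc)
      (outsideAux U m l acc) at h
    rw [List.exists_mem_cons_iff]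
    rw [sel_eq_ite, force_eq] at h
    split_ifs at h with ha
    · rcases List.mem_cons.1 h with rfl | h
      · exact .inr (.inl ⟨ha, rfl⟩)
      · rcases ih h with h | h <;> tauto
    · rcases ih h with h | h <;> tauto

lemma mem_outside {U e O : ℕ} {l : List ℕ} (h : O ∈ outside U e l) :
    ∃ f ∈ l, ∃ g ∈ l, disj g (Nat.lor f e) = true ∧ O = diff U (Nat.lor g (Nat.lor f e)) := by
  induction l with
  | nil => simp [outside] at h
  | cons a l ih =>
    change O ∈ outsideAux U (Nat.lor a e) l (outside U e l) at h
    rcases mem_outsideAux h with h | ⟨g, hg, h1, h2⟩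
    · obtain ⟨f, hf, g, hg, h⟩ := ih h
      exact ⟨f, by simp [hf], g, by simp [hg], h⟩
    · exact ⟨a, by simp, g, by simp [hg], h1, h2⟩

end Search

end MatchingBuchsbaum

/-! ### Valid states and the steps that extend them. -/

namespace MatchingBuchsbaum

variable {V : Type*}

namespace Search

/-- The state `s` describes the graph `G` with distinguished vertices `f 0, …, f (n - 1)`. -/
structure Valid (G : SimpleGraph V) (f : ℕ → V) (s : State) : Prop where
  size : s.n ≤ 16
  inj : ∀ i < s.n, ∀ j < s.n, f i = f j → i = j
  edges : ∀ e ∈ s.edges, ∃ i < s.n, ∃ j < s.n, e = Nat.lor (bit i) (bit j) ∧ G.Adj (f i) (f j)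
  -- A column index of 16 or more would address a bit of a later row.
  yes : ∀ i j, j < 16 → entry s.yes i j = true → i < s.n ∧ j < s.n ∧ G.Adj (f i) (f j)
  non : ∀ i j, j < 16 → entry s.non i j = true → i < s.n ∧ j < s.n ∧ ¬ G.Adj (f i) (f j)
  closed : ∀ i, s.closed.testBit i = true →
    i < s.n ∧ ∀ w, G.Adj (f i) w → ∃ j < s.n, w = f j
  common : ∀ c ∈ s.common, ∃ i < s.n, ∃ j < s.n, i ≠ j ∧ c = Nat.lor (bit i) (bit j) ∧
    ∀ w, G.Adj (f i) w → G.Adj (f j) w → ∃ k < s.n, w = f k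
  -- The undistinguished vertices form an independent set. This holds from the start because the
  -- initial vertices carry a matching with three edges.
  touch : ∀ v w, G.Adj v w → (∃ i < s.n, v = f i) ∨ ∃ i < s.n, w = f i

variable {G : SimpleGraph V} {f : ℕ → V} {s : State}

/-- The continuation serves only to control evaluation. This and the next four lemmas reduce every
update to the one with continuation `id`. -/
lemma addEdge_eq {α : Type} (s : State) (i j : ℕ) (k : State → α) :
    addEdge s i j k = k (addEdge s i j id) := by
  simp [addEdge]

lemma addNon_eq {α : Type} (s : State) (i j : ℕ) (k : State → α) :
    addNon s i j k = k (addNon s i j id) := by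
  simp [addNon]

lemma addClosed_eq {α : Type} (s : State) (i : ℕ) (k : State → α) :
    addClosed s i k = k (addClosed s i id) := by
  simp [addClosed]

lemma addCommon_eq {α : Type} (s : State) (i j : ℕ) (k : State → α) :
    addCommon s i j k = k (addCommon s i j id) := by
  simp [addCommon]

lemma addVertex_eq {α : Type} (s : State) (i : ℕ) (k : State → α) :
    addVertex s i k = k (addVertex s i id) := by
  simp only [addVertex, force_eq]
  rw [addEdge_eq]

@[simp] lemma addEdge_n (s : State) (i j : ℕ) : (addEdge s i j id).n = s.n := by simp [addEdge]

@[simp] lemma addVertex_n (s : State) (i : ℕ) : (addVertex s i id).n = s.n + 1 := by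
  simp only [addVertex, force_eq]
  rw [addEdge_n]

lemma apart_of_disj (hf : ∀ i < s.n, ∀ j < s.n, f i = f j → i = j) {a b c d : ℕ} (ha : a < s.n)
    (hb : b < s.n) (hc : c < s.n) (hd : d < s.n)
    (h : disj (Nat.lor (bit a) (bit b)) (Nat.lor (bit c) (bit d)) = true) :
    Apart (f a) (f b) (f c) (f d) := by
  rw [disj_iff] at h
  have h1 := h a
  have h2 := h b
  simp only [testBit_lor, testBit_bit, decide_true, Bool.true_or, Bool.or_true, true_and,
    Bool.or_eq_true, decide_eq_true_eq, not_or] at h1 h2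
  exact ⟨fun e => h1.1 (hf _ ha _ hc e).symm, fun e => h1.2 (hf _ ha _ hd e).symm,
    fun e => h2.1 (hf _ hb _ hc e).symm, fun e => h2.2 (hf _ hb _ hd e).symm⟩

/-- Outside a matching with three edges there are no further edges. -/
lemma Valid.outside (hv : Valid G f s) (hB : Bu G) {i j : ℕ} (hi : i < s.n) (hj : j < s.n)
    (hij : G.Adj (f i) (f j)) {O : ℕ}
    (hO : O ∈ outside s.full (Nat.lor (bit i) (bit j))
      (avoiding (Nat.lor (bit i) (bit j)) s.edges)) :
    (∀ k, O.testBit k = true → k < s.n) ∧ ∀ k, O.testBit k = true → ∀ w, G.Adj (f k) w →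
      ∃ l < s.n, w = f l ∧ O.testBit l = false := by
  obtain ⟨e, he, g, hg, h1, rfl⟩ := mem_outside hO
  obtain ⟨he, he'⟩ := mem_avoiding he
  obtain ⟨hg, hg'⟩ := mem_avoiding hg
  obtain ⟨a, ha, b, hb, rfl, hab⟩ := hv.edges e he
  obtain ⟨c, hc, d, hd, rfl, hcd⟩ := hv.edges g hg
  have key : ∀ k, (diff s.full (Nat.lor (Nat.lor (bit c) (bit d))
      (Nat.lor (Nat.lor (bit a) (bit b)) (Nat.lor (bit i) (bit j))))).testBit k = true ↔
      k < s.n ∧ (k ≠ c ∧ k ≠ d) ∧ (k ≠ a ∧ k ≠ b) ∧ k ≠ i ∧ k ≠ j := by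
    intro k
    simp only [testBit_diff, testBit_full, testBit_lor, testBit_bit, Bool.and_eq_true,
      decide_eq_true_eq, Bool.not_eq_true', Bool.or_eq_false_iff, decide_eq_false_iff_not]
    simp only [eq_comm (b := k), ne_eq]
  refine ⟨fun k hk => ((key k).1 hk).1, fun k hk w hw => ?_⟩
  -- Whether `w` is undistinguished or belongs to the complement again, it differs from all six
  -- matched vertices, and `{f k, w}` is a fourth disjoint edge.
  by_contra! hno
  have hk' := (key k).1 hk
  have h3 : disj (Nat.lor (bit c) (bit d)) (Nat.lor (bit a) (bit b)) = true := by
    rw [disj_iff] at h1 ⊢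
    intro k hk
    refine h1 k ⟨hk.1, ?_⟩
    rw [testBit_lor, hk.2, Bool.true_or]
  have out : ∀ l < s.n, k ≠ l → f k ≠ f l := fun l hl hne e => hne (hv.inj _ hk'.1 _ hl e)
  have out' : ∀ l < s.n, ¬ ((l ≠ c ∧ l ≠ d) ∧ (l ≠ a ∧ l ≠ b) ∧ l ≠ i ∧ l ≠ j) → w ≠ f l :=
    fun l hl hor e => hor ((key l).1 (by simpa using hno l hl e)).2
  obtain ⟨-, ⟨o1, o2⟩, ⟨o3, o4⟩, o5, o6⟩ := hk'
  refine hB.four _ _ _ _ _ _ _ _ hij hab hcd hw ?_ ?_ ?_ ?_ ?_ ?_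
  · have := apart_of_disj hv.inj ha hb hi hj he'
    exact ⟨this.1.symm, this.2.2.1.symm, this.2.1.symm, this.2.2.2.symm⟩
  · have := apart_of_disj hv.inj hc hd hi hj hg'
    exact ⟨this.1.symm, this.2.2.1.symm, this.2.1.symm, this.2.2.2.symm⟩
  · have := apart_of_disj hv.inj hc hd ha hb h3
    exact ⟨this.1.symm, this.2.2.1.symm, this.2.1.symm, this.2.2.2.symm⟩
  · exact ⟨out i hi o5, out j hj o6, out' i hi (by simp), out' j hj (by simp)⟩
  · exact ⟨out a ha o3, out b hb o4, out' a ha (by simp), out' b hb (by simp)⟩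
  · exact ⟨out c hc o1, out d hd o2, out' c hc (by simp), out' d hd (by simp)⟩

lemma Valid.addEdge (hv : Valid G f s) (hB : Bu G) {i j : ℕ} (hi : i < s.n) (hj : j < s.n)
    (hij : G.Adj (f i) (f j)) : Valid G f (addEdge s i j id) := by
  have hout := fun O => hv.outside hB hi hj hij (O := O)
  have hn := hv.size
  simp only [Search.addEdge, force_eq, id]
  constructor
  · exact hv.size
  · exact hv.inj
  · intro e he
    rcases List.mem_cons.1 he with rfl | he
    · exact ⟨i, hi, j, hj, rfl, hij⟩
    · exact hv.edges e he
  · intro a b hb h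
    simp only [entry_lor, Bool.or_eq_true, entry_cell (show j < 16 by omega) hb,
      entry_cell (show i < 16 by omega) hb] at h
    rcases h with h | ⟨rfl, rfl⟩ | ⟨rfl, rfl⟩
    · exact hv.yes a b hb h
    · exact ⟨hi, hj, hij⟩
    · exact ⟨hj, hi, hij.symm⟩
  · intro a b hb h
    rcases entry_squares (fun O hO k hk => ((hout O hO).1 k hk).trans_le hn) hb h with
      h | ⟨O, hO, h1, h2⟩
    · exact hv.non a b hb h
    · refine ⟨(hout O hO).1 _ h1, (hout O hO).1 _ h2, fun hab => ?_⟩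
      obtain ⟨l, hl, e, hl'⟩ := (hout O hO).2 _ h1 _ hab
      have := hv.inj _ ((hout O hO).1 _ h2) _ hl e
      subst this
      rw [h2] at hl'
      cases hl'
  · intro a ha
    rcases testBit_union.1 ha with h | ⟨O, hO, h1⟩
    · exact hv.closed a h
    · refine ⟨(hout O hO).1 _ h1, fun w hw => ?_⟩
      obtain ⟨l, hl, e, -⟩ := (hout O hO).2 _ h1 _ hw
      exact ⟨l, hl, e⟩
  · exact hv.common
  · exact hv.touch

lemma Valid.addNon (hv : Valid G f s) {i j : ℕ} (hi : i < s.n) (hj : j < s.n)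
    (hij : ¬ G.Adj (f i) (f j)) : Valid G f (addNon s i j id) := by
  have hn := hv.size
  simp only [Search.addNon, force_eq, id]
  refine { hv with non := fun a b hb h => ?_ }
  simp only [entry_lor, Bool.or_eq_true, entry_cell (show j < 16 by omega) hb,
    entry_cell (show i < 16 by omega) hb] at h
  rcases h with h | ⟨rfl, rfl⟩ | ⟨rfl, rfl⟩
  · exact hv.non a b hb h
  · exact ⟨hi, hj, hij⟩
  · exact ⟨hj, hi, fun h => hij h.symm⟩

lemma Valid.addClosed (hv : Valid G f s) {i : ℕ} (hi : i < s.n)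
    (h : ∀ w, G.Adj (f i) w → ∃ j < s.n, w = f j) : Valid G f (addClosed s i id) := by
  simp only [Search.addClosed, force_eq, id]
  refine { hv with closed := fun a ha => ?_ }
  simp only [testBit_lor, testBit_bit, Bool.or_eq_true, decide_eq_true_eq] at ha
  rcases ha with ha | rfl
  · exact hv.closed a ha
  · exact ⟨hi, h⟩

lemma Valid.addCommon (hv : Valid G f s) {i j : ℕ} (hi : i < s.n) (hj : j < s.n) (hij : i ≠ j)
    (h : ∀ w, G.Adj (f i) w → G.Adj (f j) w → ∃ k < s.n, w = f k) :
    Valid G f (addCommon s i j id) := by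
  simp only [Search.addCommon, force_eq, id]
  refine { hv with common := fun c hc => ?_ }
  rcases List.mem_cons.1 hc with rfl | hc
  · exact ⟨i, hi, j, hj, hij, rfl, h⟩
  · exact hv.common c hc

lemma Valid.addVertex (hv : Valid G f s) (hB : Bu G) {i : ℕ} (hi : i < s.n) (hs : s.n < 15)
    {w : V} (hw : ∀ k < s.n, w ≠ f k) (hiw : G.Adj (f i) w) :
    Valid G (Function.update f s.n w) (addVertex s i id) := by
  have hf : ∀ k < s.n, Function.update f s.n w k = f k := fun k hk =>
    Function.update_of_ne hk.ne _ _
  have hfn : Function.update f s.n w s.n = w := Function.update_self ..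
  -- An edge at the undistinguished vertex `w` must have its other end distinguished, by `touch`.
  have hclosed : ∀ v, G.Adj w v → ∃ k < s.n, v = f k := fun v hv' => by
    rcases hv.touch _ _ hv' with ⟨k, hk, e⟩ | h
    · exact absurd e (hw k hk)
    · exact h
  have hm : ∀ k, (apart i s.closed s.common).testBit k = true → k < s.n ∧ ¬ G.Adj w (f k) := by
    intro k hk
    rcases testBit_apart hk with hk | ⟨m, hm, h1, h2, h3⟩
    · refine ⟨(hv.closed k hk).1, fun h => ?_⟩
      obtain ⟨j, hj, e⟩ := (hv.closed k hk).2 _ h.symm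
      exact hw j hj e
    · obtain ⟨a, ha, b, hb, hab, rfl, hno⟩ := hv.common m hm
      simp only [testBit_lor, testBit_bit, Bool.or_eq_true, decide_eq_true_eq] at h1 h2
      have hno' : G.Adj (f a) w → G.Adj (f b) w → False := fun h h' => by
        obtain ⟨j, hj, e⟩ := hno w h h'
        exact hw j hj e
      rcases h1 with rfl | rfl <;> rcases h2 with rfl | rfl
      · exact absurd rfl h3
      · exact ⟨hb, fun h => hno' hiw h.symm⟩
      · exact ⟨ha, fun h => hno' h.symm hiw⟩
      · exact absurd rfl h3
  have hm16 : ∀ k, (apart i s.closed s.common).testBit k = true → k < 16 := fun k hk => by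
    have := (hm k hk).1
    omega
  rw [Search.addVertex]
  simp only [force_eq]
  apply Valid.addEdge _ hB (Nat.lt_succ_of_lt hi) (Nat.lt_succ_self _)
  · rw [hf i hi, hfn]; exact hiw
  constructor
  · simp only; omega
  · intro a ha b hb
    simp only at ha hb
    rcases Nat.lt_succ_iff_lt_or_eq.1 ha with ha | rfl <;>
      rcases Nat.lt_succ_iff_lt_or_eq.1 hb with hb | rfl
    · rw [hf a ha, hf b hb]; exact hv.inj a ha b hb
    · rw [hf a ha, hfn]; exact fun e => absurd e.symm (hw a ha)
    · rw [hf b hb, hfn]; exact fun e => absurd e (hw b hb)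
    · exact fun _ => rfl
  · intro e he
    obtain ⟨a, ha, b, hb, rfl, hab⟩ := hv.edges e he
    exact ⟨a, Nat.lt_succ_of_lt ha, b, Nat.lt_succ_of_lt hb, rfl, by rwa [hf a ha, hf b hb]⟩
  · intro a b hb' h
    obtain ⟨ha, hb, hab⟩ := hv.yes a b hb' h
    exact ⟨Nat.lt_succ_of_lt ha, Nat.lt_succ_of_lt hb, by rwa [hf a ha, hf b hb]⟩
  · intro a b hb' h
    simp only [entry_lor, Bool.or_eq_true] at h
    rcases h with h | h
    · rcases entry_column (show s.n < 16 by omega) hb' h with h | ⟨rfl, h'⟩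
      · obtain ⟨ha, hb, hab⟩ := hv.non a b hb' h
        exact ⟨Nat.lt_succ_of_lt ha, Nat.lt_succ_of_lt hb, by rwa [hf a ha, hf b hb]⟩
      · obtain ⟨h1, h2⟩ := hm a h'
        exact ⟨Nat.lt_succ_of_lt h1, Nat.lt_succ_self _, by
          rw [hf a h1, hfn]; exact fun h => h2 h.symm⟩
    · obtain ⟨rfl, h'⟩ := entry_shift hm16 hb' h
      obtain ⟨h1, h2⟩ := hm b h'
      exact ⟨Nat.lt_succ_self _, Nat.lt_succ_of_lt h1, by rwa [hf b h1, hfn]⟩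
  · intro a ha
    simp only [testBit_lor, testBit_bit, Bool.or_eq_true, decide_eq_true_eq] at ha
    rcases ha with ha | rfl
    · obtain ⟨h1, h2⟩ := hv.closed a ha
      refine ⟨Nat.lt_succ_of_lt h1, fun v hv' => ?_⟩
      rw [hf a h1] at hv'
      obtain ⟨j, hj, rfl⟩ := h2 v hv'
      exact ⟨j, Nat.lt_succ_of_lt hj, (hf j hj).symm⟩
    · refine ⟨Nat.lt_succ_self _, fun v hv' => ?_⟩
      rw [hfn] at hv'
      obtain ⟨j, hj, rfl⟩ := hclosed v hv'
      exact ⟨j, Nat.lt_succ_of_lt hj, (hf j hj).symm⟩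
  · intro c hc
    obtain ⟨a, ha, b, hb, hab, rfl, hno⟩ := hv.common c hc
    refine ⟨a, Nat.lt_succ_of_lt ha, b, Nat.lt_succ_of_lt hb, hab, rfl, fun v h1 h2 => ?_⟩
    rw [hf _ ha] at h1
    rw [hf _ hb] at h2
    obtain ⟨j, hj, rfl⟩ := hno v h1 h2
    exact ⟨j, Nat.lt_succ_of_lt hj, (hf j hj).symm⟩
  · intro a b hab
    rcases hv.touch a b hab with ⟨j, hj, rfl⟩ | ⟨j, hj, rfl⟩
    · exact .inl ⟨j, Nat.lt_succ_of_lt hj, (hf j hj).symm⟩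
    · exact .inr ⟨j, Nat.lt_succ_of_lt hj, (hf j hj).symm⟩

end Search

end MatchingBuchsbaum

/-! ### Soundness of the certificates. -/

namespace MatchingBuchsbaum

variable {V : Type*}

namespace Search

variable {G : SimpleGraph V} {f : ℕ → V} {s : State}

lemma Valid.adj_of_hasBit (hv : Valid G f s) {i j : ℕ} (hj : j < s.n)
    (h : hasBit s.yes i j = true) : G.Adj (f i) (f j) := by
  rw [hasBit_iff] at h
  exact (hv.yes i j (hj.trans_le hv.size) h).2.2

lemma Valid.isCopy (hv : Valid G f s) {k : ℕ} {pat : List (ℕ × ℕ)} {l : List ℕ}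
    (hpat : ∀ p ∈ pat, p.2 < k) (h : isCopy k pat s l = true) :
    l.length = k ∧ (∀ a < k, nth l a < s.n) ∧
      (∀ a < k, ∀ b < k, f (nth l a) = f (nth l b) → a = b) ∧
      ∀ p ∈ pat, G.Adj (f (nth l p.1)) (f (nth l p.2)) := by
  simp only [Search.isCopy, Bool.and_eq_true, Nat.beq_eq, nodupB_iff, allB_iff, Nat.blt_eq] at h
  obtain ⟨h1, h2, h3, h4⟩ := h
  have hlt : ∀ a < k, nth l a < s.n := fun a ha => by
    rw [nth_eq_getElem l a (by omega)]
    exact h3 _ (List.getElem_mem _)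
  refine ⟨h1, hlt, fun a ha b hb e => ?_, fun p hp => ?_⟩
  · have := hv.inj _ (hlt a ha) _ (hlt b hb) e
    rw [nth_eq_getElem l a (by omega), nth_eq_getElem l b (by omega)] at this
    exact (List.Nodup.getElem_inj_iff h2).1 this
  · exact hv.adj_of_hasBit (hlt _ (hpat p hp)) (h4 p hp)

lemma Valid.hasCopy (hv : Valid G f s) {k : ℕ} {pat : List (ℕ × ℕ)} {l : List ℕ}
    (hpat : ∀ p ∈ pat, p.2 < k) (h : certify k pat s l = true) : HasCopy G k pat := by
  cases l with
  | nil => exact absurd h Bool.false_ne_true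
  | cons a l =>
    obtain ⟨-, -, h1, h2⟩ := hv.isCopy hpat h
    exact ⟨_, h1, h2⟩

/-- By `touch` one end of the edge is distinguished. The certificate makes that end closed, so the
other end is distinguished as well, and the matrix of non-edges leaves only positions in `X`. -/
lemma Valid.isolated (hv : Valid G f s) {R X : ℕ} (h : isolated s R X = true) {u v : V}
    (huv : G.Adj u v) (hu : ∀ i < s.n, u = f i → R.testBit i = true)
    (hv' : ∀ i < s.n, v = f i → R.testBit i = true) :
    (∃ i < s.n, u = f i ∧ X.testBit i = true) ∧ ∃ i < s.n, v = f i ∧ X.testBit i = true := by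
  simp only [Search.isolated, allBelow_iff, disj_bit] at h
  have key : ∀ i < s.n, ∀ w, R.testBit i = true → G.Adj (f i) w →
      (∀ k < s.n, w = f k → R.testBit k = true) →
      X.testBit i = true ∧ ∃ k < s.n, w = f k ∧ X.testBit k = true := by
    intro i hi w hR hw hwR
    have := h i hi
    rw [hR] at this
    simp only [Bool.not_true, sel_false, Bool.not_not, Bool.and_eq_true, eq_zero_iff] at this
    obtain ⟨k, hk, rfl⟩ := (hv.closed i this.1).2 w hw
    have h2 := this.2 k
    simp only [testBit_diff, testBit_bit, hwR k hk rfl] at h2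
    have hik : i ≠ k := fun e => hw.ne (by rw [e])
    have hnon : (row s.non i).testBit k = false := by
      rw [testBit_row _ _ _ (hk.trans_le hv.size), Bool.eq_false_iff]
      exact fun h => (hv.non i k (hk.trans_le hv.size) h).2.2 hw
    rw [hnon] at h2
    cases hX : X.testBit i <;> rw [hX] at h2
    · simp [hik] at h2
    · simp [hik] at h2
      exact ⟨rfl, k, hk, rfl, h2⟩
  rcases hv.touch u v huv with ⟨i, hi, rfl⟩ | ⟨i, hi, rfl⟩
  · have := key i hi v (hu i hi rfl) huv hv'
    exact ⟨⟨i, hi, rfl, this.1⟩, this.2⟩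
  · have := key i hi u (hv' i hi rfl) huv.symm hu
    exact ⟨this.2, i, hi, rfl, this.1⟩

lemma eq_four {l : List ℕ} (h : l.length = 4) :
    l = [nth l 0, nth l 1, nth l 2, nth l 3] := by
  obtain ⟨a, b, c, d, rfl⟩ := List.length_eq_four.1 h
  rfl

/-- The third edge supplied by `extend_two` avoids the four vertices of the copy, while `isolated`
with empty `X` allows no such edge. -/
lemma Valid.not_isStuck (hv : Valid G f s) (hB : Bu G) (l : List ℕ) : isStuck s l = false := by
  rw [Bool.eq_false_iff]
  intro h
  rw [isStuck, Bool.and_eq_true] at h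
  obtain ⟨hlen, hlt, hinj, hadj⟩ := hv.isCopy (by simp) h.1
  have hne : ∀ a < 4, ∀ b < 4, a ≠ b → f (nth l a) ≠ f (nth l b) :=
    fun a ha b hb hab e => hab (hinj a ha b hb e)
  obtain ⟨x, y, hxy, hx, hy⟩ := hB.extend_two _ _ _ _ (hadj (0, 1) (by simp))
    (hadj (2, 3) (by simp)) ⟨hne 0 (by simp) 2 (by simp) (by simp),
      hne 0 (by simp) 3 (by simp) (by simp), hne 1 (by simp) 2 (by simp) (by simp),
      hne 1 (by simp) 3 (by simp) (by simp)⟩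
  have key : ∀ z, z ≠ f (nth l 0) → z ≠ f (nth l 1) → z ≠ f (nth l 2) → z ≠ f (nth l 3) →
      ∀ i < s.n, z = f i → (diff s.full (maskOf l)).testBit i = true := by
    rintro z h0 h1 h2 h3 i hi rfl
    simp only [testBit_diff, testBit_full, hi, decide_true, Bool.true_and, Bool.not_eq_true']
    rw [Bool.eq_false_iff, ne_eq, testBit_maskOf, eq_four hlen]
    intro hm
    simp only [List.mem_cons, List.not_mem_nil, or_false] at hm
    rcases hm with rfl | rfl | rfl | rfl
    exacts [h0 rfl, h1 rfl, h2 rfl, h3 rfl]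
  have := hv.isolated h.2 hxy (key x hx.1 hx.2.1 hy.1 hy.2.1)
    (key y hx.2.2.1 hx.2.2.2 hy.2.2.1 hy.2.2.2)
  obtain ⟨⟨i, -, -, h⟩, -⟩ := this
  simp at h

lemma eq_six {l : List ℕ} (h : l.length = 6) :
    l = [nth l 0, nth l 1, nth l 2, nth l 3, nth l 4, nth l 5] := by
  match l, h with
  | [a, b, c, d, e, f], _ => rfl

/-- The edge supplied by `Bu.square` leaves the four-cycle, while `isolated` confines every edge
disjoint from the fifth edge to it. -/
lemma Valid.not_isSquare (hv : Valid G f s) (hB : Bu G) (l : List ℕ) : isSquare s l = false := by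
  rw [Bool.eq_false_iff]
  intro h
  rw [isSquare, Bool.and_eq_true] at h
  obtain ⟨hlen, hlt, hinj, hadj⟩ := hv.isCopy (by simp) h.1
  have hne : ∀ a < 6, ∀ b < 6, a ≠ b → f (nth l a) ≠ f (nth l b) :=
    fun a ha b hb hab e => hab (hinj a ha b hb e)
  have hap : ∀ c < 4, ∀ d < 4, Apart (f (nth l 4)) (f (nth l 5)) (f (nth l c)) (f (nth l d)) :=
    fun c hc d hd => ⟨hne _ (by omega) _ (by omega) (by omega),
      hne _ (by omega) _ (by omega) (by omega), hne _ (by omega) _ (by omega) (by omega),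
      hne _ (by omega) _ (by omega) (by omega)⟩
  obtain ⟨u, v, huv, hap, hno⟩ := hB.square _ _ _ _ _ _ (hadj (0, 1) (by simp))
    (hadj (1, 2) (by simp)) (hadj (2, 3) (by simp)) (hadj (0, 3) (by simp))
    (hne 0 (by simp) 2 (by simp) (by simp)) (hne 1 (by simp) 3 (by simp) (by simp))
    (hadj (4, 5) (by simp)) (hap 0 (by simp) 1 (by simp)) (hap 2 (by simp) 3 (by simp))
  have key : ∀ z, z ≠ f (nth l 4) → z ≠ f (nth l 5) →
      ∀ i < s.n, z = f i → (diff s.full (maskOf (l.drop 4))).testBit i = true := by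
    rintro z h0 h1 i hi rfl
    simp only [testBit_diff, testBit_full, hi, decide_true, Bool.true_and, Bool.not_eq_true']
    rw [Bool.eq_false_iff, ne_eq, testBit_maskOf, eq_six hlen]
    intro hm
    simp only [List.drop_succ_cons, List.drop_zero, List.mem_cons, List.not_mem_nil,
      or_false] at hm
    rcases hm with rfl | rfl
    exacts [h0 rfl, h1 rfl]
  have key' : ∀ i, (maskOf (l.take 4)).testBit i = true → f i = f (nth l 0) ∨ f i = f (nth l 1) ∨
      f i = f (nth l 2) ∨ f i = f (nth l 3) := by
    intro i hi
    rw [testBit_maskOf, eq_six hlen] at hi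
    simp only [List.take_succ_cons, List.take_zero, List.mem_cons, List.not_mem_nil,
      or_false] at hi
    rcases hi with rfl | rfl | rfl | rfl <;> simp
  obtain ⟨⟨i, -, rfl, h1⟩, ⟨j, -, rfl, h2⟩⟩ := hv.isolated h.2 huv (key u hap.1 hap.2.1)
    (key v hap.2.2.1 hap.2.2.2)
  exact hno ⟨key' i h1, key' j h2⟩

lemma matchRow_cons (Y N c w : ℕ) (r ws : List ℕ) : matchRow Y N (c :: r) (w :: ws) = true ↔
    (c = 0 → Y.testBit w = true) ∧ (2 ≤ c → N.testBit w = true) ∧ matchRow Y N r ws = true := by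
  change Nat.rec (sel (disj Y (bit w)) false (matchRow Y N r ws)) (fun c _ =>
      Nat.rec (matchRow Y N r ws) (fun _ _ => sel (disj N (bit w)) false (matchRow Y N r ws)) c) c
      = true ↔ _
  match c with
  | 0 => cases h : Y.testBit w <;> simp [disj_bit, h]
  | 1 => simp
  | c + 2 => cases h : N.testBit w <;> simp [disj_bit, h]

lemma matchRow_spec {Y N : ℕ} {r ws : List ℕ} (hlen : ws.length = r.length)
    (h : matchRow Y N r ws = true) (k : ℕ) (hk : k < ws.length) :
    (nth r k = 0 → Y.testBit (nth ws k) = true) ∧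
      (2 ≤ nth r k → N.testBit (nth ws k) = true) := by
  induction r generalizing ws k with
  | nil => simp_all
  | cons c r ih =>
    cases ws with
    | nil => simp at hlen
    | cons w ws =>
      rw [matchRow_cons] at h
      cases k with
      | zero => exact ⟨h.1, h.2.1⟩
      | succ k => exact ih (by simpa using hlen) h.2.2 k (by simpa using hk)

lemma matchCodes_cons (r : List ℕ) (rs : List (List ℕ)) (used v : ℕ) (vs : List ℕ) :
    matchCodes s (r :: rs) used (v :: vs) = true ↔ v < s.n ∧ used.testBit v = false ∧
      matchRow (row s.yes v) (row s.non v) r vs = true ∧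
      matchCodes s rs (Nat.lor used (bit v)) vs = true := by
  change (force (bit v) fun b => sel (Nat.blt v s.n && disj used b)
      (force (row s.yes v) fun Y => force (row s.non v) fun N =>
        sel (matchRow Y N r vs) (force (Nat.lor used b) fun u => matchCodes s rs u vs) false)
        false) = true ↔ _
  simp only [force_eq, sel_eq_ite, disj_bit]
  split_ifs with h1 h2
  · simp only [Bool.and_eq_true, Nat.blt_eq, Bool.not_eq_true'] at h1
    simp [h1, h2]
  · simp [h2]
  · simp only [Bool.and_eq_true, Nat.blt_eq, Bool.not_eq_true'] at h1
    simp only [false_iff]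
    tauto

lemma matchCodes_spec (X : Pattern) {idx l : List ℕ} {used : ℕ}
    (h : matchCodes s (codes X idx) used l = true) :
    l.length = idx.length ∧ (∀ a < idx.length, nth l a < s.n ∧ used.testBit (nth l a) = false) ∧
      ∀ a b, a < b → b < idx.length → nth l a ≠ nth l b ∧
        (X.code (nth idx a) (nth idx b) = 0 →
          (row s.yes (nth l a)).testBit (nth l b) = true) ∧
        (X.code (nth idx a) (nth idx b) = 2 →
          (row s.non (nth l a)).testBit (nth l b) = true) := by
  induction idx generalizing used l with
  | nil =>
    cases l with
    | nil => simp
    | cons a l => exact absurd h Bool.false_ne_true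
  | cons i idx ih =>
    change matchCodes s (idx.map (X.code i) :: codes X idx) used l = true at h
    cases l with
    | nil => exact absurd h Bool.false_ne_true
    | cons v vs =>
      rw [matchCodes_cons] at h
      obtain ⟨h1, h2, h3, h4⟩ := h
      obtain ⟨i1, i2, i3⟩ := ih h4
      refine ⟨by simp [i1], ?_, ?_⟩
      · rintro (_ | a) ha
        · exact ⟨h1, h2⟩
        · have := i2 a (by simpa using ha)
          simp only [testBit_lor, Bool.or_eq_false_iff] at this
          exact ⟨this.1, this.2.1⟩
      · rintro (_ | a) (_ | b) hab hb
        · simp at hab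
        · have hb' : b < idx.length := by simpa using hb
          have := matchRow_spec (by simp [i1]) h3 b (by omega)
          have e : nth (List.map (X.code i) idx) b = X.code i (nth idx b) := by
            rw [nth_eq_getElem _ _ (by simpa using hb'), nth_eq_getElem _ _ hb', List.getElem_map]
          rw [e] at this
          have hne := (i2 b hb').2
          simp only [testBit_lor, Bool.or_eq_false_iff, testBit_bit,
            decide_eq_false_iff_not] at hne
          refine ⟨hne.2, this.1, fun h => this.2 ?_⟩
          simp only [nth_cons_zero, nth_cons_succ] at h
          omega
        · simp at hab
        · exact i3 a b (by simpa using hab) (by simpa using hb)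

/-- A distinguished vertex outside the pattern is closed and its possible neighbours lie in one
block. An undistinguished one is joined only to open vertices, which all lie in blocks; the list
`common` prevents it from meeting two blocks. -/
lemma Valid.isPlacement (hv : Valid G f s) (hG : ∀ v, ∃ w, G.Adj v w) {X : Pattern} {l : List ℕ}
    (h : isPlacement X s l = true) : X.Realizes G := by
  simp only [Search.isPlacement, force_eq, Bool.and_eq_true, isSpread] at h
  obtain ⟨h1, h2, h3, h4⟩ := h
  have hnth : ∀ a < X.size, nth (List.range X.size) a = a := fun a ha => by
    rw [nth_eq_getElem _ _ (by simpa using ha), List.getElem_range]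
  obtain ⟨hlen, hlt, hpair⟩ := matchCodes_spec X h1
  rw [List.length_range] at hlen hlt hpair
  have h16 : ∀ a < X.size, nth l a < 16 := fun a ha => (hlt a ha).1.trans_le hv.size
  have hmem : ∀ k, k ∈ l ↔ ∃ a < X.size, nth l a = k := by
    intro k
    rw [List.mem_iff_getElem]
    constructor
    · rintro ⟨a, ha, rfl⟩
      exact ⟨a, by omega, nth_eq_getElem _ _ _⟩
    · rintro ⟨a, ha, rfl⟩
      exact ⟨a, by omega, (nth_eq_getElem _ _ _).symm⟩
  have hblock : ∀ (b : List ℕ) k, (maskOf (b.map (nth l))).testBit k = true ↔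
      ∃ a ∈ b, nth l a = k := fun b k => by rw [testBit_maskOf, List.mem_map]
  refine ⟨fun a => f (nth l a), ?_, ?_, ?_⟩
  · intro a ha b hb e
    have := hv.inj _ (hlt a ha).1 _ (hlt b hb).1 e
    by_contra hab
    rcases Nat.lt_or_gt_of_ne hab with h | h
    · exact (hpair a b h hb).1 this
    · exact (hpair b a h ha).1 this.symm
  · intro a b hab hb
    have := (hpair a b hab hb).2
    rw [hnth a (hab.trans hb), hnth b hb, testBit_row _ _ _ (h16 b hb),
      testBit_row _ _ _ (h16 b hb)] at this
    exact ⟨fun h => (hv.yes _ _ (h16 b hb) (this.1 h)).2.2,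
      fun h => (hv.non _ _ (h16 b hb) (this.2 h)).2.2⟩
  · intro w hw
    refine ⟨hG w, ?_⟩
    have hopen : ∀ i < s.n, s.closed.testBit i = false →
        ∃ b ∈ X.attach, ∃ a ∈ b, nth l a = i := by
      intro i hi hc
      have := eq_zero_iff.1 h2 i
      rw [testBit_diff, testBit_diff, testBit_full, hc] at this
      simp only [hi, decide_true, Bool.not_false, Bool.and_self, Bool.true_and,
        Bool.not_eq_false'] at this
      rcases testBit_union.1 this with h | ⟨O, hO, h⟩
      · simp at h
      · obtain ⟨b, hb, rfl⟩ := List.mem_map.1 hO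
        exact ⟨b, hb, (hblock b i).1 h⟩
    by_cases hdist : ∃ i < s.n, w = f i
    · obtain ⟨i, hi, rfl⟩ := hdist
      have him : (maskOf l).testBit i = false := by
        rw [Bool.eq_false_iff, ne_eq, testBit_maskOf, hmem]
        rintro ⟨a, ha, rfl⟩
        exact hw a ha rfl
      rw [Bool.or_eq_true, Nat.beq_eq, allBelow_iff] at h3
      rcases h3 with h3 | h3
      · rw [h3, testBit_full] at him
        simp [hi] at him
      · have := h3 i hi
        rw [disj_bit, him, Bool.not_false, sel_true, Bool.and_eq_true, disj_bit,
          Bool.not_not, anyB_iff] at this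
        obtain ⟨hc, B, hB, hB'⟩ := this
        obtain ⟨b, hb, rfl⟩ := List.mem_map.1 hB
        refine ⟨b, hb, fun v hiv => ?_⟩
        obtain ⟨k, hk, rfl⟩ := (hv.closed i hc).2 v hiv
        have hz := eq_zero_iff.1 hB' k
        have hnon : (row s.non i).testBit k = false := by
          rw [testBit_row _ _ _ (hk.trans_le hv.size), Bool.eq_false_iff]
          exact fun h => (hv.non i k (hk.trans_le hv.size) h).2.2 hiv
        have hik : i ≠ k := fun e => hiv.ne (by rw [e])
        simp only [testBit_diff, testBit_full, hk, hnon, testBit_bit, hik, decide_true,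
          decide_false, Bool.not_false, Bool.and_self, Bool.true_and, Bool.not_eq_false'] at hz
        obtain ⟨a, ha, rfl⟩ := (hblock b k).1 hz
        exact ⟨a, ha, rfl⟩
    · push Not at hdist
      have hnb : ∀ v, G.Adj w v → ∃ i < s.n, v = f i ∧ s.closed.testBit i = false := by
        intro v hwv
        rcases hv.touch w v hwv with ⟨i, hi, e⟩ | ⟨i, hi, rfl⟩
        · exact absurd e (hdist i hi)
        · refine ⟨i, hi, rfl, ?_⟩
          rw [Bool.eq_false_iff]
          intro hc
          obtain ⟨j, hj, e⟩ := (hv.closed i hc).2 w hwv.symm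
          exact hdist j hj e
      obtain ⟨v₀, hv₀⟩ := hG w
      obtain ⟨i₀, hi₀, rfl, hc₀⟩ := hnb v₀ hv₀
      -- The block of one neighbour is fixed; every other neighbour must be shown to lie in it.
      obtain ⟨b, hb, a₀, ha₀, rfl⟩ := hopen i₀ hi₀ hc₀
      refine ⟨b, hb, fun v hwv => ?_⟩
      obtain ⟨i, hi, rfl, hc⟩ := hnb v hwv
      obtain ⟨c, hc', a, ha, rfl⟩ := hopen i hi hc
      have hbc := allB_iff.1 (allB_iff.1 h4 _ (List.mem_map_of_mem hb)) _
        (List.mem_map_of_mem hc')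
      rw [Bool.or_eq_true, Nat.beq_eq, allBelow_iff] at hbc
      rcases hbc with hbc | hbc
      · obtain ⟨a', ha', e⟩ := (hblock b (nth l a)).1
          (by rw [hbc]; exact (hblock c _).2 ⟨a, ha, rfl⟩)
        exact ⟨a', ha', (congrArg f e).symm⟩
      · have hbc := hbc (nth l a₀) hi₀
        rw [disj_bit, disj_bit, hc₀, (hblock b _).2 ⟨a₀, ha₀, rfl⟩] at hbc
        simp only [Bool.not_true, Bool.not_false, Bool.false_or, allBelow_iff] at hbc
        have hbc := hbc (nth l a) hi
        rw [disj_bit, disj_bit, hc, (hblock c _).2 ⟨a, ha, rfl⟩] at hbc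
        simp only [Bool.not_true, Bool.not_false, Bool.false_or, memB_iff] at hbc
        by_cases haa : nth l a₀ = nth l a
        · exact ⟨a₀, ha₀, (congrArg f haa).symm⟩
        -- The two neighbours form a recorded pair without common undistinguished neighbour, but `w`
        -- is one.
        obtain ⟨i, hi, j, hj, hij, e, hno⟩ := hv.common _ hbc
        exfalso
        have e1 := congrArg (fun m => m.testBit i) e
        have e2 := congrArg (fun m => m.testBit j) e
        simp only [testBit_lor, testBit_bit, decide_true, Bool.true_or, Bool.or_true,
          Bool.or_eq_true, decide_eq_true_eq] at e1 e2
        have : G.Adj (f i) w ∧ G.Adj (f j) w := by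
          rcases e1 with rfl | rfl <;> rcases e2 with rfl | rfl
          · exact absurd rfl hij
          · exact ⟨hv₀.symm, hwv.symm⟩
          · exact ⟨hwv.symm, hv₀.symm⟩
          · exact absurd rfl hij
        obtain ⟨k, hk, e⟩ := hno w this.1 this.2
        exact hdist k hk e

end Search

end MatchingBuchsbaum

/-! ### Soundness of branching and of the whole search. -/

namespace MatchingBuchsbaum

variable {V : Type*}

namespace Search

variable {G : SimpleGraph V} {f : ℕ → V} {s : State}

/-- The assumptions of the search at the given level. -/
structure Admissible (G : SimpleGraph V) (level : ℕ) : Prop where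
  bu : Bu G
  cover : ∀ v, ∃ w, G.Adj v w
  seven : ¬ HasCopy G 7 cycleSeven
  five : 1 ≤ level → ¬ HasCopy G 7 cycleFiveEdge
  three : 2 ≤ level → ¬ HasCopy G 7 triangleEdges

variable {level : ℕ} {Ts : List Target} {goal : Prop}

lemma Valid.not_isExcluded (hA : Admissible G level) (hv : Valid G f s) (v w : ℕ) :
    isExcluded level s v w = false := by
  rw [Bool.eq_false_iff]
  intro h
  simp only [isExcluded, force_eq, sel_eq_ite] at h
  split_ifs at h with h1 h2 h3 h4
  · exact hA.seven (hv.hasCopy (by decide) h1)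
  · rw [Nat.ble_eq] at h2
    exact hA.five (by omega) (hv.hasCopy (by decide) h3)
  · rw [Nat.ble_eq] at h4
    exact hA.three (by omega) (hv.hasCopy (by decide) h)

/-- Each choice is a true dichotomy for `G`, so one of the two new states is valid. The positive one
is omitted only if it contains an excluded graph, and a valid state contains none. If the guard on
the indices fails, the state is returned unchanged. -/
lemma Valid.branch (hA : Admissible G level) (hv : Valid G f s) (c : Choice)
    (h : ∀ t ∈ branch level s c, ∀ f', Valid G f' t → goal) : goal := by
  cases c with
  | none => exact h s (by simp [Search.branch]) f hv
  | edge i j =>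
    simp only [Search.branch, sel_eq_ite] at h
    split_ifs at h with hij
    · simp only [Bool.and_eq_true, Nat.blt_eq] at hij
      rw [addEdge_eq] at h
      by_cases hadj : G.Adj (f i) (f j)
      · have hv' := hv.addEdge hA.bu hij.1 (hij.2.trans hij.1) hadj
        rw [if_neg (by rw [hv'.not_isExcluded hA]; simp)] at h
        exact h _ (by simp) f hv'
      · have hv' := hv.addNon hij.1 (hij.2.trans hij.1) hadj
        rw [addNon_eq] at h
        refine h _ ?_ f hv'
        split_ifs <;> simp
    · exact h s (by simp) f hv
  | vertex i =>
    simp only [Search.branch, sel_eq_ite] at h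
    split_ifs at h with hij
    · simp only [Bool.and_eq_true, Nat.blt_eq] at hij
      rw [addVertex_eq] at h
      by_cases hw : ∃ w, G.Adj (f i) w ∧ ∀ k < s.n, w ≠ f k
      · obtain ⟨w, hw, hw'⟩ := hw
        have hv' := hv.addVertex hA.bu hij.1 hij.2 hw' hw
        rw [if_neg (by rw [hv'.not_isExcluded hA]; simp)] at h
        exact h _ (by simp) _ hv'
      · push Not at hw
        have hv' := hv.addClosed hij.1 hw
        rw [addClosed_eq] at h
        refine h _ ?_ f hv'
        split_ifs <;> simp
    · exact h s (by simp) f hv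
  | common i j =>
    simp only [Search.branch, sel_eq_ite] at h
    split_ifs at h with hij
    · simp only [Bool.and_eq_true, Nat.blt_eq] at hij
      obtain ⟨hij, hj, hs⟩ := hij
      rw [addVertex_eq, addEdge_eq] at h
      by_cases hw : ∃ w, G.Adj (f i) w ∧ G.Adj (f j) w ∧ ∀ k < s.n, w ≠ f k
      · obtain ⟨w, hw, hwj, hw'⟩ := hw
        have hv' := (hv.addVertex hA.bu (hij.trans hj) hs hw' hw).addEdge hA.bu (i := j) (j := s.n)
          (by rw [addVertex_n]; omega) (by rw [addVertex_n]; omega)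
          (by rwa [Function.update_self, Function.update_of_ne hj.ne])
        rw [if_neg (by rw [hv'.not_isExcluded hA]; simp)] at h
        exact h _ (by simp) _ hv'
      · push Not at hw
        have hv' := hv.addCommon (hij.trans hj) hj hij.ne hw
        rw [addCommon_eq] at h
        refine h _ ?_ f hv'
        split_ifs <;> simp
    · exact h s (by simp) f hv

lemma firstBit_eq_nil {p : ℕ → List ℕ} (hp : ∀ v, p v = []) (m : ℕ) : firstBit m p = [] := by
  rw [firstBit]
  generalize 16 = k
  induction k generalizing m with
  | zero => rfl
  | succ k ih =>
    dsimp only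
    rw [sel_eq_ite]
    split_ifs
    · rfl
    · rw [force_eq, force_eq, hp]
      exact ih _

/-- Only the final test inside `place` matters for soundness: if it always fails, nothing is found,
however the candidates were computed. -/
lemma place_eq_nil {fin : List ℕ → List ℕ} (hfin : ∀ l, fin l = []) (Y : ℕ) (ts : List Slot)
    (D : ℕ) (l : List ℕ) : place Y fin ts D l = [] := by
  induction ts generalizing D l with
  | nil => exact hfin l
  | cons t ts ih =>
    change (force (Nat.shiftRight D 16) fun D' =>
      firstBit (Nat.land D 65535) fun v => force (rowOf Y v) fun r =>
      force (diff (Nat.land D' (Nat.add (Nat.mul t.solid r) (Nat.add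
      (Nat.mul t.blank (Nat.xor r 65535)) t.loose)))
      (Nat.mul 22301085486089920167905467806764065303363585 v)) fun D' =>
        place Y fin ts D' (v :: l)) = []
    rw [force_eq]
    exact firstBit_eq_nil (fun v => by rw [force_eq, force_eq, ih]) _

lemma forceList_eq (l : List ℕ) (k : List ℕ → List ℕ) : forceList l k = k l := by
  induction l generalizing k with
  | nil => rfl
  | cons a l ih =>
    change (force a fun a => forceList l fun l => k (a :: l)) = _
    rw [force_eq, ih]

lemma Valid.accept (hA : Admissible G level) (hv : Valid G f s)
    (hT : ∀ T ∈ Ts, T.pat.Realizes G → goal) (h : accept Ts s = true) : goal := by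
  simp only [Search.accept, force_eq] at h
  generalize degrees s.yes s.n = deg at h
  generalize popcount (diff s.full s.closed) = o at h
  induction Ts with
  | nil => exact absurd h Bool.false_ne_true
  | cons T Ts ih =>
    rw [List.forall_mem_cons] at hT
    change sel (Nat.ble T.pat.size s.n && Nat.ble o T.frees)
      (force (domains s.closed deg s.n T.slots) fun D =>
        List.rec (acceptAny s s.yes deg o Ts) (fun _ _ _ => true)
          (place s.yes (fun l =>
            forceList (l.reverse.map index) fun l' => forceList (T.pos.map (nth l')) fun l' =>
            sel (Search.isPlacement T.pat s l') l []) T.slots D []))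
      (acceptAny s s.yes deg o Ts) = true at h
    rw [sel_eq_ite, force_eq] at h
    split_ifs at h
    · by_cases hp : ∃ l, Search.isPlacement T.pat s l = true
      · obtain ⟨l, hl⟩ := hp
        exact hT.1 (hv.isPlacement hA.cover hl)
      · push Not at hp
        rw [place_eq_nil (fun l => by simp [forceList_eq, hp])] at h
        exact ih hT.2 h
    · exact ih hT.2 h

/-- The output is empty, the state itself, or a branching. Returning the state claims nothing. An
empty list arises from a certificate that is impossible for a valid state, or from an accepted
pattern, which gives the goal. -/
lemma Valid.expand (hA : Admissible G level) (hv : Valid G f s)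
    (hT : ∀ T ∈ Ts, T.pat.Realizes G → goal)
    (h : ∀ t ∈ expand level Ts s, ∀ f', Valid G f' t → goal) : goal := by
  have hor : ∀ (c : Choice) (a : List State) (b : Choice → List State),
      orIfNone c a b = a ∨ orIfNone c a b = b c := by
    intro c a b
    cases c <;> simp [orIfNone]
  have hself : ∀ l : List State, (l = [s] ∨ ∃ c, l = Search.branch level s c) →
      (∀ t ∈ l, ∀ f', Valid G f' t → goal) → goal := by
    rintro l (rfl | ⟨c, rfl⟩) h
    · exact h s (by simp) f hv
    · exact hv.branch hA c h
  simp only [Search.expand, force_eq, hv.not_isStuck hA.bu, hv.not_isSquare hA.bu, sel_false] at h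
  split at h
  · rcases hor (openEdge s.yes s.non s.full s.n) _ (Search.branch level s) with e | e <;>
      rw [e] at h
    · split at h
      · by_cases htri : (Nat.ble 2 level &&
            certify 7 triangleEdges s (findTriangle s.yes s.edges s.edges)) = true
        · rw [Bool.and_eq_true, Nat.ble_eq] at htri
          exact absurd (hv.hasCopy (by decide) htri.2) (hA.three htri.1)
        · by_cases hacc : Search.accept Ts s = true
          · exact hv.accept hA hT hacc
          · rw [Bool.not_eq_true] at htri hacc
            rw [htri, hacc] at h
            exact hself _ (.inr ⟨_, rfl⟩) h
      · refine hself _ ?_ h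
        rcases hor (openVertex s.closed _) [s] (Search.branch level s) with e | e
        · exact .inl e
        · exact .inr ⟨_, e⟩
    · exact hself _ (.inr ⟨_, rfl⟩) h
  · refine hself _ ?_ h
    rename_i a b _ _
    rcases hor (openEdge s.yes s.non _ s.n) (orIfNone (openVertex s.closed (diff s.full
      (Nat.lor (Nat.land a 65535) (Nat.land b 65535)))) [s] (Search.branch level s))
      (Search.branch level s) with e | e
    · rw [e]
      rcases hor (openVertex s.closed _) [s] (Search.branch level s) with e | e
      · exact .inl e
      · exact .inr ⟨_, e⟩
    · exact .inr ⟨_, e⟩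

lemma Valid.search (hA : Admissible G level) (hv : Valid G f s)
    (hT : ∀ T ∈ Ts, T.pat.Realizes G → goal) {fuel : ℕ} (h : search level Ts fuel s = true) :
    goal := by
  induction fuel generalizing f s with
  | zero => exact absurd h Bool.false_ne_true
  | succ fuel ih =>
    exact hv.expand hA hT fun t ht f' hv' => ih hv' (allB_iff.1 h t ht)

lemma Valid.frontier (hA : Admissible G level) (hv : Valid G f s)
    (hT : ∀ T ∈ Ts, T.pat.Realizes G → goal) (d : ℕ)
    (h : ∀ t ∈ frontier level Ts d s, ∀ f', Valid G f' t → goal) : goal := by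
  induction d with
  | zero => exact h s (by simp [Search.frontier]) f hv
  | succ d ih =>
    refine ih fun t ht f' hv' => hv'.expand hA hT fun u hu f'' hv'' => h u ?_ f'' hv''
    change u ∈ (Search.frontier level Ts d s).flatMap (Search.expand level Ts)
    exact List.mem_flatMap.2 ⟨t, ht, hu⟩

lemma valid_start (hB : Bu G) {n closed : ℕ} {es : List (ℕ × ℕ)} (hn : n ≤ 16)
    (hf : ∀ i < n, ∀ j < n, f i = f j → i = j)
    (hes : ∀ p ∈ es, p.1 < n ∧ p.2 < n ∧ G.Adj (f p.1) (f p.2))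
    (hclosed : ∀ i, closed.testBit i = true → i < n ∧ ∀ w, G.Adj (f i) w → ∃ j < n, w = f j)
    (htouch : ∀ v w, G.Adj v w → (∃ i < n, v = f i) ∨ ∃ i < n, w = f i) :
    Valid G f (start n closed es) := by
  have hsize : ∀ es, (start n closed es).n = n := by
    intro es
    induction es with
    | nil => rfl
    | cons p es ih => exact (addEdge_n (start n closed es) p.1 p.2).trans ih
  induction es with
  | nil =>
    exact ⟨hn, hf, by simp [start], fun i j _ h => by simp [start, entry] at h,
      fun i j _ h => by simp [start, entry] at h, hclosed, by simp [start], htouch⟩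
  | cons p es ih =>
    rw [List.forall_mem_cons] at hes
    exact (ih hes.2).addEdge hB (by rw [hsize]; exact hes.1.1) (by rw [hsize]; exact hes.1.2.1)
      hes.1.2.2

end Search

end MatchingBuchsbaum

namespace MatchingBuchsbaum

variable {V : Type*}

/-! ### The Buchsbaum property in terms of edges -/

/-- The edges `e` and `f` have no common end. -/
def EdgeApart (e f : Sym2 V) : Prop := ∀ v, v ∈ e → v ∉ f

lemma EdgeApart.symm {e f : Sym2 V} (h : EdgeApart e f) : EdgeApart f e :=
  fun v hf he => h v he hf

lemma edgeApart_mk {a b c d : V} : EdgeApart s(a, b) s(c, d) ↔ Apart a b c d := by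
  simp only [EdgeApart, Apart, Sym2.mem_iff]
  constructor
  · intro h
    have h1 := h a (.inl rfl)
    have h2 := h b (.inr rfl)
    tauto
  · rintro ⟨h1, h2, h3, h4⟩ v (rfl | rfl) (rfl | rfl) <;> contradiction

lemma EdgeApart.ne {e f : Sym2 V} (h : EdgeApart e f) : e ≠ f := by
  rintro rfl
  induction e with | _ a b => exact h a (by simp) (by simp)

lemma IsMatching.mono {G : SimpleGraph V} {s t : Finset (Sym2 V)} (h : IsMatching G t)
    (hs : s ⊆ t) : IsMatching G s :=
  ⟨fun e he => h.1 e (hs he), fun e he f hf => h.2 e (hs he) f (hs hf)⟩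

lemma IsMatching.edgeApart {G : SimpleGraph V} {s : Finset (Sym2 V)} (h : IsMatching G s)
    {e f : Sym2 V} (he : e ∈ s) (hf : f ∈ s) (hne : e ≠ f) : EdgeApart e f :=
  fun v hv hv' => hne (h.2 e he f hf v hv hv')

lemma isMatching_singleton {G : SimpleGraph V} {e : Sym2 V} (he : e ∈ G.edgeSet) :
    IsMatching G {e} :=
  ⟨by simpa using he, by simp_all⟩

lemma mem_matchingComplex {G : SimpleGraph V} {s : Finset (Sym2 V)} :
    s ∈ matchingComplex G ↔ s.Nonempty ∧ IsMatching G s := Iff.rfl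

lemma Bu.card_le {G : SimpleGraph V} (hB : Bu G) {s : Finset (Sym2 V)} (hs : IsMatching G s) :
    s.card ≤ 3 := by
  classical
  by_contra! hlt
  obtain ⟨e, he⟩ : s.Nonempty := Finset.card_pos.1 (by omega)
  obtain ⟨f, g, h, hf, hg, hh, h1, h2, h3⟩ :=
    (Finset.two_lt_card_iff (s := s.erase e)).1 (by rw [Finset.card_erase_of_mem he]; omega)
  rw [Finset.mem_erase] at hf hg hh
  have a1 := hs.edgeApart hf.2 hg.2 h1
  have a2 := hs.edgeApart hf.2 hh.2 h2
  have a3 := hs.edgeApart hg.2 hh.2 h3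
  have a4 := hs.edgeApart he hf.2 hf.1.symm
  have a5 := hs.edgeApart he hg.2 hg.1.symm
  have a6 := hs.edgeApart he hh.2 hh.1.symm
  have e1 := hs.1 e he
  have e2 := hs.1 f hf.2
  have e3 := hs.1 g hg.2
  have e4 := hs.1 h hh.2
  clear hf hg hh he h1 h2 h3
  induction e with | _ a b =>
  induction f with | _ c d =>
  induction g with | _ i j =>
  induction h with | _ k l =>
  simp only [edgeApart_mk] at a1 a2 a3 a4 a5 a6
  exact hB.four _ _ _ _ _ _ _ _ e2 e3 e4 e1 a1 a2 a3 a4 a5 a6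

lemma Bu.exists_one {G : SimpleGraph V} (hB : Bu G) {e : Sym2 V} (he : e ∈ G.edgeSet) :
    ∃ f ∈ G.edgeSet, EdgeApart e f := by
  induction e with | _ a b =>
  obtain ⟨c, d, h, h'⟩ := hB.extend_one a b he
  exact ⟨s(c, d), h, edgeApart_mk.2 h'⟩

lemma Bu.exists_two {G : SimpleGraph V} (hB : Bu G) {e f : Sym2 V} (he : e ∈ G.edgeSet)
    (hf : f ∈ G.edgeSet) (hef : EdgeApart e f) :
    ∃ g ∈ G.edgeSet, EdgeApart e g ∧ EdgeApart f g := by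
  induction e with | _ a b =>
  induction f with | _ c d =>
  obtain ⟨x, y, h, h1, h2⟩ := hB.extend_two a b c d he hf (edgeApart_mk.1 hef)
  exact ⟨s(x, y), h, (edgeApart_mk.2 h1).symm, (edgeApart_mk.2 h2).symm⟩

variable [DecidableEq V] {G : SimpleGraph V}

lemma isMatching_insert {e : Sym2 V} {s : Finset (Sym2 V)} (he : e ∈ G.edgeSet)
    (hs : IsMatching G s) (h : ∀ f ∈ s, EdgeApart e f) : IsMatching G (insert e s) := by
  refine ⟨fun f hf => ?_, fun f hf g hg v hv hv' => ?_⟩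
  · rcases Finset.mem_insert.1 hf with rfl | hf
    exacts [he, hs.1 f hf]
  · rcases Finset.mem_insert.1 hf with rfl | hf' <;> rcases Finset.mem_insert.1 hg with rfl | hg'
    · rfl
    · exact absurd hv' (h g hg' v hv)
    · exact absurd hv (h f hf' v hv')
    · exact hs.2 f hf' g hg' v hv hv'

lemma isMatching_pair {e f : Sym2 V} (he : e ∈ G.edgeSet) (hf : f ∈ G.edgeSet)
    (h : EdgeApart e f) : IsMatching G {e, f} :=
  isMatching_insert he (isMatching_singleton hf) (by simpa using h)

lemma isMatching_triple {e f g : Sym2 V} (he : e ∈ G.edgeSet) (hf : f ∈ G.edgeSet)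
    (hg : g ∈ G.edgeSet) (h1 : EdgeApart e f) (h2 : EdgeApart e g) (h3 : EdgeApart f g) :
    IsMatching G {e, f, g} :=
  isMatching_insert he (isMatching_pair hf hg h3) (by simpa using ⟨h1, h2⟩)

lemma mem_link {e : Sym2 V} {s : Finset (Sym2 V)} :
    s ∈ link (matchingComplex G) {e} ↔ s.Nonempty ∧ IsMatching G (insert e s) ∧ e ∉ s := by
  change (s ∈ matchingComplex G ∧ s ∪ {e} ∈ matchingComplex G ∧ Disjoint s {e}) ↔ _
  rw [mem_matchingComplex, mem_matchingComplex, Finset.disjoint_singleton_right,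
    Finset.union_comm, ← Finset.insert_eq]
  exact ⟨fun h => ⟨h.1.1, h.2.1.2, h.2.2⟩, fun h => ⟨⟨h.1, h.2.1.mono (Finset.subset_insert _ _)⟩,
    ⟨Finset.insert_nonempty _ _, h.2.1⟩, h.2.2⟩⟩

lemma singleton_mem_link {e x : Sym2 V} (he : e ∈ G.edgeSet) :
    {x} ∈ link (matchingComplex G) {e} ↔ x ∈ G.edgeSet ∧ EdgeApart e x := by
  rw [mem_link]
  constructor
  · rintro ⟨-, h, hne⟩
    exact ⟨h.1 x (by simp), h.edgeApart (by simp) (by simp) (by simpa using hne)⟩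
  · rintro ⟨hx, h⟩
    exact ⟨by simp, isMatching_pair he hx h, by simpa using h.ne⟩

lemma skeleton_adj {e : Sym2 V} (he : e ∈ G.edgeSet)
    {x y : {x : Sym2 V // {x} ∈ link (matchingComplex G) {e}}} :
    (oneSkeleton (link (matchingComplex G) {e})).Adj x y ↔ EdgeApart x.1 y.1 := by
  obtain ⟨x, hx⟩ := x
  obtain ⟨y, hy⟩ := y
  rw [singleton_mem_link he] at hx hy
  change (_ ≠ _ ∧ ({x, y} : Finset (Sym2 V)) ∈ link (matchingComplex G) {e}) ↔ _
  rw [mem_link]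
  constructor
  · rintro ⟨hne, -, h, -⟩
    exact h.edgeApart (by simp) (by simp) (by simpa using hne)
  · intro h
    refine ⟨by simpa using h.ne, by simp, isMatching_triple he hx.1 hy.1 hx.2 hy.2 h, ?_⟩
    simpa using ⟨hx.2.ne, hy.2.ne⟩

lemma bu_of_isTwoDimBuchsbaum (h : IsTwoDimBuchsbaum (matchingComplex G)) : Bu G := by
  obtain ⟨⟨⟨s, hs, hcard⟩, hmax⟩, hlink⟩ := h
  have hlink : ∀ e ∈ G.edgeSet, IsConnectedGraph (link (matchingComplex G) {e}) :=
    fun e he => hlink e ⟨by simp, isMatching_singleton he⟩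
  have hpair : ∀ e ∈ G.edgeSet, ∃ x y, x ∈ G.edgeSet ∧ y ∈ G.edgeSet ∧ EdgeApart e x ∧
      EdgeApart e y ∧ EdgeApart x y := by
    intro e he
    obtain ⟨⟨⟨t, ht, hc⟩, -⟩, -⟩ := hlink e he
    obtain ⟨x, y, hxy, rfl⟩ := Finset.card_eq_two.1 hc
    rw [mem_link] at ht
    have hne : e ≠ x ∧ e ≠ y := by simpa using ht.2.2
    exact ⟨x, y, ht.2.1.1 _ (by simp), ht.2.1.1 _ (by simp),
      ht.2.1.edgeApart (by simp) (by simp) hne.1, ht.2.1.edgeApart (by simp) (by simp) hne.2,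
      ht.2.1.edgeApart (by simp) (by simp) hxy⟩
  refine ⟨?_, ?_, ?_, ?_, ?_⟩
  · obtain ⟨e, he⟩ := hs.1
    have := hs.2.1 e he
    induction e with | _ a b => exact ⟨a, b, this⟩
  · intro a b hab
    obtain ⟨x, y, hx, -, h1, -⟩ := hpair s(a, b) hab
    induction x with | _ c d => exact ⟨c, d, hx, edgeApart_mk.1 h1⟩
  · intro a b c d hab hcd hap
    obtain ⟨x, y, hx, hy, h1, h2, h3⟩ := hpair s(a, b) hab
    have hcon := (hlink s(a, b) hab).2
    let X : {x : Sym2 V // {x} ∈ link (matchingComplex G) {s(a, b)}} :=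
      ⟨x, (singleton_mem_link hab).2 ⟨hx, h1⟩⟩
    let Y : {x : Sym2 V // {x} ∈ link (matchingComplex G) {s(a, b)}} :=
      ⟨y, (singleton_mem_link hab).2 ⟨hy, h2⟩⟩
    -- A connected graph with two vertices has no isolated vertex, so `{c, d}` has a neighbour in
    -- the link, which is the third edge.
    have : Nontrivial {x : Sym2 V // {x} ∈ link (matchingComplex G) {s(a, b)}} :=
      ⟨X, Y, fun e => h3.ne (congrArg Subtype.val e)⟩
    obtain ⟨Z, hZ⟩ := hcon.preconnected.exists_adj_of_nontrivial
      ⟨s(c, d), (singleton_mem_link hab).2 ⟨hcd, edgeApart_mk.2 hap⟩⟩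
    rw [skeleton_adj hab] at hZ
    obtain ⟨z, hz⟩ := Z
    rw [singleton_mem_link hab] at hz
    induction z with
    | _ u v => exact ⟨u, v, hz.1, edgeApart_mk.1 hz.2.symm, edgeApart_mk.1 hZ.symm⟩
  · intro a b c d e f g h hab hcd hef hgh h1 h2 h3 h4 h5 h6
    simp only [← edgeApart_mk] at h1 h2 h3 h4 h5 h6
    have hm : IsMatching G {s(g, h), s(a, b), s(c, d), s(e, f)} :=
      isMatching_insert hgh (isMatching_triple hab hcd hef h1 h2 h3) (by simpa using ⟨h4, h5, h6⟩)
    have := hmax _ ⟨by simp, hm⟩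
    rw [Finset.card_insert_of_notMem (by
        simp only [Finset.mem_insert, Finset.mem_singleton, not_or]
        exact ⟨h4.ne, h5.ne, h6.ne⟩),
      Finset.card_insert_of_notMem (by
        simp only [Finset.mem_insert, Finset.mem_singleton, not_or]
        exact ⟨h1.ne, h2.ne⟩),
      Finset.card_pair h3.ne] at this
    omega
  · intro a b c d x y hab hbc hcd had hac hbd hxy h1 h2
    by_contra! hno
    have hcon := (hlink s(x, y) hxy).2
    have hE : ∀ u v, G.Adj u v → Apart x y u v →
        {s(u, v)} ∈ link (matchingComplex G) {s(x, y)} :=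
      fun u v huv h => (singleton_mem_link hxy).2 ⟨huv, edgeApart_mk.2 h⟩
    have hreach := hcon.preconnected ⟨s(a, b), hE a b hab h1⟩
      ⟨s(b, c), hE b c hbc ⟨h1.2.1, h2.1, h1.2.2.2, h2.2.2.1⟩⟩
    -- An edge inside `{a, b, c, d}` disjoint from `{a, b}` is `{c, d}`, and conversely. So the
    -- component of `{a, b}` is this pair and does not contain `{b, c}`.
    have key : ∀ Z, (oneSkeleton (link (matchingComplex G) {s(x, y)})).Reachable
        ⟨s(a, b), hE a b hab h1⟩ Z → Z.1 = s(a, b) ∨ Z.1 = s(c, d) := by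
      intro Z hZ
      rw [SimpleGraph.reachable_iff_reflTransGen] at hZ
      induction hZ with
      | refl => exact .inl rfl
      | @tail Y Z _ hYZ ih =>
        rw [skeleton_adj hxy] at hYZ
        obtain ⟨z, hz⟩ := Z
        rw [singleton_mem_link hxy] at hz
        induction z with
        | _ u v =>
          have huv := hno u v hz.1 (edgeApart_mk.1 hz.2.symm)
          have hne : u ≠ v := SimpleGraph.Adj.ne hz.1
          rcases ih with ih | ih <;> rw [ih, edgeApart_mk] at hYZ <;>
            obtain ⟨n1, n2, n3, n4⟩ := hYZ <;>
            rcases huv with ⟨rfl | rfl | rfl | rfl, rfl | rfl | rfl | rfl⟩ <;>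
            simp_all [Sym2.eq_swap]
    rcases key _ hreach with h | h
    · simp only [Sym2.eq_iff] at h
      rcases h with ⟨rfl, -⟩ | ⟨-, rfl⟩
      · exact hab.ne rfl
      · exact hac rfl
    · simp only [Sym2.eq_iff] at h
      rcases h with ⟨rfl, -⟩ | ⟨rfl, -⟩
      · exact hbc.ne rfl
      · exact hbd rfl

/-- The link of `e` is connected. -/
lemma Bu.reachable {e : Sym2 V} (hB : Bu G) (he : e ∈ G.edgeSet)
    (X Y : {x : Sym2 V // {x} ∈ link (matchingComplex G) {e}}) :
    (oneSkeleton (link (matchingComplex G) {e})).Reachable X Y := by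
  have step : ∀ {X Y : {x : Sym2 V // {x} ∈ link (matchingComplex G) {e}}},
      EdgeApart X.1 Y.1 → (oneSkeleton (link (matchingComplex G) {e})).Reachable X Y :=
    fun h => ((skeleton_adj he).2 h).reachable
  have hX := (singleton_mem_link he).1 X.2
  have hY := (singleton_mem_link he).1 Y.2
  obtain ⟨g, hg, heg, hXg⟩ := hB.exists_two he hX.1 hX.2
  obtain ⟨g', hg', heg', hYg'⟩ := hB.exists_two he hY.1 hY.2
  have r1 := step (X := X) (Y := ⟨g, (singleton_mem_link he).2 ⟨hg, heg⟩⟩) hXg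
  have r2 := step (X := Y) (Y := ⟨g', (singleton_mem_link he).2 ⟨hg', heg'⟩⟩) hYg'
  by_cases c1 : EdgeApart X.1 Y.1
  · exact step c1
  by_cases c2 : EdgeApart Y.1 g
  · exact r1.trans (step (X := Y) c2).symm
  by_cases c3 : EdgeApart X.1 g'
  · exact (step (X := X) (Y := ⟨g', _⟩) c3).trans r2.symm
  by_cases c4 : EdgeApart g g'
  · exact r1.trans ((step (X := ⟨g, _⟩) (Y := ⟨g', _⟩) c4).trans r2.symm)
  -- With no short path left, `X` meets `Y` and `g'`, and `g` meets `Y` and `g'`. The meeting points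
  -- are distinct, so the four edges form the cycle `a, b, d, c`.
  simp only [EdgeApart, not_forall, not_not] at c1 c2 c3 c4
  obtain ⟨a, haX, haY⟩ := c1
  obtain ⟨c, hcY, hcg⟩ := c2
  obtain ⟨b, hbX, hbg'⟩ := c3
  obtain ⟨d, hdg, hdg'⟩ := c4
  have hab : a ≠ b := by rintro rfl; exact hYg' _ haY hbg'
  have hac : a ≠ c := by rintro rfl; exact hXg _ haX hcg
  have had : a ≠ d := by rintro rfl; exact hXg _ haX hdg
  have hbc : b ≠ c := by rintro rfl; exact hXg _ hbX hcg
  have hbd : b ≠ d := by rintro rfl; exact hXg _ hbX hdg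
  have hcd : c ≠ d := by rintro rfl; exact hYg' _ hcY hdg'
  have eX : X.1 = s(a, b) := (Sym2.mem_and_mem_iff hab).1 ⟨haX, hbX⟩
  have eY : Y.1 = s(a, c) := (Sym2.mem_and_mem_iff hac).1 ⟨haY, hcY⟩
  have eg : g = s(c, d) := (Sym2.mem_and_mem_iff hcd).1 ⟨hcg, hdg⟩
  have eg' : g' = s(b, d) := (Sym2.mem_and_mem_iff hbd).1 ⟨hbg', hdg'⟩
  subst eg eg'
  rw [eX] at hX
  rw [eY] at hY
  induction e with | _ x y =>
  -- The new edge has at most one end on the cycle. Hence it is disjoint from `X` or from its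
  -- partner `g`, and from `Y` or from its partner `g'`, which connects both to it.
  obtain ⟨u, v, huv, hap, hout⟩ := hB.square a b d c x y hX.1 hg' (SimpleGraph.Adj.symm hg) hY.1
    had hbc he (edgeApart_mk.1 hX.2) ⟨(edgeApart_mk.1 heg).2.1, (edgeApart_mk.1 heg).1,
      (edgeApart_mk.1 heg).2.2.2, (edgeApart_mk.1 heg).2.2.1⟩
  have hH := (singleton_mem_link he).2 ⟨huv, (edgeApart_mk.2 hap).symm⟩
  have hXH : (oneSkeleton (link (matchingComplex G) {s(x, y)})).Reachable X ⟨s(u, v), hH⟩ := by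
    by_cases h : EdgeApart X.1 s(u, v)
    · exact step (Y := ⟨s(u, v), hH⟩) h
    · refine r1.trans (step (X := ⟨s(c, d), _⟩) (Y := ⟨s(u, v), hH⟩) ?_)
      rw [eX, edgeApart_mk] at h
      change EdgeApart s(c, d) s(u, v)
      rw [edgeApart_mk]
      simp only [Apart, ne_eq] at h ⊢
      refine ⟨?_, ?_, ?_, ?_⟩ <;> rintro rfl <;> apply hout <;> grind
  have hYH : (oneSkeleton (link (matchingComplex G) {s(x, y)})).Reachable Y ⟨s(u, v), hH⟩ := by
    by_cases h : EdgeApart Y.1 s(u, v)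
    · exact step (Y := ⟨s(u, v), hH⟩) h
    · refine r2.trans (step (X := ⟨s(b, d), _⟩) (Y := ⟨s(u, v), hH⟩) ?_)
      rw [eY, edgeApart_mk] at h
      change EdgeApart s(b, d) s(u, v)
      rw [edgeApart_mk]
      simp only [Apart, ne_eq] at h ⊢
      refine ⟨?_, ?_, ?_, ?_⟩ <;> rintro rfl <;> apply hout <;> grind
  exact hXH.trans hYH.symm

lemma isTwoDimBuchsbaum_of_bu (hB : Bu G) : IsTwoDimBuchsbaum (matchingComplex G) := by
  have hlink : ∀ e ∈ G.edgeSet, ∃ x y, x ∈ G.edgeSet ∧ y ∈ G.edgeSet ∧ EdgeApart e x ∧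
      EdgeApart e y ∧ EdgeApart x y := by
    intro e he
    obtain ⟨x, hx, h1⟩ := hB.exists_one he
    obtain ⟨y, hy, h2, h3⟩ := hB.exists_two he hx h1
    exact ⟨x, y, hx, hy, h1, h2, h3⟩
  refine ⟨⟨?_, fun s hs => hB.card_le hs.2⟩, fun e he => ?_⟩
  · obtain ⟨a, b, hab⟩ := hB.edge
    obtain ⟨x, y, hx, hy, h1, h2, h3⟩ := hlink s(a, b) hab
    refine ⟨{s(a, b), x, y}, ⟨by simp, isMatching_triple hab hx hy h1 h2 h3⟩, ?_⟩
    exact Finset.card_eq_three.2 ⟨_, _, _, h1.ne, h2.ne, h3.ne, rfl⟩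
  · have he : e ∈ G.edgeSet := he.2.1 e (by simp)
    obtain ⟨x, y, hx, hy, h1, h2, h3⟩ := hlink e he
    refine ⟨⟨⟨{x, y}, ?_, Finset.card_pair h3.ne⟩, fun s hs => ?_⟩, ?_⟩
    · rw [mem_link]
      exact ⟨by simp, isMatching_triple he hx hy h1 h2 h3, by simpa using ⟨h1.ne, h2.ne⟩⟩
    · rw [mem_link] at hs
      have := hB.card_le hs.2.1
      rw [Finset.card_insert_of_notMem hs.2.2] at this
      omega
    · have : Nonempty {x : Sym2 V // {x} ∈ link (matchingComplex G) {e}} :=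
        ⟨⟨x, (singleton_mem_link he).2 ⟨hx, h1⟩⟩⟩
      exact ⟨fun X Y => hB.reachable he X Y⟩

lemma isTwoDimBuchsbaum_iff : IsTwoDimBuchsbaum (matchingComplex G) ↔ Bu G :=
  ⟨bu_of_isTwoDimBuchsbaum, isTwoDimBuchsbaum_of_bu⟩

end MatchingBuchsbaum

namespace MatchingBuchsbaum

variable {V : Type*}

/-! ### A criterion for patterns whose realizations have the Buchsbaum property -/

namespace Pattern

open Search

/-- Pairs `(a, b)` with `a < b < n`. -/
def pairsBelow (n : ℕ) : List (ℕ × ℕ) :=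
  (List.range n).flatMap fun b => (List.range b).map fun a => (a, b)

/-- Required edges. -/
def solids (X : Pattern) : List (ℕ × ℕ) :=
  (pairsBelow X.size).filter fun p => X.code p.1 p.2 == 0

def mask (p : ℕ × ℕ) : ℕ := Nat.lor (bit p.1) (bit p.2)

/-- The possible traces of an edge on the vertices of the pattern. -/
def traces (X : Pattern) : List ℕ :=
  ((pairsBelow X.size).filter fun p => X.code p.1 p.2 != 2).map mask ++ X.attach.flatten.map bit

/-- Two disjoint edges whose four ends carry no other perfect matching. -/
def rigid (X : Pattern) (p q : ℕ × ℕ) : Bool :=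
  let no := fun a b => X.code (min a b) (max a b) == 2
  (no p.1 q.1 || no p.2 q.2) && (no p.1 q.2 || no p.2 q.1)

/-- A condition on a pattern that implies the Buchsbaum property of its realizations. -/
def good (X : Pattern) : Bool :=
  (!X.solids.isEmpty && X.attach.flatten.all fun a => decide (a < X.size)) &&
  X.traces.all fun m₁ =>
    let L₁ := avoiding m₁ X.traces
    let S := X.solids.filter fun p => disj (mask p) m₁
    !S.isEmpty &&
    (L₁.all fun m₂ =>
      (S.any fun p => disj (mask p) m₂) &&
      (let L₂ := avoiding m₂ L₁
       L₂.all fun m₃ => (avoiding m₃ L₂).isEmpty)) &&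
    -- Either alternative rules out that all edges disjoint from the given one lie on the vertices
    -- of a four-cycle. Five covered vertices do not fit, and two disjoint edges on a four-cycle
    -- leave a second perfect matching on their ends.
    (decide (5 ≤ ((List.range X.size).filter fun i => S.any fun p => p.1 == i || p.2 == i).length) ||
      S.any fun p => S.any fun q => disj (mask p) (mask q) && X.rigid p q)

lemma mem_pairsBelow {n : ℕ} {p : ℕ × ℕ} : p ∈ pairsBelow n ↔ p.1 < p.2 ∧ p.2 < n := by
  obtain ⟨a, b⟩ := p
  simp only [pairsBelow, List.mem_flatMap, List.mem_range, List.mem_map, Prod.mk.injEq]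
  constructor
  · rintro ⟨b', hb, a', ha, rfl, rfl⟩
    exact ⟨ha, hb⟩
  · rintro ⟨ha, hb⟩
    exact ⟨b, hb, a, ha, rfl, rfl⟩

lemma mem_avoiding_of {e f : ℕ} {l : List ℕ} (h : f ∈ l) (hd : disj f e = true) :
    f ∈ avoiding e l := by
  induction l with
  | nil => simp at h
  | cons a l ih =>
    change f ∈ sel (disj a e) (a :: avoiding e l) (avoiding e l)
    rw [sel_eq_ite]
    rcases List.mem_cons.1 h with rfl | h
    · simp [hd]
    · split_ifs
      · simp [ih h]
      · exact ih h

lemma testBit_mask (p : ℕ × ℕ) (k : ℕ) : (mask p).testBit k = true ↔ k = p.1 ∨ k = p.2 := by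
  rw [mask, testBit_lor, testBit_bit, testBit_bit, Bool.or_eq_true, decide_eq_true_eq,
    decide_eq_true_eq, eq_comm (a := p.1), eq_comm (a := p.2)]

variable {X : Pattern} {G : SimpleGraph V} {g : ℕ → V}

/-- The mask `m` describes the vertices of the pattern at the edge `{u, v}`. -/
def IsTrace (X : Pattern) (g : ℕ → V) (u v : V) (m : ℕ) : Prop :=
  ∀ a, m.testBit a = true ↔ a < X.size ∧ (g a = u ∨ g a = v)

lemma IsTrace.disj {u v u' v' : V} {m m' : ℕ} (h : X.IsTrace g u v m) (h' : X.IsTrace g u' v' m')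
    (hap : Apart u v u' v') : disj m m' = true := by
  rw [disj_iff]
  rintro k ⟨h1, h2⟩
  obtain ⟨-, h1⟩ := (h k).1 h1
  obtain ⟨-, h2⟩ := (h' k).1 h2
  obtain ⟨n1, n2, n3, n4⟩ := hap
  rcases h1 with rfl | rfl <;> rcases h2 with h2 | h2 <;> contradiction

lemma IsTrace.apart {u v : V} {m : ℕ} {p : ℕ × ℕ} (h : X.IsTrace g u v m) (h1 : p.1 < X.size)
    (h2 : p.2 < X.size) (hd : Search.disj (mask p) m = true) : Apart (g p.1) (g p.2) u v := by
  rw [disj_iff] at hd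
  have hd1 := hd p.1
  have hd2 := hd p.2
  simp only [testBit_mask, true_or, or_true, true_and, h _, h1, h2, not_or] at hd1 hd2
  exact ⟨hd1.1, hd1.2, hd2.1, hd2.2⟩

/-- If `{x, y}` is a side of the cycle, the other two sides form another matching. If it is a
diagonal pair, the sides of the cycle give one. -/
lemma alternative_matching {a b c d x y z w : V} (hab : G.Adj a b) (hbc : G.Adj b c)
    (hcd : G.Adj c d) (had : G.Adj a d) (hx : x = a ∨ x = b ∨ x = c ∨ x = d)
    (hy : y = a ∨ y = b ∨ y = c ∨ y = d) (hz : z = a ∨ z = b ∨ z = c ∨ z = d)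
    (hw : w = a ∨ w = b ∨ w = c ∨ w = d) (hxy : x ≠ y) (hzw : z ≠ w) (hap : Apart x y z w) :
    (G.Adj x z ∧ G.Adj y w) ∨ (G.Adj x w ∧ G.Adj y z) := by
  obtain ⟨h1, h2, h3, h4⟩ := hap
  have hba := hab.symm
  have hcb := hbc.symm
  have hdc := hcd.symm
  have hda := had.symm
  rcases hx with rfl | rfl | rfl | rfl <;> rcases hy with rfl | rfl | rfl | rfl <;>
    first
    | exact absurd rfl hxy
    | (rcases hz with rfl | rfl | rfl | rfl <;>
        first
        | exact absurd rfl h1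
        | exact absurd rfl h3
        | (rcases hw with rfl | rfl | rfl | rfl <;>
          first
          | exact absurd rfl h2
          | exact absurd rfl h4
          | exact absurd rfl hzw
          | exact .inl ⟨by assumption, by assumption⟩
          | exact .inr ⟨by assumption, by assumption⟩))

/-- Disjoint edges have disjoint traces, so a bound on disjoint traces bounds matchings. In the
other direction only required edges are used: they lie inside the core, where disjointness of a
trace from a required edge means disjointness of the edges. -/
theorem bu_of_good (hgood : X.good = true) (h : X.Realizes G) : Bu G := by
  obtain ⟨g, hinj, hcode, hout⟩ := h
  simp only [good, Bool.and_eq_true, Bool.not_eq_true', List.isEmpty_eq_false_iff, List.all_eq_true,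
    decide_eq_true_eq] at hgood
  obtain ⟨⟨hne, hattach⟩, hgood⟩ := hgood
  have hblock : ∀ b ∈ X.attach, ∀ a ∈ b, a < X.size := fun b hb a ha =>
    hattach a (List.mem_flatten.2 ⟨b, hb, ha⟩)
  have hcode' : ∀ i < X.size, ∀ j < X.size, G.Adj (g i) (g j) →
      X.code (min i j) (max i j) ≠ 2 := by
    intro i hi j hj hij he
    rcases lt_trichotomy i j with h | rfl | h
    · rw [min_eq_left h.le, max_eq_right h.le] at he
      exact (hcode i j h hj).2 he hij
    · exact hij.ne rfl
    · rw [min_eq_right h.le, max_eq_left h.le] at he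
      exact (hcode j i h hi).2 he hij.symm
  have hout' : ∀ w, (∀ a < X.size, w ≠ g a) → ∀ v, G.Adj w v →
      ∃ a < X.size, v = g a ∧ bit a ∈ X.traces := by
    intro w hw v hwv
    obtain ⟨-, b, hb, hb'⟩ := hout w hw
    obtain ⟨a, ha, rfl⟩ := hb' v hwv
    refine ⟨a, hblock b hb a ha, rfl, ?_⟩
    simp only [traces, List.mem_append, List.mem_map]
    exact .inr ⟨a, List.mem_flatten.2 ⟨b, hb, ha⟩, rfl⟩
  have hsingle : ∀ a < X.size, ∀ w, (∀ b < X.size, w ≠ g b) → X.IsTrace g w (g a) (bit a) := by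
    intro a ha w hw b
    simp only [testBit_bit, decide_eq_true_eq]
    constructor
    · rintro rfl
      exact ⟨ha, .inr rfl⟩
    · rintro ⟨hb, h | h⟩
      · exact absurd h.symm (hw b hb)
      · exact (hinj b hb a ha h).symm
  -- Further vertices are joined only to the core, so every edge has an end there and its trace is a
  -- pair or a single vertex.
  have htrace : ∀ u v, G.Adj u v → ∃ m ∈ X.traces, X.IsTrace g u v m := by
    intro u v huv
    by_cases hu : ∃ i < X.size, u = g i
    · obtain ⟨i, hi, rfl⟩ := hu
      by_cases hv : ∃ j < X.size, v = g j
      · obtain ⟨j, hj, rfl⟩ := hv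
        refine ⟨mask (min i j, max i j), ?_, fun a => ?_⟩
        · simp only [traces, List.mem_append, List.mem_map, List.mem_filter, mem_pairsBelow]
          refine .inl ⟨(min i j, max i j), ⟨⟨?_, by simp [hi, hj]⟩, ?_⟩, rfl⟩
          · have : i ≠ j := fun e => huv.ne (by rw [e])
            simp only
            omega
          · simpa using hcode' i hi j hj huv
        · rw [testBit_mask]
          constructor
          · intro h
            have : a = i ∨ a = j := by simp only at h; omega
            rcases this with rfl | rfl
            · exact ⟨hi, .inl rfl⟩
            · exact ⟨hj, .inr rfl⟩
          · rintro ⟨ha, h | h⟩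
            · have := hinj a ha i hi h
              simp only
              omega
            · have := hinj a ha j hj h
              simp only
              omega
      · push Not at hv
        obtain ⟨a, ha, e, hm⟩ := hout' v hv _ huv.symm
        refine ⟨_, hm, fun b => ?_⟩
        rw [hsingle a ha v hv b, e]
        tauto
    · push Not at hu
      obtain ⟨a, ha, rfl, hm⟩ := hout' u hu _ huv
      exact ⟨_, hm, hsingle a ha u hu⟩
  have hsolid : ∀ p ∈ X.solids, p.1 < X.size ∧ p.2 < X.size ∧ G.Adj (g p.1) (g p.2) := by
    intro p hp
    simp only [solids, List.mem_filter, mem_pairsBelow, beq_iff_eq] at hp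
    exact ⟨hp.1.1.trans hp.1.2, hp.1.2, (hcode _ _ hp.1.1 hp.1.2).1 hp.2⟩
  refine ⟨?_, ?_, ?_, ?_, ?_⟩
  · obtain ⟨p, hp⟩ := List.exists_mem_of_ne_nil _ hne
    exact ⟨_, _, (hsolid p hp).2.2⟩
  · intro a b hab
    obtain ⟨m, hm, ht⟩ := htrace a b hab
    obtain ⟨p, hp⟩ := List.exists_mem_of_ne_nil _ (hgood m hm).1.1
    rw [List.mem_filter] at hp
    obtain ⟨h1, h2, h3⟩ := hsolid p hp.1
    obtain ⟨n1, n2, n3, n4⟩ := ht.apart h1 h2 hp.2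
    exact ⟨_, _, h3, n1.symm, n3.symm, n2.symm, n4.symm⟩
  · intro a b c d hab hcd hap
    obtain ⟨m, hm, ht⟩ := htrace a b hab
    obtain ⟨m', hm', ht'⟩ := htrace c d hcd
    obtain ⟨h1, -⟩ := (hgood m hm).1.2 m' (mem_avoiding_of hm' (ht'.disj ht
      ⟨hap.1.symm, hap.2.2.1.symm, hap.2.1.symm, hap.2.2.2.symm⟩))
    rw [List.any_eq_true] at h1
    obtain ⟨p, hp, hp'⟩ := h1
    rw [List.mem_filter] at hp
    obtain ⟨h1, h2, h3⟩ := hsolid p hp.1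
    exact ⟨_, _, h3, ht.apart h1 h2 hp.2, ht'.apart h1 h2 hp'⟩
  · intro a b c d e f x y hab hcd hef hxy n1 n2 n3 n4 n5 n6
    obtain ⟨m₁, hm₁, t₁⟩ := htrace a b hab
    obtain ⟨m₂, hm₂, t₂⟩ := htrace c d hcd
    obtain ⟨m₃, hm₃, t₃⟩ := htrace e f hef
    obtain ⟨m₄, hm₄, t₄⟩ := htrace x y hxy
    have swap : ∀ {a b c d : V}, Apart a b c d → Apart c d a b := fun h =>
      ⟨h.1.symm, h.2.2.1.symm, h.2.1.symm, h.2.2.2.symm⟩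
    obtain ⟨-, h2⟩ := (hgood m₁ hm₁).1.2 m₂ (mem_avoiding_of hm₂ (t₂.disj t₁ (swap n1)))
    have h3 := h2 m₃ (mem_avoiding_of (mem_avoiding_of hm₃ (t₃.disj t₁ (swap n2)))
      (t₃.disj t₂ (swap n3)))
    rw [List.isEmpty_iff] at h3
    have h4 := mem_avoiding_of (mem_avoiding_of (mem_avoiding_of hm₄ (t₄.disj t₁ n4))
      (t₄.disj t₂ n5)) (t₄.disj t₃ n6)
    rw [h3] at h4
    simp at h4
  · intro a b c d x y hab hbc hcd had hac hbd hxy n1 n2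
    obtain ⟨m, hm, ht⟩ := htrace x y hxy
    by_contra! hno
    have hin : ∀ p ∈ X.solids, Search.disj (mask p) m = true →
        (g p.1 = a ∨ g p.1 = b ∨ g p.1 = c ∨ g p.1 = d) ∧
        (g p.2 = a ∨ g p.2 = b ∨ g p.2 = c ∨ g p.2 = d) := by
      intro p hp hd
      obtain ⟨h1, h2, h3⟩ := hsolid p hp
      exact hno _ _ h3 (ht.apart h1 h2 hd)
    have h2 := (hgood m hm).2
    rw [Bool.or_eq_true, decide_eq_true_eq, List.any_eq_true] at h2
    rcases h2 with h2 | ⟨p, hp, h2⟩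
    · classical
      set L := (List.range X.size).filter fun i =>
        (X.solids.filter fun p => Search.disj (mask p) m).any fun p => p.1 == i || p.2 == i with hL
      have hnd : L.Nodup := List.nodup_range.filter _
      rw [← List.toFinset_card_of_nodup hnd] at h2
      have hsub : L.toFinset.image g ⊆ {a, b, c, d} := by
        intro z hz
        obtain ⟨i, hi, rfl⟩ := Finset.mem_image.1 hz
        rw [List.mem_toFinset, hL, List.mem_filter, List.any_eq_true] at hi
        obtain ⟨-, p, hp, hi⟩ := hi
        rw [List.mem_filter] at hp
        have := hin p hp.1 hp.2
        simp only [Bool.or_eq_true, beq_iff_eq] at hi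
        rcases hi with rfl | rfl
        · simpa using this.1
        · simpa using this.2
      have hcard := Finset.card_le_card hsub
      rw [Finset.card_image_of_injOn] at hcard
      · have := Finset.card_le_four (a := a) (b := b) (c := c) (d := d)
        omega
      · intro i hi j hj e
        simp only [hL, List.coe_toFinset, Set.mem_ofPred_eq, List.mem_filter, List.mem_range] at hi hj
        exact hinj i hi.1 j hj.1 e
    · rw [List.any_eq_true] at h2
      obtain ⟨q, hq, h2⟩ := h2
      rw [List.mem_filter] at hp hq
      rw [Bool.and_eq_true] at h2
      obtain ⟨hpq, hr⟩ := h2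
      obtain ⟨p1, p2, padj⟩ := hsolid p hp.1
      obtain ⟨q1, q2, qadj⟩ := hsolid q hq.1
      have hap : Apart (g p.1) (g p.2) (g q.1) (g q.2) := by
        refine IsTrace.apart (X := X) (fun k => ?_) p1 p2 hpq
        rw [testBit_mask]
        constructor
        · rintro (rfl | rfl)
          · exact ⟨q1, .inl rfl⟩
          · exact ⟨q2, .inr rfl⟩
        · rintro ⟨hk, h | h⟩
          · exact .inl (hinj _ hk _ q1 h)
          · exact .inr (hinj _ hk _ q2 h)
      have hp' := hin p hp.1 hp.2
      have hq' := hin q hq.1 hq.2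
      simp only [rigid, Bool.and_eq_true, Bool.or_eq_true, beq_iff_eq] at hr
      rcases alternative_matching hab hbc hcd had hp'.1 hp'.2 hq'.1 hq'.2 padj.ne qadj.ne hap with
        ⟨h1, h2⟩ | ⟨h1, h2⟩
      · rcases hr.1 with h | h
        · exact hcode' _ p1 _ q1 h1 h
        · exact hcode' _ p2 _ q2 h2 h
      · rcases hr.2 with h | h
        · exact hcode' _ p1 _ q2 h1 h
        · exact hcode' _ p2 _ q1 h2 h

end Pattern

end MatchingBuchsbaum

namespace MatchingBuchsbaum

variable {V : Type*}

namespace Pattern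

/-! ### Gluing patterns -/

/-- The position of vertex `i` of a pattern glued to `X` along the first `k` vertices. -/
def shift (k : ℕ) (X : Pattern) (i : ℕ) : ℕ := if i < k then i else X.size - k + i

/-- `X` and `Y` with their first `k` vertices identified. -/
def glue (k : ℕ) (X Y : Pattern) : Pattern where
  size := X.size + Y.size - k
  must := X.must ++ Y.must.map fun p => (shift k X p.1, shift k X p.2)
  may := X.may ++ Y.may.map fun p => (shift k X p.1, shift k X p.2)
  attach := X.attach ++ Y.attach.map (List.map (shift k X))

def triangle : Pattern := ⟨3, [(0, 1), (1, 2), (0, 2)], [], []⟩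

/-- Vertex 0 is the centre, and a single edge is included. -/
def star : Pattern := ⟨2, [(0, 1)], [], [[0]]⟩

/-- A star with at least two edges, one of whose leaves is `0`. -/
def petal : Pattern := ⟨3, [(0, 1), (1, 2)], [], [[1]]⟩

def g1 : Pattern := ⟨5, [(0, 1), (1, 2), (2, 3), (3, 4)], [(0, 3), (1, 4)], [[1, 3]]⟩

def g2 : Pattern := ⟨5, [(0, 1), (1, 2), (0, 2), (2, 3), (3, 4)], [(0, 3), (1, 3)], [[3]]⟩

def g3 : Pattern :=
  ⟨5, [(0, 1), (1, 2), (2, 3), (3, 4), (0, 4)], [(0, 2), (2, 4), (1, 4), (1, 3), (0, 3)], []⟩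

def bow : Pattern := ⟨5, [(0, 1), (1, 2), (0, 2), (2, 3), (3, 4), (2, 4)], [], []⟩

def b1 : Pattern := ⟨6, [(0, 3), (1, 4), (2, 5)], [], [[0, 1, 2]]⟩

def b2 : Pattern :=
  ⟨7, [(0, 3), (1, 3), (0, 5), (1, 5), (1, 4), (2, 4), (1, 6), (2, 6)], [], [[0, 1, 2]]⟩

def b3 : Pattern :=
  ⟨7, [(0, 4), (1, 4), (1, 5), (2, 5), (2, 6), (0, 6), (0, 3), (1, 3), (2, 3)],
    [(0, 5), (1, 6), (2, 4)], [[0, 1, 2]]⟩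

def b4 : Pattern :=
  ⟨8, [(0, 4), (1, 4), (1, 5), (2, 5), (2, 6), (0, 6), (0, 7), (1, 3), (2, 3)],
    [(0, 5), (1, 6), (2, 4)], [[0, 1, 2]]⟩

def b5 : Pattern :=
  ⟨8, [(0, 3), (0, 4), (0, 5), (1, 3), (1, 5), (1, 7), (2, 5), (2, 6), (2, 7)],
    [(1, 4), (1, 6), (0, 7), (2, 3)], [[0, 1, 2]]⟩

def b6 : Pattern :=
  ⟨8, [(0, 3), (0, 4), (1, 4), (1, 5), (1, 7), (2, 6), (2, 7)], [(2, 4), (2, 5), (1, 6)],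
    [[0, 1, 2]]⟩

def b7 : Pattern :=
  ⟨8, [(1, 2), (2, 3), (1, 3), (4, 5), (5, 6), (4, 6), (0, 1), (0, 4), (0, 7)],
    [(0, 2), (0, 3), (0, 5), (0, 6)], [[0]]⟩

def b8 : Pattern :=
  ⟨8, [(2, 3), (3, 4), (2, 4), (0, 2), (0, 5), (0, 6), (1, 5), (1, 7)],
    [(0, 3), (0, 4), (0, 7), (1, 6)], [[0, 1]]⟩

def b9 : Pattern :=
  ⟨8, [(2, 3), (3, 4), (2, 4), (0, 2), (1, 2), (0, 5), (0, 7), (1, 6), (1, 7)],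
    [(0, 6), (1, 5)], [[0, 1]]⟩

def e1 : Pattern :=
  ⟨7, [(1, 2), (2, 3), (1, 3), (0, 1), (0, 4), (4, 5), (5, 6), (4, 6), (0, 2), (0, 3), (0, 5),
    (0, 6)], [], []⟩

def e2 : Pattern :=
  ⟨7, [(2, 3), (3, 4), (2, 4), (0, 2), (0, 5), (1, 5), (1, 6), (0, 3), (0, 4), (0, 6)], [], []⟩

def petals : List Pattern :=
  [triangle, petal].flatMap fun X => [triangle, petal].flatMap fun Y =>
    [triangle, petal].map fun Z => glue 1 (glue 1 X Y) Z

def triples : List Pattern :=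
  [triangle, star].flatMap fun X => [triangle, star].flatMap fun Y =>
    [triangle, star].map fun Z => glue 0 (glue 0 X Y) Z

def doubles : List Pattern :=
  [triangle, star].flatMap fun X => [bow, g1, g2, g3].map fun Y => glue 0 X Y

def catalogue : List Pattern :=
  petals ++ [b1, b2, b3, b4, b5, b6, b7, b8, b9, e1, e2] ++ triples ++ doubles

lemma good_of_mem_catalogue : ∀ X ∈ catalogue, X.good = true := by
  decide +kernel

end Pattern

end MatchingBuchsbaum

/-! ### Splitting and gluing realizations. -/

namespace MatchingBuchsbaum

variable {V : Type*}

namespace Pattern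

/-- The subgraph of `G` induced on `A` is obtained from the pattern `X`, with vertices at `g`. -/
structure RealizesOn (X : Pattern) (G : SimpleGraph V) (A : Set V) (g : ℕ → V) : Prop where
  mem : ∀ a < X.size, g a ∈ A
  inj : ∀ a < X.size, ∀ b < X.size, g a = g b → a = b
  code : ∀ a b, a < b → b < X.size → (X.code a b = 0 → G.Adj (g a) (g b)) ∧
    (X.code a b = 2 → ¬ G.Adj (g a) (g b))
  out : ∀ w ∈ A, (∀ a < X.size, w ≠ g a) → (∃ v ∈ A, G.Adj w v) ∧
    ∃ b ∈ X.attach, ∀ v ∈ A, G.Adj w v → ∃ a ∈ b, v = g a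

lemma realizes_iff {X : Pattern} {G : SimpleGraph V} :
    X.Realizes G ↔ ∃ g, X.RealizesOn G Set.univ g := by
  constructor
  · rintro ⟨g, h1, h2, h3⟩
    exact ⟨g, by simp, h1, h2, by simpa using h3⟩
  · rintro ⟨g, -, h1, h2, h3⟩
    exact ⟨g, h1, h2, by simpa using h3⟩

variable {X Y : Pattern} {G : SimpleGraph V} {A B S : Set V} {g g₁ g₂ : ℕ → V}

lemma RealizesOn.of_induce {g : ℕ → A} (h : X.RealizesOn (G.induce A) Set.univ g) :
    X.RealizesOn G A (fun a => (g a : V)) := by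
  refine ⟨fun a _ => (g a).2, fun a ha b hb e => h.inj a ha b hb (Subtype.ext e),
    fun a b hab hb => by simpa using h.code a b hab hb, fun w hw hwg => ?_⟩
  obtain ⟨⟨v, -, hv⟩, b, hb, h'⟩ := h.out ⟨w, hw⟩ (Set.mem_univ _)
    fun a ha e => hwg a ha (congrArg Subtype.val e)
  refine ⟨⟨v, v.2, hv⟩, b, hb, fun u hu hwu => ?_⟩
  obtain ⟨a, ha, e⟩ := h' ⟨u, hu⟩ (Set.mem_univ _) hwu
  exact ⟨a, ha, congrArg Subtype.val e⟩

lemma RealizesOn.induce (h : X.RealizesOn G A g) (hX : 0 < X.size)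
    (hattach : ∀ b ∈ X.attach, ∀ a ∈ b, a < X.size) :
    ∃ g' : ℕ → A, X.RealizesOn (G.induce A) Set.univ g' ∧ ∀ a < X.size, (g' a : V) = g a := by
  -- Values of the placement beyond the size of the pattern are irrelevant; `g 0` serves as default.
  have key : ∀ a, ∃ z : A, a < X.size → (z : V) = g a := by
    intro a
    by_cases ha : a < X.size
    · exact ⟨⟨g a, h.mem a ha⟩, fun _ => rfl⟩
    · exact ⟨⟨g 0, h.mem 0 hX⟩, fun h => absurd h ha⟩
  choose g' hg' using key
  refine ⟨g', ⟨by simp, fun a ha b hb e => ?_, fun a b hab hb => ?_, fun w _ hwg => ?_⟩, hg'⟩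
  · exact h.inj a ha b hb (by rw [← hg' a ha, ← hg' b hb, e])
  · have := h.code a b hab hb
    rw [← hg' a (hab.trans hb), ← hg' b hb] at this
    simpa using this
  · obtain ⟨⟨v, hv, hwv⟩, b, hb, h'⟩ := h.out w w.2
      fun a ha e => hwg a ha (Subtype.ext (by rw [hg' a ha, e]))
    refine ⟨⟨⟨v, hv⟩, Set.mem_univ _, hwv⟩, b, hb, fun u _ hwu => ?_⟩
    obtain ⟨a, ha, e⟩ := h' u u.2 hwu
    exact ⟨a, ha, Subtype.ext (by rw [hg' a (hattach b hb a ha), e])⟩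

/-- Conditions under which `glue k X Y` behaves as expected. -/
structure Gluable (k : ℕ) (X Y : Pattern) : Prop where
  le_left : k ≤ X.size
  le_right : k ≤ Y.size
  left : ∀ b < X.size, ∀ a < b, (glue k X Y).code a b = X.code a b
  right : ∀ b < Y.size, ∀ a < b, (glue k X Y).code (shift k X a) (shift k X b) = Y.code a b
  cross : ∀ a < X.size, k ≤ a → ∀ b < Y.size, k ≤ b → (glue k X Y).code a (shift k X b) = 2
  attach_left : ∀ b ∈ X.attach, ∀ a ∈ b, a < X.size
  attach_right : ∀ b ∈ Y.attach, ∀ a ∈ b, a < Y.size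

lemma shift_lt_iff {k i : ℕ} (hk : k ≤ X.size) : shift k X i < X.size ↔ i < k := by
  rw [shift]
  split_ifs <;> omega

lemma shift_of_lt {k i : ℕ} (h : i < k) : shift k X i = i := if_pos h

lemma shift_of_le {k i : ℕ} (h : k ≤ i) : shift k X i = X.size - k + i := if_neg (by omega)

lemma shift_inj {k i j : ℕ} (h : shift k X i = shift k X j) : i = j := by
  rw [shift, shift] at h
  split_ifs at h <;> omega

lemma shift_lt_shift {k i j : ℕ} (h : i < j) : shift k X i < shift k X j := by
  rw [shift, shift]
  split_ifs <;> omega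

lemma shift_lt_size {k i : ℕ} (hk : k ≤ X.size) (hi : i < Y.size) :
    shift k X i < (glue k X Y).size := by
  change _ < X.size + Y.size - k
  rw [shift]
  split_ifs <;> omega

lemma Gluable.exists_shift {k : ℕ} (hG : Gluable k X Y) {c : ℕ} (hc : c < (glue k X Y).size)
    (h : X.size ≤ c) : ∃ j < Y.size, k ≤ j ∧ c = shift k X j := by
  change c < X.size + Y.size - k at hc
  have := hG.le_left
  refine ⟨c - (X.size - k), by omega, by omega, ?_⟩
  rw [shift_of_le (by omega)]
  omega

lemma Gluable.size_le {k : ℕ} (hG : Gluable k X Y) : X.size ≤ (glue k X Y).size := by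
  change _ ≤ X.size + Y.size - k
  have := hG.le_right
  omega

/-- Since a further vertex is joined to a single block, it belongs to one of the two parts. Between
the parts there are only the edges at shared vertices, because the code of a crossing pair is a
non-edge. -/
lemma RealizesOn.split {k : ℕ} (hG : Gluable k X Y) (h : (glue k X Y).RealizesOn G S g) :
    ∃ A B : Set V, A ∪ B = S ∧ (∀ z, z ∈ A → z ∈ B → ∃ a < k, z = g a) ∧
      (∀ u ∈ S, ∀ v ∈ S, G.Adj u v → (u ∈ A ∧ v ∈ A) ∨ (u ∈ B ∧ v ∈ B)) ∧
      X.RealizesOn G A g ∧ Y.RealizesOn G B (fun a => g (shift k X a)) := by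
  have hX : ∀ {a}, a < X.size → a < (glue k X Y).size := fun h => h.trans_le hG.size_le
  have hY : ∀ {a}, a < Y.size → shift k X a < (glue k X Y).size :=
    fun h => shift_lt_size hG.le_left h
  -- A further vertex goes to `A` if its neighbours lie in one block of `X`, and to `B` only
  -- otherwise, so the choice is unambiguous.
  set A : Set V := {z | (∃ a < X.size, z = g a) ∨ (z ∈ S ∧ (∀ a < (glue k X Y).size, z ≠ g a) ∧
    ∃ b ∈ X.attach, ∀ v ∈ S, G.Adj z v → ∃ a ∈ b, v = g a)} with hA
  set B : Set V := {z | (∃ a < Y.size, z = g (shift k X a)) ∨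
    (z ∈ S ∧ (∀ a < (glue k X Y).size, z ≠ g a) ∧ z ∉ A)} with hB
  have hout : ∀ z ∈ S, (∀ a < (glue k X Y).size, z ≠ g a) →
      (z ∈ A ∧ z ∉ B ∧ (∃ v ∈ A, G.Adj z v) ∧
        ∃ b ∈ X.attach, ∀ v ∈ S, G.Adj z v → v ∈ A ∧ ∃ a ∈ b, v = g a) ∨
      (z ∈ B ∧ z ∉ A ∧ (∃ v ∈ B, G.Adj z v) ∧
        ∃ b ∈ Y.attach, ∀ v ∈ S, G.Adj z v → v ∈ B ∧ ∃ a ∈ b, v = g (shift k X a)) := by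
    intro z hz hzg
    obtain ⟨⟨v, hv, hzv⟩, b, hb, hb'⟩ := h.out z hz hzg
    by_cases hzA : z ∈ A
    · left
      rcases hzA with ⟨a, ha, e⟩ | ⟨-, -, b, hb, hb'⟩
      · exact absurd e (hzg a (hX ha))
      · have hvA : ∀ v ∈ S, G.Adj z v → v ∈ A ∧ ∃ a ∈ b, v = g a := fun v hv hzv => by
          obtain ⟨a, ha, e⟩ := hb' v hv hzv
          exact ⟨.inl ⟨a, hG.attach_left b hb a ha, e⟩, a, ha, e⟩
        have hzA : z ∈ A := .inr ⟨hz, hzg, b, hb, hb'⟩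
        refine ⟨hzA, ?_, ⟨v, (hvA v hv hzv).1, hzv⟩, b, hb, hvA⟩
        rintro (⟨a, ha, e⟩ | ⟨-, -, h⟩)
        · exact hzg _ (hY ha) e
        · exact h hzA
    · right
      change b ∈ X.attach ++ Y.attach.map (List.map (shift k X)) at hb
      rcases List.mem_append.1 hb with hb | hb
      · exact absurd (.inr ⟨hz, hzg, b, hb, hb'⟩) hzA
      · obtain ⟨b, hbY, rfl⟩ := List.mem_map.1 hb
        have hvB : ∀ v ∈ S, G.Adj z v → v ∈ B ∧ ∃ a ∈ b, v = g (shift k X a) := fun v hv hzv => by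
          obtain ⟨a, ha, e⟩ := hb' v hv hzv
          obtain ⟨a', ha', rfl⟩ := List.mem_map.1 ha
          exact ⟨.inl ⟨a', hG.attach_right b hbY a' ha', e⟩, a', ha', e⟩
        exact ⟨.inr ⟨hz, hzg, hzA⟩, hzA, ⟨v, (hvB v hv hzv).1, hzv⟩, b, hbY, hvB⟩
  have hAS : ∀ z ∈ A, z ∈ S := by
    rintro z (⟨a, ha, rfl⟩ | h')
    exacts [h.mem a (hX ha), h'.1]
  have hBS : ∀ z ∈ B, z ∈ S := by
    rintro z (⟨a, ha, rfl⟩ | h')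
    exacts [h.mem _ (hY ha), h'.1]
  have hcases : ∀ z ∈ S, (∃ a < X.size, z = g a) ∨ (∃ a < Y.size, k ≤ a ∧ z = g (shift k X a)) ∨
      ∀ a < (glue k X Y).size, z ≠ g a := by
    intro z _
    by_cases hz : ∃ a < (glue k X Y).size, z = g a
    · obtain ⟨c, hc, rfl⟩ := hz
      by_cases hcX : c < X.size
      · exact .inl ⟨c, hcX, rfl⟩
      · obtain ⟨j, hj, hkj, rfl⟩ := hG.exists_shift hc (not_lt.1 hcX)
        exact .inr (.inl ⟨j, hj, hkj, rfl⟩)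
    · push Not at hz
      exact .inr (.inr hz)
  have hcross : ∀ a < X.size, ∀ b < Y.size, k ≤ b → G.Adj (g a) (g (shift k X b)) →
      a < k := by
    intro a ha b hb hkb hadj
    by_contra hka
    have hlt : a < shift k X b := ha.trans_le (not_lt.1 fun h => by
      rw [shift_lt_iff hG.le_left] at h; omega)
    exact (h.code a _ hlt (hY hb)).2 (hG.cross a ha (not_lt.1 hka) b hb hkb) hadj
  have hbase : ∀ a < k, g a ∈ B := fun a ha => .inl ⟨a, ha.trans_le hG.le_right, by
    rw [shift_of_lt ha]⟩
  refine ⟨A, B, ?_, ?_, ?_, ?_, ?_⟩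
  · ext z
    constructor
    · rintro (hz | hz)
      exacts [hAS z hz, hBS z hz]
    · intro hz
      rcases hcases z hz with h' | ⟨a, ha, -, e⟩ | h'
      · exact .inl (.inl h')
      · exact .inr (.inl ⟨a, ha, e⟩)
      · rcases hout z hz h' with h' | h'
        exacts [.inl h'.1, .inr h'.1]
  · rintro z hzA hzB
    rcases hzA with ⟨a, ha, rfl⟩ | ⟨hz, hzg, hzA⟩
    · rcases hzB with ⟨b, hb, e⟩ | ⟨-, hzg, -⟩
      · have := h.inj a (hX ha) _ (hY hb) e
        subst this
        rw [shift_lt_iff hG.le_left] at ha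
        exact ⟨b, ha, by rw [shift_of_lt ha]⟩
      · exact absurd rfl (hzg a (hX ha))
    · rcases hzB with ⟨b, hb, e⟩ | ⟨-, -, h'⟩
      · exact absurd e (hzg _ (hY hb))
      · exact absurd (.inr ⟨hz, hzg, hzA⟩) h'
  · intro u hu v hv huv
    rcases hcases u hu with ⟨a, ha, rfl⟩ | ⟨a, ha, hka, rfl⟩ | hug
    · rcases hcases v hv with ⟨b, hb, rfl⟩ | ⟨b, hb, hkb, rfl⟩ | hvg
      · exact .inl ⟨.inl ⟨a, ha, rfl⟩, .inl ⟨b, hb, rfl⟩⟩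
      · exact .inr ⟨hbase a (hcross a ha b hb hkb huv), .inl ⟨b, hb, rfl⟩⟩
      · rcases hout v hv hvg with ⟨hvA, -, -, b, hb, h'⟩ | ⟨hvB, -, -, b, hb, h'⟩
        · exact .inl ⟨(h' _ hu huv.symm).1, hvA⟩
        · exact .inr ⟨(h' _ hu huv.symm).1, hvB⟩
    · rcases hcases v hv with ⟨b, hb, rfl⟩ | ⟨b, hb, hkb, rfl⟩ | hvg
      · exact .inr ⟨.inl ⟨a, ha, rfl⟩, hbase b (hcross b hb a ha hka huv.symm)⟩
      · exact .inr ⟨.inl ⟨a, ha, rfl⟩, .inl ⟨b, hb, rfl⟩⟩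
      · rcases hout v hv hvg with ⟨hvA, -, -, b, hb, h'⟩ | ⟨hvB, -, -, b, hb, h'⟩
        · exact .inl ⟨(h' _ hu huv.symm).1, hvA⟩
        · exact .inr ⟨(h' _ hu huv.symm).1, hvB⟩
    · rcases hout u hu hug with ⟨huA, -, -, b, hb, h'⟩ | ⟨huB, -, -, b, hb, h'⟩
      · exact .inl ⟨huA, (h' _ hv huv).1⟩
      · exact .inr ⟨huB, (h' _ hv huv).1⟩
  · refine ⟨fun a ha => .inl ⟨a, ha, rfl⟩, fun a ha b hb => h.inj a (hX ha) b (hX hb),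
      fun a b hab hb => ?_, fun w hw hwg => ?_⟩
    · rw [← hG.left b hb a hab]
      exact h.code a b hab (hX hb)
    · rcases hw with ⟨a, ha, e⟩ | ⟨hw, hwg', hwA⟩
      · exact absurd e (hwg a ha)
      · rcases hout w hw hwg' with ⟨-, -, h1, b, hb, h'⟩ | ⟨-, h', -⟩
        · exact ⟨h1, b, hb, fun v hv hwv => (h' v (hAS v hv) hwv).2⟩
        · exact absurd (.inr ⟨hw, hwg', hwA⟩) h'
  · refine ⟨fun a ha => .inl ⟨a, ha, rfl⟩,
      fun a ha b hb e => shift_inj (h.inj _ (hY ha) _ (hY hb) e),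
      fun a b hab hb => ?_, fun w hw hwg => ?_⟩
    · rw [← hG.right b hb a hab]
      exact h.code _ _ (shift_lt_shift hab) (hY hb)
    · rcases hw with ⟨a, ha, e⟩ | ⟨hw, hwg', hwA⟩
      · exact absurd e (hwg a ha)
      · rcases hout w hw hwg' with ⟨h', -⟩ | ⟨-, -, h1, b, hb, h'⟩
        · exact absurd h' hwA
        · exact ⟨h1, b, hb, fun v hv hwv => (h' v (hBS v hv) hwv).2⟩

/-- The placement uses `g₁` on the vertices of `X` and `g₂` beyond them. The agreement on the first
`k` vertices makes it equal to `g₂` on the whole shifted copy of `Y`. -/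
lemma RealizesOn.glue {k : ℕ} (hG : Gluable k X Y) (hX : X.RealizesOn G A g₁)
    (hY : Y.RealizesOn G B g₂) (hbase : ∀ a < k, g₁ a = g₂ a)
    (hAB : ∀ z, z ∈ A → z ∈ B → ∃ a < k, z = g₁ a)
    (hedge : ∀ u ∈ A, ∀ v ∈ B, G.Adj u v → u ∈ B ∨ v ∈ A) :
    ∃ g, (glue k X Y).RealizesOn G (A ∪ B) g ∧ ∀ a < X.size, g a = g₁ a := by
  set g : ℕ → V := fun c => if c < X.size then g₁ c else g₂ (c - (X.size - k)) with hg
  have gX : ∀ a < X.size, g a = g₁ a := fun a ha => if_pos ha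
  have gY : ∀ a, g (shift k X a) = g₂ a := by
    intro a
    by_cases ha : a < k
    · rw [shift_of_lt ha, gX a (ha.trans_le hG.le_left), hbase a ha]
    · have h1 : ¬ shift k X a < X.size := by rwa [shift_lt_iff hG.le_left]
      change (if _ then _ else _) = _
      rw [if_neg h1, shift_of_le (not_lt.1 ha), Nat.add_sub_cancel_left]
  have hinA : ∀ a < X.size, g₁ a ∈ B → a < k := fun a ha h => by
    obtain ⟨b, hb, e⟩ := hAB _ (hX.mem a ha) h
    have := hX.inj a ha b (hb.trans_le hG.le_left) e
    omega
  have hinB : ∀ b < Y.size, g₂ b ∈ A → b < k := fun b hb h => by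
    obtain ⟨a, ha, e⟩ := hAB _ h (hY.mem b hb)
    rw [hbase a ha] at e
    have := hY.inj b hb a (ha.trans_le hG.le_right) e
    omega
  refine ⟨g, ⟨?_, ?_, ?_, ?_⟩, gX⟩
  · intro c hc
    by_cases hcX : c < X.size
    · rw [gX c hcX]
      exact .inl (hX.mem c hcX)
    · obtain ⟨j, hj, -, rfl⟩ := hG.exists_shift hc (not_lt.1 hcX)
      rw [gY]
      exact .inr (hY.mem j hj)
  · intro c hc d hd e
    by_cases hcX : c < X.size <;> by_cases hdX : d < X.size
    · rw [gX c hcX, gX d hdX] at e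
      exact hX.inj c hcX d hdX e
    · obtain ⟨j, hj, hkj, rfl⟩ := hG.exists_shift hd (not_lt.1 hdX)
      rw [gX c hcX, gY] at e
      have := hinB j hj (e ▸ hX.mem c hcX)
      omega
    · obtain ⟨j, hj, hkj, rfl⟩ := hG.exists_shift hc (not_lt.1 hcX)
      rw [gX d hdX, gY] at e
      have := hinB j hj (e ▸ hX.mem d hdX)
      omega
    · obtain ⟨i, hi, hki, rfl⟩ := hG.exists_shift hc (not_lt.1 hcX)
      obtain ⟨j, hj, hkj, rfl⟩ := hG.exists_shift hd (not_lt.1 hdX)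
      rw [gY, gY] at e
      rw [hY.inj i hi j hj e]
  · intro c d hcd hd
    by_cases hdX : d < X.size
    · rw [gX c (hcd.trans hdX), gX d hdX, hG.left d hdX c hcd]
      exact hX.code c d hcd hdX
    · obtain ⟨j, hj, hkj, rfl⟩ := hG.exists_shift hd (not_lt.1 hdX)
      have hright : ∀ i, c = shift k X i →
          ((Pattern.glue k X Y).code c (shift k X j) = 0 → G.Adj (g c) (g (shift k X j))) ∧
          ((Pattern.glue k X Y).code c (shift k X j) = 2 → ¬ G.Adj (g c) (g (shift k X j))) := by
        rintro i rfl
        have hij : i < j := by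
          by_contra h
          rcases (not_lt.1 h).lt_or_eq with h | rfl
          · exact absurd (shift_lt_shift (X := X) h) hcd.not_gt
          · exact lt_irrefl _ hcd
        rw [gY, gY, hG.right j hj i hij]
        exact hY.code i j hij hj
      by_cases hck : c < k
      · exact hright c (shift_of_lt hck).symm
      · by_cases hcX : c < X.size
        · rw [hG.cross c hcX (not_lt.1 hck) j hj hkj, gX c hcX, gY]
          refine ⟨by simp, fun _ hadj => ?_⟩
          rcases hedge _ (hX.mem c hcX) _ (hY.mem j hj) hadj with h | h
          · exact hck (hinA c hcX h)
          · exact absurd (hinB j hj h) (not_lt.2 hkj)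
        · obtain ⟨i, hi, hki, e⟩ := hG.exists_shift (hcd.trans hd) (not_lt.1 hcX)
          exact hright i e
  · intro w hw hwg
    have hwX : ∀ a < X.size, w ≠ g₁ a := fun a ha => by
      rw [← gX a ha]
      exact hwg a (ha.trans_le hG.size_le)
    have hwY : ∀ a < Y.size, w ≠ g₂ a := fun a ha => by
      rw [← gY a]
      exact hwg _ (shift_lt_size hG.le_left ha)
    have hnot : ¬ (w ∈ A ∧ w ∈ B) := by
      rintro ⟨h1, h2⟩
      obtain ⟨a, ha, e⟩ := hAB w h1 h2
      exact hwX a (ha.trans_le hG.le_left) e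
    rcases hw with hw | hw
    · obtain ⟨⟨v, hv, hwv⟩, b, hb, hb'⟩ := hX.out w hw hwX
      refine ⟨⟨v, .inl hv, hwv⟩, b, List.mem_append.2 (.inl hb), fun v hv hwv => ?_⟩
      have hvA : v ∈ A := by
        rcases hv with hv | hv
        · exact hv
        · rcases hedge w hw v hv hwv with h | h
          · exact absurd ⟨hw, h⟩ hnot
          · exact h
      obtain ⟨a, ha, rfl⟩ := hb' v hvA hwv
      exact ⟨a, ha, (gX a (hG.attach_left b hb a ha)).symm⟩
    · obtain ⟨⟨v, hv, hwv⟩, b, hb, hb'⟩ := hY.out w hw hwY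
      refine ⟨⟨v, .inr hv, hwv⟩, b.map (shift k X),
        List.mem_append.2 (.inr (List.mem_map_of_mem hb)), fun v hv hwv => ?_⟩
      have hvB : v ∈ B := by
        rcases hv with hv | hv
        · rcases hedge v hv w hw hwv.symm with h | h
          · exact h
          · exact absurd ⟨h, hw⟩ hnot
        · exact hv
      obtain ⟨a, ha, rfl⟩ := hb' v hvB hwv
      exact ⟨_, List.mem_map_of_mem ha, (gY a).symm⟩

end Pattern

end MatchingBuchsbaum

namespace MatchingBuchsbaum

variable {V : Type*}

namespace Pattern

variable {G : SimpleGraph V}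

/-! ### Patterns and families of graphs -/

lemma isK3_of_realizesOn {g : ℕ → V} (h : triangle.RealizesOn G Set.univ g) : IsK3 G := by
  have hbij : Function.Bijective fun i : Fin 3 => g i := by
    refine ⟨fun i j e => Fin.ext (h.inj i i.2 j j.2 e), fun w => ?_⟩
    by_contra hw
    push Not at hw
    obtain ⟨-, b, hb, -⟩ := h.out w (Set.mem_univ _) fun a ha e => hw ⟨a, ha⟩ e.symm
    simp [triangle] at hb
  have hcode : ∀ b < 3, ∀ a < b, triangle.code a b = 0 := by decide
  have hadj : ∀ i j : Fin 3, i < j → G.Adj (g i) (g j) := fun i j hij =>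
    (h.code i j hij j.2).1 (hcode j j.2 i hij)
  refine ⟨RelIso.symm ⟨Equiv.ofBijective _ hbij, ?_⟩⟩
  intro i j
  simp only [Equiv.ofBijective_apply, SimpleGraph.top_adj]
  constructor
  · rintro hij rfl
    exact hij.ne rfl
  · intro hij
    rcases lt_or_gt_of_ne hij with h | h
    exacts [hadj i j h, (hadj j i h).symm]

lemma realizesOn_of_isK3 (h : IsK3 G) (c : V) :
    ∃ g, triangle.RealizesOn G Set.univ g ∧ g 0 = c := by
  obtain ⟨φ⟩ := h
  have hcast : ∀ a < 3, ∀ b < 3, Fin.ofNat 3 a = Fin.ofNat 3 b → a = b := by decide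
  have hcode : ∀ b < 3, ∀ a < b, triangle.code a b = 0 := by decide
  have hinj : ∀ a < 3, ∀ b < 3, φ.symm (φ c + Fin.ofNat 3 a) = φ.symm (φ c + Fin.ofNat 3 b) → a = b :=
    fun a ha b hb e => hcast a ha b hb (add_left_cancel (φ.symm.injective e))
  -- Rotating `Fin 3` by `φ c` places vertex 0 of the triangle at `c`, as needed for a petal.
  refine ⟨fun a => φ.symm (φ c + Fin.ofNat 3 a), ⟨by simp, hinj, fun a b hab hb => ⟨fun _ => ?_, ?_⟩,
    fun w _ hw => ?_⟩, by simp⟩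
  · rw [φ.symm.map_adj_iff, SimpleGraph.top_adj]
    intro e
    have := hcast a (hab.trans hb) b hb (add_left_cancel e)
    omega
  · rw [hcode b hb a hab]
    simp
  · exfalso
    refine hw (φ w - φ c).val (φ w - φ c).2 ?_
    rw [Fin.ofNat_val_eq_self, add_sub_cancel, RelIso.symm_apply_apply]

lemma eq_starGraph {z : V} (h : ∀ w, w ≠ z → G.Adj w z ∧ ∀ v, G.Adj w v → v = z) :
    G = SimpleGraph.starGraph z := by
  ext u v
  rw [SimpleGraph.starGraph_adj]
  constructor
  · intro huv
    refine ⟨huv.ne, ?_⟩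
    by_cases hu : u = z
    · exact .inl hu
    · exact .inr ((h u hu).2 v huv)
  · rintro ⟨hne, rfl | rfl⟩
    · exact (h v hne.symm).1.symm
    · exact (h u hne).1

lemma isStar_of_realizesOn {g : ℕ → V} (h : star.RealizesOn G Set.univ g) : IsStar G := by
  have h01 : G.Adj (g 0) (g 1) := (h.code 0 1 (by decide) (by decide)).1 (by decide)
  refine ⟨⟨_, _, h01.ne⟩, g 0, eq_starGraph fun w hw => ?_⟩
  have hout : ∀ w, w ≠ g 0 → w ≠ g 1 → G.Adj w (g 0) ∧ ∀ v, G.Adj w v → v = g 0 := by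
    intro w h0 h1
    obtain ⟨⟨v, -, hv⟩, b, hb, hb'⟩ := h.out w (Set.mem_univ _) (by
      intro a ha
      change a < 2 at ha
      interval_cases a <;> assumption)
    have hb : b = [0] := by simpa [star] using hb
    subst hb
    have : ∀ v, G.Adj w v → v = g 0 := by simpa using hb'
    exact ⟨this v hv ▸ hv, this⟩
  by_cases hw1 : w = g 1
  · subst hw1
    refine ⟨h01.symm, fun v hv => ?_⟩
    by_contra hv0
    exact h01.ne ((hout v hv0 hv.ne').2 _ hv.symm).symm
  · exact hout w hw hw1

lemma realizesOn_of_isStar (h : IsStar G) : ∃ g, star.RealizesOn G Set.univ g := by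
  obtain ⟨hn, z, rfl⟩ := h
  obtain ⟨y, hy⟩ := exists_ne z
  refine ⟨fun a => if a = 0 then z else y, by simp, ?_, ?_, ?_⟩
  · intro a ha b hb e
    change a < 2 at ha
    change b < 2 at hb
    interval_cases a <;> interval_cases b <;> simp_all
  · intro a b hab hb
    change b < 2 at hb
    have ha : a = 0 := by omega
    have hb : b = 1 := by omega
    subst ha hb
    simp only [if_true, one_ne_zero, if_false, SimpleGraph.starGraph_adj, true_or, and_true]
    exact ⟨fun _ => hy.symm, fun h => absurd h (by decide)⟩
  · intro w _ hw
    have hwz : w ≠ z := by simpa using hw 0 (by decide)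
    refine ⟨⟨z, Set.mem_univ _, SimpleGraph.starGraph_center_adj' hwz.symm⟩, [0], by simp [star],
      fun v _ hv => ⟨0, by simp, ?_⟩⟩
    rw [SimpleGraph.starGraph_adj] at hv
    simpa [hwz] using hv.2

lemma isPetal_of_realizesOn [Finite V] {g : ℕ → V} (h : petal.RealizesOn G Set.univ g) :
    IsPetal G (g 0) := by
  have h01 : G.Adj (g 0) (g 1) := (h.code 0 1 (by decide) (by decide)).1 (by decide)
  have h12 : G.Adj (g 1) (g 2) := (h.code 1 2 (by decide) (by decide)).1 (by decide)
  have h02 : ¬ G.Adj (g 0) (g 2) := (h.code 0 2 (by decide) (by decide)).2 (by decide)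
  have hne : g 0 ≠ g 2 := fun e => absurd (h.inj 0 (by decide) 2 (by decide) e) (by decide)
  have hout : ∀ w, w ≠ g 0 → w ≠ g 1 → w ≠ g 2 → G.Adj w (g 1) ∧ ∀ v, G.Adj w v → v = g 1 := by
    intro w h0 h1 h2
    obtain ⟨⟨v, -, hv⟩, b, hb, hb'⟩ := h.out w (Set.mem_univ _) (by
      intro a ha
      change a < 3 at ha
      interval_cases a <;> assumption)
    have hb : b = [1] := by simpa [petal] using hb
    subst hb
    have : ∀ v, G.Adj w v → v = g 1 := by simpa using hb'
    exact ⟨this v hv ▸ hv, this⟩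
  refine .inr ⟨g 1, h01.ne', eq_starGraph fun w hw => ?_, ?_⟩
  · by_cases hw0 : w = g 0
    · subst hw0
      refine ⟨h01, fun v hv => ?_⟩
      by_contra hv1
      exact h01.ne ((hout v hv.ne' hv1 (by rintro rfl; exact h02 hv)).2 _ hv.symm)
    by_cases hw2 : w = g 2
    · subst hw2
      refine ⟨h12.symm, fun v hv => ?_⟩
      by_contra hv1
      exact h12.ne' ((hout v (by rintro rfl; exact h02 hv.symm) hv1 hv.ne').2 _ hv.symm)
    · exact hout w hw0 hw hw2
  · have : 1 < G.edgeSet.ncard := (Set.one_lt_ncard (Set.toFinite _)).2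
      ⟨s(g 0, g 1), h01, s(g 1, g 2), h12, by
        intro e
        rw [Sym2.eq_iff] at e
        rcases e with e | e
        · exact h01.ne e.1
        · exact hne e.1⟩
    exact this

lemma realizesOn_of_star {z c : V} (hc : z ≠ c) (hG : G = SimpleGraph.starGraph z)
    (hcard : 2 ≤ G.edgeSet.ncard) : ∃ g, petal.RealizesOn G Set.univ g ∧ g 0 = c := by
  obtain ⟨y, hyz, hyc⟩ : ∃ y, y ≠ z ∧ y ≠ c := by
    by_contra! hno
    have hsub : G.edgeSet ⊆ {s(z, c)} := by
      intro e he
      induction e with | _ u v =>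
      rw [SimpleGraph.mem_edgeSet, hG, SimpleGraph.starGraph_adj] at he
      rcases he with ⟨hne, rfl | rfl⟩
      · rw [hno v hne.symm]
        rfl
      · rw [hno u hne]
        exact Sym2.eq_swap
    have := Set.ncard_le_ncard hsub
    rw [Set.ncard_singleton] at this
    omega
  subst hG
  refine ⟨fun a => if a = 0 then c else if a = 1 then z else y, ⟨by simp, ?_, ?_, ?_⟩, rfl⟩
  · intro a ha b hb e
    change a < 3 at ha
    change b < 3 at hb
    interval_cases a <;> interval_cases b <;> simp_all
  · intro a b hab hb
    change b < 3 at hb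
    interval_cases b
    · omega
    · have ha : a = 0 := by omega
      subst ha
      simp only [if_true, one_ne_zero, if_false, SimpleGraph.starGraph_adj, or_true, and_true]
      exact ⟨fun _ => hc.symm, fun h => absurd h (by decide)⟩
    · interval_cases a
      · refine ⟨fun h => absurd h (by decide), fun _ => ?_⟩
        simp [SimpleGraph.starGraph_adj, hc.symm, hyz]
      · refine ⟨fun _ => ?_, fun h => absurd h (by decide)⟩
        simp [SimpleGraph.starGraph_adj, hyz.symm]
  · intro w _ hw
    have hwz : w ≠ z := by simpa using hw 1 (by decide)
    refine ⟨⟨z, Set.mem_univ _, SimpleGraph.starGraph_center_adj' hwz.symm⟩, [1], by simp [petal],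
      fun v _ hv => ⟨1, by simp, ?_⟩⟩
    rw [SimpleGraph.starGraph_adj] at hv
    simpa [hwz] using hv.2

/-- The pattern `X` describes the diagram `D`. -/
structure Describes {n : ℕ} (X : Pattern) (D : Diagram n) : Prop where
  size : X.size = n
  solid : ∀ i j : Fin n, s(i, j) ∈ D.solid ↔ i ≠ j ∧ X.code (min i j : Fin n) (max i j : Fin n) = 0
  dotted : ∀ i j : Fin n, i < j →
    (s(i, j) ∈ D.solid ∨ s(i, j) ∈ D.dotted ↔ X.code i j ≠ 2)
  attach : ∀ b ∈ X.attach, ∀ a ∈ b, ∃ i ∈ D.unfilled, (i : ℕ) = a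
  unfilled : ∀ j ∈ D.unfilled, ∃ b ∈ X.attach, ∀ i ∈ D.unfilled, (i : ℕ) ∈ b

/-- A diagram attaches further vertices to all of its unfilled set. The field `unfilled` makes one
block contain that set, so the two attachment conditions agree. -/
lemma Describes.family_iff {n : ℕ} {X : Pattern} {D : Diagram n} (h : X.Describes D)
    (hn : 0 < n) : D.Family G ↔ X.Realizes G := by
  obtain ⟨rfl, hsolid, hdotted, hattach, hunfilled⟩ := h
  constructor
  · rintro ⟨f, h1, h2, h3⟩
    let g : ℕ → V := fun a => if h : a < X.size then f ⟨a, h⟩ else f ⟨0, hn⟩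
    have hg : ∀ i : Fin X.size, g i = f i := fun i => dif_pos i.2
    refine ⟨g, fun a ha b hb e => ?_, fun a b hab hb => ?_, fun w hw => ?_⟩
    · have := hg ⟨a, ha⟩
      have := hg ⟨b, hb⟩
      simp_all only
      exact congrArg Fin.val (f.injective e)
    · have hlt : (⟨a, hab.trans hb⟩ : Fin X.size) < ⟨b, hb⟩ := hab
      have ea := hg ⟨a, hab.trans hb⟩
      have eb := hg ⟨b, hb⟩
      simp only at ea eb
      rw [ea, eb]
      refine ⟨fun hc => h1 _ _ ((hsolid _ _).2 ⟨hlt.ne, ?_⟩), fun hc hadj =>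
        ((hdotted _ _ hlt).1 (h2 _ _ hadj)) hc⟩
      rw [min_eq_left hlt.le, max_eq_right hlt.le]
      exact hc
    · obtain ⟨⟨v, hv⟩, h⟩ := h3 w (by
        rintro ⟨i, rfl⟩
        exact hw i i.2 (hg i).symm)
      refine ⟨⟨v, hv⟩, ?_⟩
      obtain ⟨i, hi, rfl⟩ := h v hv
      obtain ⟨b, hb, hb'⟩ := hunfilled i hi
      refine ⟨b, hb, fun u hu => ?_⟩
      obtain ⟨j, hj, rfl⟩ := h u hu
      exact ⟨j, hb' j hj, (hg j).symm⟩
  · rintro ⟨g, h1, h2, h3⟩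
    refine ⟨⟨fun i => g i, fun i j e => Fin.ext (h1 i i.2 j j.2 e)⟩, fun i j hij => ?_,
      fun i j hij => ?_, fun w hw => ?_⟩
    · obtain ⟨hne, hc⟩ := (hsolid i j).1 hij
      rcases lt_or_gt_of_ne hne with h | h
      · rw [min_eq_left h.le, max_eq_right h.le] at hc
        exact (h2 i j h j.2).1 hc
      · rw [min_eq_right h.le, max_eq_left h.le] at hc
        exact ((h2 j i h i.2).1 hc).symm
    · change G.Adj (g i) (g j) at hij
      have hne : i ≠ j := by
        rintro rfl
        exact hij.ne rfl
      rcases lt_or_gt_of_ne hne with h | h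
      · exact (hdotted i j h).2 fun hc => (h2 i j h j.2).2 hc hij
      · rw [Sym2.eq_swap]
        exact (hdotted j i h).2 fun hc => (h2 j i h i.2).2 hc hij.symm
    · obtain ⟨h4, b, hb, hb'⟩ := h3 w fun a ha e => hw ⟨⟨a, ha⟩, e.symm⟩
      refine ⟨h4, fun v hv => ?_⟩
      obtain ⟨a, ha, rfl⟩ := hb' v hv
      obtain ⟨i, hi, rfl⟩ := hattach b hb a ha
      exact ⟨i, hi, rfl⟩

end Pattern

end MatchingBuchsbaum

/-! ### Connected patterns, and finite checks on the small patterns and the diagrams. -/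

namespace MatchingBuchsbaum

variable {V : Type*}

namespace Pattern

variable {G : SimpleGraph V} {A : Set V} {g : ℕ → V} {X Y Z : Pattern}

instance (k : ℕ) (X Y : Pattern) : Decidable (Gluable k X Y) :=
  decidable_of_iff (k ≤ X.size ∧ k ≤ Y.size ∧
    (∀ b < X.size, ∀ a < b, (glue k X Y).code a b = X.code a b) ∧
    (∀ b < Y.size, ∀ a < b, (glue k X Y).code (shift k X a) (shift k X b) = Y.code a b) ∧
    (∀ a < X.size, k ≤ a → ∀ b < Y.size, k ≤ b → (glue k X Y).code a (shift k X b) = 2) ∧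
    (∀ b ∈ X.attach, ∀ a ∈ b, a < X.size) ∧ ∀ b ∈ Y.attach, ∀ a ∈ b, a < Y.size)
    ⟨fun ⟨h1, h2, h3, h4, h5, h6, h7⟩ => ⟨h1, h2, h3, h4, h5, h6, h7⟩,
      fun ⟨h1, h2, h3, h4, h5, h6, h7⟩ => ⟨h1, h2, h3, h4, h5, h6, h7⟩⟩

instance {n : ℕ} (X : Pattern) (D : Diagram n) : Decidable (X.Describes D) :=
  decidable_of_iff (X.size = n ∧
    (∀ i j : Fin n, s(i, j) ∈ D.solid ↔
      i ≠ j ∧ X.code (min i j : Fin n) (max i j : Fin n) = 0) ∧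
    (∀ i j : Fin n, i < j → (s(i, j) ∈ D.solid ∨ s(i, j) ∈ D.dotted ↔ X.code i j ≠ 2)) ∧
    (∀ b ∈ X.attach, ∀ a ∈ b, ∃ i ∈ D.unfilled, (i : ℕ) = a) ∧
    ∀ j ∈ D.unfilled, ∃ b ∈ X.attach, ∀ i ∈ D.unfilled, (i : ℕ) ∈ b)
    ⟨fun ⟨h1, h2, h3, h4, h5⟩ => ⟨h1, h2, h3, h4, h5⟩,
      fun ⟨h1, h2, h3, h4, h5⟩ => ⟨h1, h2, h3, h4, h5⟩⟩

/-- Every vertex of the pattern is joined to an earlier one. -/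
def Linked (X : Pattern) : Prop :=
  0 < X.size ∧ (∀ a < X.size, 0 < a → ∃ b < a, X.code b a = 0) ∧
    ∀ b ∈ X.attach, ∀ a ∈ b, a < X.size

instance (X : Pattern) : Decidable X.Linked := by
  unfold Linked
  infer_instance

lemma RealizesOn.reachable (h : X.RealizesOn G A g) (hX : X.Linked) {z : V} (hz : z ∈ A) :
    G.Reachable (g 0) z := by
  have key : ∀ a < X.size, G.Reachable (g 0) (g a) := by
    intro a
    induction a using Nat.strong_induction_on with
    | _ a ih =>
      intro ha
      rcases Nat.eq_zero_or_pos a with rfl | h0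
      · exact .refl _
      · obtain ⟨b, hb, hc⟩ := hX.2.1 a ha h0
        exact (ih b hb (hb.trans ha)).trans ((h.code b a hb ha).1 hc).reachable
  by_cases hzg : ∃ a < X.size, z = g a
  · obtain ⟨a, ha, rfl⟩ := hzg
    exact key a ha
  · push Not at hzg
    obtain ⟨⟨v, hv, hzv⟩, b, hb, hb'⟩ := h.out z hz hzg
    obtain ⟨a, ha, rfl⟩ := hb' v hv hzv
    exact (key a (hX.2.2 b hb a ha)).trans hzv.symm.reachable

/-- A linked pattern has connected realizations, and a connected set closed under adjacency is a
component. -/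
lemma RealizesOn.supp_eq (h : X.RealizesOn G A g) (hX : X.Linked)
    (hA : ∀ u ∈ A, ∀ v, G.Adj u v → v ∈ A) : (G.connectedComponentMk (g 0)).supp = A := by
  ext z
  rw [SimpleGraph.ConnectedComponent.mem_supp_iff, SimpleGraph.ConnectedComponent.eq]
  refine ⟨fun hz => ?_, fun hz => (h.reachable hX hz).symm⟩
  replace hz := hz.symm
  rw [SimpleGraph.reachable_iff_reflTransGen] at hz
  induction hz with
  | refl => exact h.mem 0 hX.1
  | tail _ huv ih => exact hA _ ih _ huv

lemma gluable_doubles : ∀ X ∈ [triangle, star], ∀ Y ∈ [bow, g1, g2, g3], Gluable 0 X Y := by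
  decide +kernel

lemma gluable_triples : ∀ X ∈ [triangle, star], ∀ Y ∈ [triangle, star], Gluable 0 X Y ∧
    ∀ Z ∈ [triangle, star], Gluable 0 (glue 0 X Y) Z := by
  decide +kernel

lemma gluable_petals : ∀ X ∈ [triangle, petal], ∀ Y ∈ [triangle, petal], Gluable 1 X Y ∧
    ∀ Z ∈ [triangle, petal], Gluable 1 (glue 1 X Y) Z := by
  decide +kernel

lemma linked_small : ∀ X ∈ [triangle, star, petal, bow, g1, g2, g3], X.Linked := by
  decide +kernel

lemma describes_g1 : g1.Describes diagG1 := by decide +kernel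
lemma describes_g2 : g2.Describes diagG2 := by decide +kernel
lemma describes_g3 : g3.Describes diagG3 := by decide +kernel
lemma describes_bow : bow.Describes bowtie := by decide +kernel
lemma describes_b1 : b1.Describes diagB1 := by decide +kernel
lemma describes_b2 : b2.Describes diagB2 := by decide +kernel
lemma describes_b3 : b3.Describes diagB3 := by decide +kernel
lemma describes_b4 : b4.Describes diagB4 := by decide +kernel
lemma describes_b5 : b5.Describes diagB5 := by decide +kernel
lemma describes_b6 : b6.Describes diagB6 := by decide +kernel
lemma describes_b7 : b7.Describes diagB7 := by decide +kernel
lemma describes_b8 : b8.Describes diagB8 := by decide +kernel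
lemma describes_b9 : b9.Describes diagB9 := by decide +kernel
lemma describes_e1 : e1.Describes diagE1 := by decide +kernel
lemma describes_e2 : e2.Describes diagE2 := by decide +kernel

/-! ### Components -/

lemma realizes_of_component {C : G.ConnectedComponent} (hX : X.Linked)
    (h : X.RealizesOn G C.supp g) :
    ∃ g', X.RealizesOn C.toSimpleGraph Set.univ g' := by
  obtain ⟨g', hg', -⟩ := h.induce hX.1 hX.2.2
  exact ⟨g', hg'⟩

lemma component_small (hX : X ∈ [triangle, star]) {C : G.ConnectedComponent}
    (h : X.RealizesOn G C.supp g) : IsK3 C.toSimpleGraph ∨ IsStar C.toSimpleGraph := by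
  simp only [List.mem_cons, List.not_mem_nil, or_false] at hX
  rcases hX with rfl | rfl
  · obtain ⟨g', h'⟩ := realizes_of_component (linked_small _ (by simp)) h
    exact .inl (isK3_of_realizesOn h')
  · obtain ⟨g', h'⟩ := realizes_of_component (linked_small _ (by simp)) h
    exact .inr (isStar_of_realizesOn h')

lemma exists_small {C : G.ConnectedComponent}
    (h : IsK3 C.toSimpleGraph ∨ IsStar C.toSimpleGraph) :
    ∃ X ∈ [triangle, star], ∃ g, X.RealizesOn G C.supp g := by
  rcases h with h | h
  · obtain ⟨g, hg, -⟩ := realizesOn_of_isK3 h (h.some.symm 0)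
    exact ⟨triangle, by simp, _, hg.of_induce⟩
  · obtain ⟨g, hg⟩ := realizesOn_of_isStar h
    exact ⟨star, by simp, _, hg.of_induce⟩

lemma component_large (hX : X ∈ [bow, g1, g2, g3]) {C : G.ConnectedComponent}
    (h : X.RealizesOn G C.supp g) :
    bowtie.Family C.toSimpleGraph ∨ diagG1.Family C.toSimpleGraph ∨
      diagG2.Family C.toSimpleGraph ∨ diagG3.Family C.toSimpleGraph := by
  have hX' := realizes_iff.2 (realizes_of_component (linked_small X (by
    simp only [List.mem_cons, List.not_mem_nil, or_false] at hX ⊢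
    tauto)) h)
  rw [describes_g1.family_iff (by simp), describes_g2.family_iff (by simp),
    describes_g3.family_iff (by simp), describes_bow.family_iff (by simp)]
  simp only [List.mem_cons, List.not_mem_nil, or_false] at hX
  rcases hX with rfl | rfl | rfl | rfl <;> tauto

lemma exists_large {C : G.ConnectedComponent}
    (h : bowtie.Family C.toSimpleGraph ∨ diagG1.Family C.toSimpleGraph ∨
      diagG2.Family C.toSimpleGraph ∨ diagG3.Family C.toSimpleGraph) :
    ∃ X ∈ [bow, g1, g2, g3], ∃ g, X.RealizesOn G C.supp g := by
  rw [describes_g1.family_iff (by simp), describes_g2.family_iff (by simp),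
    describes_g3.family_iff (by simp), describes_bow.family_iff (by simp)] at h
  simp only [realizes_iff] at h
  rcases h with ⟨g, h⟩ | ⟨g, h⟩ | ⟨g, h⟩ | ⟨g, h⟩
  exacts [⟨bow, by simp, _, h.of_induce⟩, ⟨g1, by simp, _, h.of_induce⟩,
    ⟨g2, by simp, _, h.of_induce⟩, ⟨g3, by simp, _, h.of_induce⟩]

lemma component_ne {C D : G.ConnectedComponent} {B : Set V} {c : V} (hC : C.supp = A)
    (hD : D.supp = B) (hc : c ∈ A) (hc' : c ∉ B) : C ≠ D := by
  rintro rfl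
  rw [hC] at hD
  exact hc' (hD ▸ hc)

lemma twoComponents_of_realizesOn (hX : X ∈ [triangle, star]) (hY : Y ∈ [bow, g1, g2, g3])
    (h : (glue 0 X Y).RealizesOn G Set.univ g) : TwoComponents G := by
  obtain ⟨A, B, hU, hAB, hedge, hA, hB⟩ := h.split (gluable_doubles X hX Y hY)
  have hXl : X.Linked := linked_small X (by
    simp only [List.mem_cons, List.not_mem_nil, or_false] at hX ⊢; tauto)
  have hYl : Y.Linked := linked_small Y (by
    simp only [List.mem_cons, List.not_mem_nil, or_false] at hY ⊢; tauto)
  have hAB : ∀ z, z ∈ A → z ∉ B := fun z h1 h2 => by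
    obtain ⟨a, ha, -⟩ := hAB z h1 h2
    omega
  have hC := hA.supp_eq hXl fun u hu v huv => by
    rcases hedge u (Set.mem_univ _) v (Set.mem_univ _) huv with h | h
    · exact h.2
    · exact absurd h.1 (hAB u hu)
  have hD := hB.supp_eq hYl fun u hu v huv => by
    rcases hedge u (Set.mem_univ _) v (Set.mem_univ _) huv with h | h
    · exact absurd hu (hAB u h.1)
    · exact h.2
  refine ⟨_, _, component_ne hC hD (hA.mem 0 hXl.1) (hAB _ (hA.mem 0 hXl.1)), fun Z => ?_,
    component_small hX (by rw [hC]; exact hA), component_large hY (by rw [hD]; exact hB)⟩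
  induction Z using SimpleGraph.ConnectedComponent.ind with
  | _ v =>
    have hv : v ∈ A ∪ B := hU ▸ Set.mem_univ v
    rcases hv with hv | hv
    · rw [← hC] at hv
      exact .inl hv
    · rw [← hD] at hv
      exact .inr hv

lemma threeComponents_of_realizesOn (hX : X ∈ [triangle, star]) (hY : Y ∈ [triangle, star])
    (hZ : Z ∈ [triangle, star]) (h : (glue 0 (glue 0 X Y) Z).RealizesOn G Set.univ g) :
    ThreeComponents G := by
  have hl : ∀ W ∈ [triangle, star], W.Linked := fun W hW => linked_small W (by
    simp only [List.mem_cons, List.not_mem_nil, or_false] at hW ⊢; tauto)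
  obtain ⟨S, C, hU, hSC, hedge, hS, hC⟩ := h.split ((gluable_triples X hX Y hY).2 Z hZ)
  obtain ⟨A, B, hU', hAB, hedge', hA, hB⟩ := hS.split (gluable_triples X hX Y hY).1
  have hAB : ∀ z, z ∈ A → z ∉ B := fun z h1 h2 => by
    obtain ⟨a, ha, -⟩ := hAB z h1 h2
    omega
  have hSC : ∀ z, z ∈ S → z ∉ C := fun z h1 h2 => by
    obtain ⟨a, ha, -⟩ := hSC z h1 h2
    omega
  have hS' : ∀ u ∈ S, ∀ v, G.Adj u v → v ∈ S := fun u hu v huv => by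
    rcases hedge u (Set.mem_univ _) v (Set.mem_univ _) huv with h | h
    · exact h.2
    · exact absurd h.1 (hSC u hu)
  have hAS : ∀ z ∈ A, z ∈ S := fun z hz => hU' ▸ .inl hz
  have hBS : ∀ z ∈ B, z ∈ S := fun z hz => hU' ▸ .inr hz
  have eA := hA.supp_eq (hl X hX) fun u hu v huv => by
    rcases hedge' u (hAS u hu) v (hS' u (hAS u hu) v huv) huv with h | h
    · exact h.2
    · exact absurd h.1 (hAB u hu)
  have eB := hB.supp_eq (hl Y hY) fun u hu v huv => by
    rcases hedge' u (hBS u hu) v (hS' u (hBS u hu) v huv) huv with h | h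
    · exact absurd hu (hAB u h.1)
    · exact h.2
  have eC := hC.supp_eq (hl Z hZ) fun u hu v huv => by
    rcases hedge u (Set.mem_univ _) v (Set.mem_univ _) huv with h | h
    · exact absurd hu (hSC u h.1)
    · exact h.2
  have mA := hA.mem 0 (hl X hX).1
  have mB := hB.mem 0 (hl Y hY).1
  have hall : ∀ W : G.ConnectedComponent, W = G.connectedComponentMk (g 0) ∨
      W = G.connectedComponentMk (g (shift 0 X 0)) ∨
      W = G.connectedComponentMk (g (shift 0 (glue 0 X Y) 0)) := by
    intro W
    induction W using SimpleGraph.ConnectedComponent.ind with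
    | _ v =>
      have hv : v ∈ S ∪ C := hU ▸ Set.mem_univ v
      rcases hv with hv | hv
      · rw [← hU'] at hv
        rcases hv with hv | hv
        · rw [← eA] at hv
          exact .inl hv
        · rw [← eB] at hv
          exact .inr (.inl hv)
      · rw [← eC] at hv
        exact .inr (.inr hv)
  constructor
  · rw [← Set.ncard_univ]
    refine Set.ncard_eq_three.2 ⟨_, _, _, component_ne eA eB mA (hAB _ mA),
      component_ne eA eC mA (hSC _ (hAS _ mA)), component_ne eB eC mB (hSC _ (hBS _ mB)), ?_⟩
    ext W
    simpa using hall W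
  · intro W
    rcases hall W with rfl | rfl | rfl
    · exact component_small hX (by rw [eA]; exact hA)
    · exact component_small hY (by rw [eB]; exact hB)
    · exact component_small hZ (by rw [eC]; exact hC)

lemma supp_disjoint {C D : G.ConnectedComponent} (h : C ≠ D) {z : V} (hz : z ∈ C.supp)
    (hz' : z ∈ D.supp) : False := h (Eq.trans (Eq.symm hz) hz')

lemma supp_adj {C D : G.ConnectedComponent} {u v : V} (hu : u ∈ C.supp) (hv : v ∈ D.supp)
    (huv : G.Adj u v) : C = D := by
  have : G.connectedComponentMk u = G.connectedComponentMk v :=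
    SimpleGraph.ConnectedComponent.eq.2 huv.reachable
  rw [SimpleGraph.ConnectedComponent.mem_supp_iff] at hu hv
  rw [← hu, ← hv, this]

lemma exists_of_twoComponents (h : TwoComponents G) : ∃ X ∈ doubles, X.Realizes G := by
  obtain ⟨C, D, hne, hall, hC, hD⟩ := h
  obtain ⟨X, hX, g₁, h₁⟩ := exists_small hC
  obtain ⟨Y, hY, g₂, h₂⟩ := exists_large hD
  obtain ⟨g, hg, -⟩ := h₁.glue (gluable_doubles X hX Y hY) h₂ (by simp)
    (fun z hz hz' => (supp_disjoint hne hz hz').elim)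
    (fun u hu v hv huv => (hne (supp_adj hu hv huv)).elim)
  have hU : C.supp ∪ D.supp = Set.univ := by
    ext v
    simp only [Set.mem_union, SimpleGraph.ConnectedComponent.mem_supp_iff, Set.mem_univ, iff_true]
    exact hall _
  rw [hU] at hg
  refine ⟨_, ?_, realizes_iff.2 ⟨g, hg⟩⟩
  exact List.mem_flatMap.2 ⟨X, hX, List.mem_map.2 ⟨Y, hY, rfl⟩⟩

lemma exists_of_threeComponents (h : ThreeComponents G) : ∃ X ∈ triples, X.Realizes G := by
  obtain ⟨hcard, hall⟩ := h
  rw [← Set.ncard_univ] at hcard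
  obtain ⟨C, D, E, hCD, hCE, hDE, hU⟩ := Set.ncard_eq_three.1 hcard
  obtain ⟨X, hX, g₁, h₁⟩ := exists_small (hall C)
  obtain ⟨Y, hY, g₂, h₂⟩ := exists_small (hall D)
  obtain ⟨Z, hZ, g₃, h₃⟩ := exists_small (hall E)
  obtain ⟨g, hg, -⟩ := h₁.glue (gluable_triples X hX Y hY).1 h₂ (by simp)
    (fun z hz hz' => (supp_disjoint hCD hz hz').elim)
    (fun u hu v hv huv => (hCD (supp_adj hu hv huv)).elim)
  obtain ⟨g, hg, -⟩ := hg.glue ((gluable_triples X hX Y hY).2 Z hZ) h₃ (by simp)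
    (fun z hz hz' => (hz.elim (fun h => supp_disjoint hCE h hz')
      fun h => supp_disjoint hDE h hz').elim)
    (fun u hu v hv huv => (hu.elim (fun h => hCE (supp_adj h hv huv))
      fun h => hDE (supp_adj h hv huv)).elim)
  have hU : C.supp ∪ D.supp ∪ E.supp = Set.univ := by
    ext v
    simp only [Set.mem_union, SimpleGraph.ConnectedComponent.mem_supp_iff, Set.mem_univ, iff_true]
    have : G.connectedComponentMk v ∈ ({C, D, E} : Set G.ConnectedComponent) :=
      hU ▸ Set.mem_univ _
    simpa [or_assoc] using this
  rw [hU] at hg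
  refine ⟨_, ?_, realizes_iff.2 ⟨g, hg⟩⟩
  exact List.mem_flatMap.2 ⟨X, hX, List.mem_flatMap.2 ⟨Y, hY, List.mem_map.2 ⟨Z, hZ, rfl⟩⟩⟩

/-! ### Petal graphs -/

lemma RealizesOn.isPetal [Finite V] (hX : X ∈ [triangle, petal]) (h : X.RealizesOn G A g)
    (h0 : g 0 ∈ A) : IsPetal (G.induce A) ⟨g 0, h0⟩ := by
  simp only [List.mem_cons, List.not_mem_nil, or_false] at hX
  rcases hX with rfl | rfl
  · obtain ⟨g', h', -⟩ := h.induce (by decide) (by decide)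
    exact .inl (isK3_of_realizesOn h')
  · obtain ⟨g', h', e⟩ := h.induce (by decide) (by decide)
    have : (⟨g 0, h0⟩ : A) = g' 0 := Subtype.ext (e 0 (by decide)).symm
    rw [this]
    exact isPetal_of_realizesOn h'

lemma exists_of_isPetal {c : V} {hc : c ∈ A} (h : IsPetal (G.induce A) ⟨c, hc⟩) :
    ∃ X ∈ [triangle, petal], ∃ g, X.RealizesOn G A g ∧ g 0 = c := by
  rcases h with h | ⟨z, hz, hG, hcard⟩
  · obtain ⟨g, hg, h0⟩ := realizesOn_of_isK3 h ⟨c, hc⟩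
    exact ⟨triangle, by simp, _, hg.of_induce, congrArg Subtype.val h0⟩
  · obtain ⟨g, hg, h0⟩ := realizesOn_of_star hz hG hcard
    exact ⟨petal, by simp, _, hg.of_induce, congrArg Subtype.val h0⟩

lemma familyPetal_of_realizesOn [Finite V] (hX : X ∈ [triangle, petal])
    (hY : Y ∈ [triangle, petal]) (hZ : Z ∈ [triangle, petal])
    (h : (glue 1 (glue 1 X Y) Z).RealizesOn G Set.univ g) : FamilyPetal G := by
  have hl : ∀ W ∈ [triangle, petal], 0 < W.size := fun W hW => (linked_small W (by
    simp only [List.mem_cons, List.not_mem_nil, or_false] at hW ⊢; tauto)).1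
  obtain ⟨S, C, hU, hSC, hedge, hS, hC⟩ := h.split ((gluable_petals X hX Y hY).2 Z hZ)
  obtain ⟨A, B, hU', hAB, hedge', hA, hB⟩ := hS.split (gluable_petals X hX Y hY).1
  have hAS : ∀ z ∈ A, z ∈ S := fun z hz => hU' ▸ .inl hz
  have hBS : ∀ z ∈ B, z ∈ S := fun z hz => hU' ▸ .inr hz
  have cA : g 0 ∈ A := hA.mem 0 (hl X hX)
  have cB : g 0 ∈ B := hB.mem 0 (hl Y hY)
  have cC : g 0 ∈ C := hC.mem 0 (hl Z hZ)
  have hAB : A ∩ B = {g 0} := by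
    ext z
    refine ⟨fun ⟨h1, h2⟩ => ?_, fun h => h ▸ ⟨cA, cB⟩⟩
    obtain ⟨a, ha, rfl⟩ := hAB z h1 h2
    rw [Nat.lt_one_iff.1 ha]
    rfl
  have hSC : ∀ z ∈ S, z ∈ C → z = g 0 := by
    intro z h1 h2
    obtain ⟨a, ha, rfl⟩ := hSC z h1 h2
    rw [Nat.lt_one_iff.1 ha]
  have hAC : A ∩ C = {g 0} := by
    ext z
    exact ⟨fun ⟨h1, h2⟩ => hSC z (hAS z h1) h2, fun h => h ▸ ⟨cA, cC⟩⟩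
  have hBC : B ∩ C = {g 0} := by
    ext z
    exact ⟨fun ⟨h1, h2⟩ => hSC z (hBS z h1) h2, fun h => h ▸ ⟨cB, cC⟩⟩
  refine ⟨g 0, ![A, B, C], ?_, ?_, ?_, ?_, ?_⟩
  · intro i
    fin_cases i
    exacts [cA, cB, cC]
  · intro i j hij
    fin_cases i <;> fin_cases j
    · exact absurd rfl hij
    · exact hAB
    · exact hAC
    · exact (Set.inter_comm _ _).trans hAB
    · exact absurd rfl hij
    · exact hBC
    · exact (Set.inter_comm _ _).trans hAC
    · exact (Set.inter_comm _ _).trans hBC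
    · exact absurd rfl hij
  · rw [Set.eq_univ_iff_forall]
    intro z
    rw [Set.mem_iUnion]
    have hz : z ∈ S ∪ C := hU ▸ Set.mem_univ z
    rcases hz with hz | hz
    · rw [← hU'] at hz
      rcases hz with hz | hz
      exacts [⟨0, hz⟩, ⟨1, hz⟩]
    · exact ⟨2, hz⟩
  · intro u v huv
    rcases hedge u (Set.mem_univ _) v (Set.mem_univ _) huv with h | h
    · rcases hedge' u h.1 v h.2 huv with h | h
      exacts [⟨0, h⟩, ⟨1, h⟩]
    · exact ⟨2, h⟩
  · intro i
    fin_cases i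
    · exact hA.isPetal hX _
    · exact hB.isPetal hY (hB.mem 0 (hl Y hY))
    · exact hC.isPetal hZ (hC.mem 0 (hl Z hZ))

lemma exists_of_familyPetal (h : FamilyPetal G) : ∃ X ∈ petals, X.Realizes G := by
  obtain ⟨c, A, hc, hinter, hU, hedge, hpetal⟩ := h
  obtain ⟨X, hX, g₁, h₁, e₁⟩ := exists_of_isPetal (hpetal 0)
  obtain ⟨Y, hY, g₂, h₂, e₂⟩ := exists_of_isPetal (hpetal 1)
  obtain ⟨Z, hZ, g₃, h₃, e₃⟩ := exists_of_isPetal (hpetal 2)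
  have hX0 : 0 < X.size := (gluable_petals X hX Y hY).1.le_left
  have hmeet : ∀ i j, i ≠ j → ∀ z, z ∈ A i → z ∈ A j → z = c := fun i j hij z h1 h2 => by
    have : z ∈ A i ∩ A j := ⟨h1, h2⟩
    rwa [hinter i j hij] at this
  have hcross : ∀ i j, i ≠ j → ∀ u ∈ A i, ∀ v ∈ A j, G.Adj u v → u ∈ A j ∨ v ∈ A i := by
    intro i j hij u hu v hv huv
    obtain ⟨k, hk, hk'⟩ := hedge u v huv
    by_cases hik : i = k
    · subst hik
      exact .inr hk'
    -- Here `u` lies in two different petals, so it is the gluing vertex, which belongs to every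
    -- petal.
    · rw [hmeet i k hik u hu hk]
      exact .inl (hc j)
  obtain ⟨g, hg, e⟩ := h₁.glue (gluable_petals X hX Y hY).1 h₂
    (fun a ha => by rw [Nat.lt_one_iff.1 ha, e₁, e₂])
    (fun z hz hz' => ⟨0, by simp, (hmeet 0 1 (by simp) z hz hz').trans e₁.symm⟩)
    (fun u hu v hv huv => hcross 0 1 (by simp) u hu v hv huv)
  have e₀ : g 0 = c := by rw [e 0 hX0, e₁]
  obtain ⟨g, hg, -⟩ := hg.glue ((gluable_petals X hX Y hY).2 Z hZ) h₃
    (fun a ha => by rw [Nat.lt_one_iff.1 ha, e₀, e₃])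
    (fun z hz hz' => ⟨0, by simp, by
      rw [e₀]
      rcases hz with hz | hz
      exacts [hmeet 0 2 (by decide) z hz hz', hmeet 1 2 (by decide) z hz hz']⟩)
    (fun u hu v hv huv => by
      rcases hu with hu | hu
      · exact (hcross 0 2 (by decide) u hu v hv huv).imp_right .inl
      · exact (hcross 1 2 (by decide) u hu v hv huv).imp_right .inr)
  have hU : A 0 ∪ A 1 ∪ A 2 = Set.univ := by
    rw [Set.eq_univ_iff_forall] at hU ⊢
    intro z
    obtain ⟨i, hi⟩ := Set.mem_iUnion.1 (hU z)
    fin_cases i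
    exacts [.inl (.inl hi), .inl (.inr hi), .inr hi]
  rw [hU] at hg
  refine ⟨_, ?_, realizes_iff.2 ⟨g, hg⟩⟩
  exact List.mem_flatMap.2 ⟨X, hX, List.mem_flatMap.2 ⟨Y, hY, List.mem_map.2 ⟨Z, hZ, rfl⟩⟩⟩

/-- The families of the classification are those given by the patterns of the catalogue. -/
theorem exists_mem_catalogue_iff [Finite V] : (∃ X ∈ catalogue, X.Realizes G) ↔
    (FamilyPetal G ∨
      diagB1.Family G ∨ diagB2.Family G ∨ diagB3.Family G ∨ diagB4.Family G ∨
      diagB5.Family G ∨ diagB6.Family G ∨ diagB7.Family G ∨ diagB8.Family G ∨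
      diagB9.Family G) ∨
    (diagE1.Family G ∨ diagE2.Family G) ∨ (ThreeComponents G ∨ TwoComponents G) := by
  have hP : FamilyPetal G ↔ ∃ X ∈ petals, X.Realizes G := by
    refine ⟨exists_of_familyPetal, ?_⟩
    rintro ⟨W, hW, h⟩
    obtain ⟨g, h⟩ := realizes_iff.1 h
    obtain ⟨X, hX, hW⟩ := List.mem_flatMap.1 hW
    obtain ⟨Y, hY, hW⟩ := List.mem_flatMap.1 hW
    obtain ⟨Z, hZ, rfl⟩ := List.mem_map.1 hW
    exact familyPetal_of_realizesOn hX hY hZ h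
  have hT : ThreeComponents G ↔ ∃ X ∈ triples, X.Realizes G := by
    refine ⟨exists_of_threeComponents, ?_⟩
    rintro ⟨W, hW, h⟩
    obtain ⟨g, h⟩ := realizes_iff.1 h
    obtain ⟨X, hX, hW⟩ := List.mem_flatMap.1 hW
    obtain ⟨Y, hY, hW⟩ := List.mem_flatMap.1 hW
    obtain ⟨Z, hZ, rfl⟩ := List.mem_map.1 hW
    exact threeComponents_of_realizesOn hX hY hZ h
  have hD : TwoComponents G ↔ ∃ X ∈ doubles, X.Realizes G := by
    refine ⟨exists_of_twoComponents, ?_⟩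
    rintro ⟨W, hW, h⟩
    obtain ⟨g, h⟩ := realizes_iff.1 h
    obtain ⟨X, hX, hW⟩ := List.mem_flatMap.1 hW
    obtain ⟨Y, hY, rfl⟩ := List.mem_map.1 hW
    exact twoComponents_of_realizesOn hX hY h
  rw [hP, hT, hD, describes_b1.family_iff (by simp), describes_b2.family_iff (by simp),
    describes_b3.family_iff (by simp), describes_b4.family_iff (by simp),
    describes_b5.family_iff (by simp), describes_b6.family_iff (by simp),
    describes_b7.family_iff (by simp), describes_b8.family_iff (by simp),
    describes_b9.family_iff (by simp), describes_e1.family_iff (by simp),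
    describes_e2.family_iff (by simp)]
  simp only [catalogue, List.mem_append, or_and_right, exists_or, List.mem_cons, List.not_mem_nil,
    or_false, exists_eq_left]
  simp only [or_assoc]

end Pattern

end MatchingBuchsbaum

namespace MatchingBuchsbaum

variable {V : Type*}

namespace Search

open Pattern

/-! ### The searches -/

/-- Each list of numbers is the order in which the vertices of the pattern are placed. It affects
only the running time. -/
def fiveTargets : List Target :=
  [target (glue 0 star g3) [1, 0, 2, 3, 4, 5, 6],
    target (glue 0 triangle g3) [0, 1, 2, 3, 4, 5, 6, 7]]

def sevenTargets : List Target :=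
  [target (glue 0 star g2) [1, 0, 6, 5, 4, 2, 3], target (glue 0 star bow) [0, 1, 4, 2, 3, 5, 6],
    target (glue 1 (glue 1 triangle triangle) petal) [6, 5, 0, 1, 2, 3, 4],
    target (glue 1 (glue 1 triangle petal) petal) [4, 3, 0, 1, 2, 5, 6],
    target e2 [0, 2, 3, 4, 5, 1, 6], target e1 [1, 2, 3, 0, 4, 5, 6],
    target (glue 1 (glue 1 triangle triangle) triangle) [0, 1, 2, 3, 4, 5, 6],
    target (glue 0 (glue 0 triangle star) star) [4, 3, 6, 5, 0, 1, 2]]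

def triangleTargets : List Target :=
  [target b8 [6, 0, 5, 2, 3, 4, 1, 7], target b7 [7, 0, 1, 2, 3, 4, 5, 6],
    target (glue 0 star g2) [1, 0, 6, 5, 4, 2, 3],
    target (glue 0 triangle g2) [7, 6, 5, 3, 4, 0, 1, 2], target b9 [0, 2, 1, 7, 3, 4, 5, 6],
    target (glue 0 triangle g1) [4, 5, 6, 3, 7, 0, 1, 2],
    target (glue 0 star bow) [0, 1, 4, 2, 3, 5, 6],
    target (glue 1 (glue 1 triangle petal) petal) [4, 3, 0, 1, 2, 5, 6],
    target (glue 1 (glue 1 triangle triangle) petal) [6, 5, 0, 1, 2, 3, 4],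
    target (glue 0 triangle bow) [5, 3, 4, 6, 7, 0, 1, 2],
    target (glue 0 (glue 0 triangle star) star) [4, 3, 6, 5, 0, 1, 2],
    target (glue 0 (glue 0 triangle triangle) star) [7, 6, 0, 1, 2, 3, 4, 5],
    target (glue 0 (glue 0 triangle triangle) triangle) [0, 1, 2, 3, 4, 5, 6, 7, 8]]

def matchingTargets : List Target :=
  [target b6 [3, 0, 4, 1, 5, 7, 2, 6], target b5 [0, 5, 1, 2, 3, 7, 4, 6],
    target b4 [7, 0, 4, 6, 1, 3, 2, 5], target b2 [1, 3, 0, 5, 4, 2, 6],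
    target b3 [0, 3, 1, 2, 4, 5, 6], target b1 [3, 0, 4, 1, 5, 2],
    target (glue 0 star g1) [1, 0, 2, 3, 4, 5, 6]]

def fiveStart : State := start 7 0 cycleFiveEdge

/-- The mask 127 closes all seven vertices: there are no others joined to them. -/
def sevenStart : State := start 7 127 triangleEdges

/-- The mask 135 closes the triangle `0, 1, 2` and the outside neighbour `7` of vertex 3. -/
def triangleStart : State := start 8 135 ((3, 7) :: triangleEdges)

/-- The mask 42 closes the vertices 1, 3, 5, one end of each matching edge. -/
def matchingStart : State := start 6 42 [(0, 1), (2, 3), (4, 5)]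

lemma search_five : search 0 fiveTargets 40 fiveStart = true := by decide +kernel

lemma search_seven : search 1 sevenTargets 60 sevenStart = true := by decide +kernel

/-- The frontier after seven steps is cut into pieces so that each kernel evaluation stays moderate.
-/
lemma search_triangle_take : allB (search 1 triangleTargets 60)
    ((frontier 1 triangleTargets 7 triangleStart).take 60) = true := by decide +kernel

lemma search_triangle_drop : allB (search 1 triangleTargets 60)
    ((frontier 1 triangleTargets 7 triangleStart).drop 60) = true := by decide +kernel

lemma search_matching_take : allB (search 2 matchingTargets 60)
    ((frontier 2 matchingTargets 7 matchingStart).take 40) = true := by decide +kernel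

lemma search_matching_drop_take : allB (search 2 matchingTargets 60)
    (((frontier 2 matchingTargets 7 matchingStart).drop 40).take 8) = true := by decide +kernel

lemma search_matching_drop_drop_take : allB (search 2 matchingTargets 60)
    ((((frontier 2 matchingTargets 7 matchingStart).drop 40).drop 8).take 20) = true := by
  decide +kernel

lemma search_matching_drop_drop_drop : allB (search 2 matchingTargets 60)
    ((((frontier 2 matchingTargets 7 matchingStart).drop 40).drop 8).drop 20) = true := by
  decide +kernel

lemma allB_of_take_of_drop {α : Type} {p : α → Bool} {l : List α} (n : ℕ)
    (h₁ : allB p (l.take n) = true) (h₂ : allB p (l.drop n) = true) : allB p l = true := by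
  rw [allB_iff] at *
  intro a ha
  rw [← List.take_append_drop n l, List.mem_append] at ha
  exact ha.elim (h₁ a) (h₂ a)

lemma search_triangle : allB (search 1 triangleTargets 60)
    (frontier 1 triangleTargets 7 triangleStart) = true :=
  allB_of_take_of_drop _ search_triangle_take search_triangle_drop

lemma search_matching : allB (search 2 matchingTargets 60)
    (frontier 2 matchingTargets 7 matchingStart) = true :=
  allB_of_take_of_drop _ search_matching_take (allB_of_take_of_drop _ search_matching_drop_take
    (allB_of_take_of_drop _ search_matching_drop_drop_take search_matching_drop_drop_drop))

instance : DecidableEq Pattern := fun X Y =>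
  decidable_of_iff (X.size = Y.size ∧ X.must = Y.must ∧ X.may = Y.may ∧ X.attach = Y.attach)
    (by cases X; cases Y; simp)

lemma targets_subset : ∀ T ∈ fiveTargets ++ sevenTargets ++ triangleTargets ++ matchingTargets,
    T.pat ∈ catalogue := by
  decide +kernel

end Search

end MatchingBuchsbaum

namespace MatchingBuchsbaum

variable {V : Type*} {G : SimpleGraph V}

/-! ### Existence of a pattern -/

open Search Pattern

lemma touch_of_three (hB : Bu G) (D : V → Prop) {a b c d e f : V} (hab : G.Adj a b)
    (hcd : G.Adj c d) (hef : G.Adj e f) (h1 : Apart a b c d) (h2 : Apart a b e f)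
    (h3 : Apart c d e f) (ha : D a) (hb : D b) (hc : D c) (hd : D d) (he : D e) (hf : D f)
    (v w : V) (hvw : G.Adj v w) : D v ∨ D w := by
  by_contra! hno
  have hv : ∀ z, D z → v ≠ z := by
    rintro z hz rfl
    exact hno.1 hz
  have hw : ∀ z, D z → w ≠ z := by
    rintro z hz rfl
    exact hno.2 hz
  exact hB.four a b c d e f v w hab hcd hef hvw h1 h2 h3 ⟨hv a ha, hv b hb, hw a ha, hw b hb⟩
    ⟨hv c hc, hv d hd, hw c hc, hw d hd⟩ ⟨hv e he, hv f hf, hw e he, hw f hf⟩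

lemma apart_of_injective {n : ℕ} {g : ℕ → V} (hg : ∀ a < n, ∀ b < n, g a = g b → a = b)
    {i j p q : ℕ} (h : (i < n ∧ j < n ∧ p < n ∧ q < n) ∧ i ≠ p ∧ i ≠ q ∧ j ≠ p ∧ j ≠ q) :
    Apart (g i) (g j) (g p) (g q) := by
  obtain ⟨⟨hi, hj, hp, hq⟩, h1, h2, h3, h4⟩ := h
  exact ⟨fun e => h1 (hg _ hi _ hp e), fun e => h2 (hg _ hi _ hq e),
    fun e => h3 (hg _ hj _ hp e), fun e => h4 (hg _ hj _ hq e)⟩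

lemma touch_of_injective (hB : Bu G) {n : ℕ} {g : ℕ → V}
    (hg : ∀ a < n, ∀ b < n, g a = g b → a = b) {i j k l p q : ℕ} (hij : G.Adj (g i) (g j))
    (hkl : G.Adj (g k) (g l)) (hpq : G.Adj (g p) (g q))
    (h : [i, j, k, l, p, q].Nodup ∧ ∀ x ∈ [i, j, k, l, p, q], x < n) (v w : V)
    (hvw : G.Adj v w) : (∃ x < n, v = g x) ∨ ∃ x < n, w = g x := by
  obtain ⟨h1, h2⟩ := h
  simp only [List.nodup_cons, List.mem_cons, List.not_mem_nil, or_false, not_or] at h1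
  have hi := h2 i (by simp)
  have hj := h2 j (by simp)
  have hk := h2 k (by simp)
  have hl := h2 l (by simp)
  have hp := h2 p (by simp)
  have hq := h2 q (by simp)
  exact touch_of_three hB (fun z => ∃ x < n, z = g x) hij hkl hpq
    (apart_of_injective hg (by tauto)) (apart_of_injective hg (by tauto))
    (apart_of_injective hg (by tauto)) ⟨i, hi, rfl⟩ ⟨j, hj, rfl⟩ ⟨k, hk, rfl⟩ ⟨l, hl, rfl⟩
    ⟨p, hp, rfl⟩ ⟨q, hq, rfl⟩ v w hvw

/-- Two disjoint edges of the five-cycle and the extra edge form a maximum matching, so the seven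
vertices meet every edge. The patterns offered to the search are a graph with a Hamiltonian
five-cycle next to a star or triangle. -/
lemma exists_of_hasCopy_five (hA : Admissible G 0) (h : HasCopy G 7 cycleFiveEdge) :
    ∃ X ∈ catalogue, X.Realizes G := by
  obtain ⟨g, hg, hadj⟩ := h
  have hv : Valid G g fiveStart := valid_start hA.bu (by simp) hg
    (fun p hp => ⟨by revert p; decide, by revert p; decide, hadj p hp⟩)
    (fun i hi => by simp at hi)
    (touch_of_injective hA.bu hg (hadj (0, 1) (by decide)) (hadj (2, 3) (by decide))
      (hadj (5, 6) (by decide)) (by decide))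
  exact hv.search hA (fun T hT hr => ⟨T.pat, targets_subset T (by simp [hT]), hr⟩) search_five

lemma exists_of_triangle_of_adj (hA : Admissible G 1) {g : ℕ → V} {w : V}
    (hg : ∀ a < 7, ∀ b < 7, g a = g b → a = b) (h01 : G.Adj (g 0) (g 1)) (h12 : G.Adj (g 1) (g 2))
    (h02 : G.Adj (g 0) (g 2)) (h34 : G.Adj (g 3) (g 4)) (h56 : G.Adj (g 5) (g 6))
    (hw : ∀ a < 7, w ≠ g a) (h3w : G.Adj (g 3) w) : ∃ X ∈ catalogue, X.Realizes G := by
  set f : ℕ → V := Function.update g 7 w with hf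
  have fw : f 7 = w := Function.update_self ..
  have fg : ∀ a < 7, f a = g a := fun a ha => Function.update_of_ne ha.ne _ _
  have htouch := touch_of_injective hA.bu hg h01 h34 h56 (by decide)
  -- An outside neighbour of a triangle vertex would give four disjoint edges: the one to it, the
  -- opposite side of the triangle, and the two extra edges.
  have hclosed : ∀ i j k, ({i, j, k} : Finset ℕ) = {0, 1, 2} → G.Adj (g j) (g k) →
      ∀ v, G.Adj (g i) v → ∃ a < 7, v = g a := by
    intro i j k hijk hjk v hv
    by_contra! hno
    have hi : i ∈ ({0, 1, 2} : Finset ℕ) := hijk ▸ (by simp)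
    have hj : j ∈ ({0, 1, 2} : Finset ℕ) := hijk ▸ (by simp)
    have hk : k ∈ ({0, 1, 2} : Finset ℕ) := hijk ▸ (by simp)
    have hcard : ({i, j, k} : Finset ℕ).card = 3 := by rw [hijk]; rfl
    have hij : i ≠ j := by
      rintro rfl
      have := Finset.card_le_two (a := i) (b := k)
      simp at hcard
      omega
    have hik : i ≠ k := by
      rintro rfl
      have := Finset.card_le_two (a := j) (b := i)
      rw [Finset.pair_comm j i, Finset.insert_idem] at hcard
      rw [Finset.pair_comm] at this
      omega
    simp only [Finset.mem_insert, Finset.mem_singleton] at hi hj hk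
    have hv' : ∀ z < 7, v ≠ g z := hno
    refine hA.bu.four (g j) (g k) (g 3) (g 4) (g 5) (g 6) (g i) v hjk h34 h56 hv
      (apart_of_injective hg (by omega)) (apart_of_injective hg (by omega))
      (apart_of_injective hg (by omega)) ?_ ?_ ?_
    · exact ⟨fun e => hij (hg _ (by omega) _ (by omega) e),
        fun e => hik (hg _ (by omega) _ (by omega) e), hv' _ (by omega), hv' _ (by omega)⟩
    · exact ⟨fun e => absurd (hg _ (by omega) _ (by omega) e) (by omega),
        fun e => absurd (hg _ (by omega) _ (by omega) e) (by omega), hv' _ (by omega),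
        hv' _ (by omega)⟩
    · exact ⟨fun e => absurd (hg _ (by omega) _ (by omega) e) (by omega),
        fun e => absurd (hg _ (by omega) _ (by omega) e) (by omega), hv' _ (by omega),
        hv' _ (by omega)⟩
  have hfinj : ∀ a < 8, ∀ b < 8, f a = f b → a = b := by
    intro a ha b hb
    rcases Nat.lt_succ_iff_lt_or_eq.1 ha with ha | rfl <;>
      rcases Nat.lt_succ_iff_lt_or_eq.1 hb with hb | rfl
    · rw [fg a ha, fg b hb]; exact hg a ha b hb
    · rw [fg a ha, fw]; exact fun e => absurd e.symm (hw a ha)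
    · rw [fg b hb, fw]; exact fun e => absurd e (hw b hb)
    · exact fun _ => rfl
  have hlift : ∀ v, (∃ a < 7, v = g a) → ∃ a < 8, v = f a := by
    rintro v ⟨a, ha, rfl⟩
    exact ⟨a, by omega, (fg a ha).symm⟩
  have hedges : ∀ p ∈ (3, 7) :: triangleEdges, G.Adj (f p.1) (f p.2) := by
    simp only [triangleEdges, List.forall_mem_cons, fw, fg 0 (by simp), fg 1 (by simp),
      fg 2 (by simp), fg 3 (by simp), fg 4 (by simp), fg 5 (by simp), fg 6 (by simp)]
    exact ⟨h3w, h01, h12, h02, h34, h56, by simp⟩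
  have hv : Valid G f triangleStart := by
    refine valid_start hA.bu (by simp) hfinj
      (fun p hp => ⟨by revert p; decide, by revert p; decide, hedges p hp⟩) (fun i hi => ?_)
      (fun v u hvu => (htouch v u hvu).imp (hlift v) (hlift u))
    have hi8 : i < 8 := by
      by_contra h
      rw [Nat.testBit_eq_false_of_lt (lt_of_lt_of_le (by norm_num)
        (Nat.pow_le_pow_right (n := 2) (by norm_num) (not_lt.1 h)))] at hi
      cases hi
    refine ⟨hi8, fun v hv => hlift v ?_⟩
    interval_cases i
    · exact hclosed 0 1 2 rfl h12 v (fg 0 (by simp) ▸ hv)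
    · exact hclosed 1 0 2 (by decide) h02 v (fg 1 (by simp) ▸ hv)
    · exact hclosed 2 0 1 (by decide) h01 v (fg 2 (by simp) ▸ hv)
    · exact absurd hi (by decide)
    · exact absurd hi (by decide)
    · exact absurd hi (by decide)
    · exact absurd hi (by decide)
    · rw [fw] at hv
      rcases htouch w v hv with ⟨a, ha, e⟩ | h
      · exact absurd e (hw a ha)
      · exact h
  exact hv.frontier hA (fun T hT hr => ⟨T.pat, targets_subset T (by simp [hT]), hr⟩) 7
    fun t ht f' hv' => hv'.search hA
      (fun T hT hr => ⟨T.pat, targets_subset T (by simp [hT]), hr⟩)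
      (allB_iff.1 search_triangle t ht)

/-- Either the seven vertices have no neighbours outside, or some end of the two extra edges has
one, because the triangle vertices cannot. By symmetry that end may be taken to be vertex 3. -/
lemma exists_of_hasCopy_triangle (hA : Admissible G 1) (h : HasCopy G 7 triangleEdges) :
    ∃ X ∈ catalogue, X.Realizes G := by
  obtain ⟨g, hg, hadj⟩ := h
  have h01 := hadj (0, 1) (by decide)
  have h12 := hadj (1, 2) (by decide)
  have h02 := hadj (0, 2) (by decide)
  have h34 := hadj (3, 4) (by decide)
  have h56 := hadj (5, 6) (by decide)
  have htouch := touch_of_injective hA.bu hg h01 h34 h56 (by decide)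
  by_cases hclosed : ∀ i < 7, ∀ v, G.Adj (g i) v → ∃ a < 7, v = g a
  · have hv : Valid G g sevenStart := by
      refine valid_start hA.bu (by simp) hg
        (fun p hp => ⟨by revert p; decide, by revert p; decide, hadj p hp⟩) (fun i hi => ?_) htouch
      have hi7 : i < 7 := by
        by_contra h
        rw [Nat.testBit_eq_false_of_lt (lt_of_lt_of_le (by norm_num)
          (Nat.pow_le_pow_right (n := 2) (by norm_num) (not_lt.1 h)))] at hi
        cases hi
      exact ⟨hi7, hclosed i hi7⟩
    exact hv.search hA (fun T hT hr => ⟨T.pat, targets_subset T (by simp [hT]), hr⟩) search_seven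
  · push Not at hclosed
    obtain ⟨i, hi, w, hiw, hw⟩ := hclosed
    have htri : ∀ j k, j < 7 → k < 7 → i < 3 → j < 3 → k < 3 → i ≠ j → i ≠ k →
        G.Adj (g j) (g k) → False := fun j k hj hk hi3 hj3 hk3 hij hik hjk => by
      refine hA.bu.four (g j) (g k) (g 3) (g 4) (g 5) (g 6) (g i) w hjk h34 h56 hiw
        (apart_of_injective hg (by omega)) (apart_of_injective hg (by omega))
        (apart_of_injective hg (by omega)) ?_ ?_ ?_
      all_goals
        exact ⟨fun e => absurd (hg _ (by omega) _ (by omega) e) (by omega),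
          fun e => absurd (hg _ (by omega) _ (by omega) e) (by omega), hw _ (by omega),
          hw _ (by omega)⟩
    interval_cases i
    · exact (htri 1 2 (by simp) (by simp) (by simp) (by simp) (by simp) (by simp) (by simp) h12).elim
    · exact (htri 0 2 (by simp) (by simp) (by simp) (by simp) (by simp) (by simp) (by simp) h02).elim
    · exact (htri 0 1 (by simp) (by simp) (by simp) (by simp) (by simp) (by simp) (by simp) h01).elim
    · exact exists_of_triangle_of_adj hA hg h01 h12 h02 h34 h56 hw hiw
    · refine exists_of_triangle_of_adj hA
        (g := fun a => g (if a = 3 then 4 else if a = 4 then 3 else a)) (w := w) ?_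
        h01 h12 h02 h34.symm h56 ?_ hiw
      · intro a ha b hb e
        have := hg _ (by split_ifs <;> omega) _ (by split_ifs <;> omega) e
        split_ifs at this <;> omega
      · exact fun a ha => hw _ (by split_ifs <;> omega)
    -- The relabelling exchanges the two extra edges; in the next case one of them is also reversed.
    · refine exists_of_triangle_of_adj hA
        (g := fun a => g (if a < 3 then a else if a < 5 then a + 2 else a - 2)) (w := w) ?_
        h01 h12 h02 h56 h34 ?_ hiw
      · intro a ha b hb e
        have := hg _ (by split_ifs <;> omega) _ (by split_ifs <;> omega) e
        split_ifs at this <;> omega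
      · exact fun a ha => hw _ (by split_ifs <;> omega)
    · refine exists_of_triangle_of_adj hA
        (g := fun a => g (if a < 3 then a else if a < 5 then 9 - a else a - 2)) (w := w) ?_
        h01 h12 h02 h56.symm h34 ?_ hiw
      · intro a ha b hb e
        have := hg _ (by split_ifs <;> omega) _ (by split_ifs <;> omega) e
        split_ifs at this <;> omega
      · exact fun a ha => hw _ (by split_ifs <;> omega)

lemma getD_injective {l : List V} {d : V} (h : l.Nodup) :
    ∀ a < l.length, ∀ b < l.length, l.getD a d = l.getD b d → a = b := by
  intro a ha b hb e
  rw [List.getD_eq_getElem _ _ ha, List.getD_eq_getElem _ _ hb] at e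
  exact (List.Nodup.getElem_inj_iff h).1 e

/-- One end of an edge of a maximum matching has no neighbour outside the matching. -/
lemma exists_closed_end (hA : Admissible G 2) {a b c d e f : V} (hab : G.Adj a b)
    (hcd : G.Adj c d) (hef : G.Adj e f) (hnd : [a, b, c, d, e, f].Nodup) :
    ∃ p q, (p = a ∧ q = b ∨ p = b ∧ q = a) ∧ ∀ w, G.Adj q w → w ∈ [a, b, c, d, e, f] := by
  by_cases hb : ∀ w, G.Adj b w → w ∈ [a, b, c, d, e, f]
  · exact ⟨a, b, .inl ⟨rfl, rfl⟩, hb⟩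
  by_cases ha : ∀ w, G.Adj a w → w ∈ [a, b, c, d, e, f]
  · exact ⟨b, a, .inr ⟨rfl, rfl⟩, ha⟩
  exfalso
  push Not at ha hb
  obtain ⟨w, haw, hw⟩ := ha
  obtain ⟨w', hbw', hw'⟩ := hb
  simp only [List.nodup_cons, List.mem_cons, List.not_mem_nil, or_false, not_or] at hnd hw hw'
  -- If both ends have outside neighbours, a shared one yields a triangle with two disjoint edges,
  -- and distinct ones replace the edge by two and give four disjoint edges.
  by_cases hww : w = w'
  · subst hww
    have hl : [a, b, w, c, d, e, f].Nodup := by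
      simp only [List.nodup_cons, List.mem_cons, List.not_mem_nil, or_false, not_or,
        not_false_eq_true, List.nodup_nil, and_true]
      refine ⟨?_, ?_, ?_, ?_, ?_, ?_⟩ <;> grind
    refine hA.three le_rfl
      ⟨fun i => [a, b, w, c, d, e, f].getD i a, getD_injective (d := a) hl, ?_⟩
    intro p hp
    simp only [triangleEdges, List.mem_cons, List.not_mem_nil, or_false] at hp
    rcases hp with rfl | rfl | rfl | rfl | rfl
    exacts [hab, hbw', haw, hcd, hef]
  · refine hA.bu.four a w b w' c d e f haw hbw' hcd hef ?_ ?_ ?_ ?_ ?_ ?_ <;>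
      (unfold Apart; grind)

lemma exists_of_closed (hA : Admissible G 2) {a b c d e f : V} (hab : G.Adj a b)
    (hcd : G.Adj c d) (hef : G.Adj e f) (hnd : [a, b, c, d, e, f].Nodup)
    (hb : ∀ w, G.Adj b w → w ∈ [a, b, c, d, e, f]) (hd : ∀ w, G.Adj d w → w ∈ [a, b, c, d, e, f])
    (hf : ∀ w, G.Adj f w → w ∈ [a, b, c, d, e, f]) : ∃ X ∈ catalogue, X.Realizes G := by
  set g : ℕ → V := fun i => [a, b, c, d, e, f].getD i a with hg
  have hinj : ∀ i < 6, ∀ j < 6, g i = g j → i = j := getD_injective hnd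
  have hmem : ∀ w ∈ [a, b, c, d, e, f], ∃ i < 6, w = g i := by
    intro w hw
    obtain ⟨i, hi, rfl⟩ := List.mem_iff_getElem.1 hw
    exact ⟨i, hi, (List.getD_eq_getElem _ _ hi).symm⟩
  have hv : Valid G g matchingStart := by
    refine valid_start hA.bu (by simp) hinj ?_ (fun i hi => ?_)
      (touch_of_injective hA.bu hinj (i := 0) (j := 1) (k := 2) (l := 3) (p := 4) (q := 5)
        hab hcd hef (by decide))
    · simp only [List.forall_mem_cons]
      exact ⟨⟨by simp, by simp, hab⟩, ⟨by simp, by simp, hcd⟩, ⟨by simp, by simp, hef⟩, by simp⟩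
    · have hi6 : i < 6 := by
        by_contra h
        rw [Nat.testBit_eq_false_of_lt (lt_of_lt_of_le (by norm_num)
          (Nat.pow_le_pow_right (n := 2) (by norm_num) (not_lt.1 h)))] at hi
        cases hi
      refine ⟨hi6, fun w hw => hmem w ?_⟩
      interval_cases i
      · exact absurd hi (by decide)
      · exact hb w hw
      · exact absurd hi (by decide)
      · exact hd w hw
      · exact absurd hi (by decide)
      · exact hf w hw
  exact hv.frontier hA (fun T hT hr => ⟨T.pat, targets_subset T (by simp [hT]), hr⟩) 7
    fun t ht f' hv' => hv'.search hA
      (fun T hT hr => ⟨T.pat, targets_subset T (by simp [hT]), hr⟩)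
      (allB_iff.1 search_matching t ht)

lemma perm_pair {a b p q : V} (h : p = a ∧ q = b ∨ p = b ∧ q = a) : [p, q].Perm [a, b] := by
  rcases h with ⟨rfl, rfl⟩ | ⟨rfl, rfl⟩
  exacts [.refl _, .swap _ _ _]

lemma adj_of_pair {a b p q : V} (hab : G.Adj a b) (h : p = a ∧ q = b ∨ p = b ∧ q = a) :
    G.Adj p q := by
  rcases h with ⟨rfl, rfl⟩ | ⟨rfl, rfl⟩
  exacts [hab, hab.symm]

/-- `exists_closed_end` is applied to the three edges of a maximum matching in turn, and each edge
is oriented so that its closed end comes second. The permutations of the six vertices record this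
reordering. -/
lemma exists_of_level_two (hA : Admissible G 2) : ∃ X ∈ catalogue, X.Realizes G := by
  obtain ⟨a, b, hab⟩ := hA.bu.edge
  obtain ⟨c, d, hcd, h1⟩ := hA.bu.extend_one a b hab
  obtain ⟨e, f, hef, h2, h3⟩ := hA.bu.extend_two a b c d hab hcd h1
  have n1 := hab.ne
  have n2 := hcd.ne
  have n3 := hef.ne
  have hnd : [a, b, c, d, e, f].Nodup := by
    simp only [List.nodup_cons, List.mem_cons, List.not_mem_nil, or_false, not_or,
      not_false_eq_true, List.nodup_nil, and_true]
    unfold Apart at h1 h2 h3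
    refine ⟨?_, ?_, ?_, ?_, ?_⟩ <;> grind
  obtain ⟨p, q, hpq, hq⟩ := exists_closed_end hA hab hcd hef hnd
  obtain ⟨r, s, hrs, hs⟩ := exists_closed_end hA hcd hab hef
    ((List.Perm.append_right [e, f]
      (List.perm_append_comm (l₁ := [c, d]) (l₂ := [a, b]))).nodup_iff.2 hnd)
  obtain ⟨t, u, htu, hu⟩ := exists_closed_end hA hef hab hcd
    ((List.perm_append_comm (l₁ := [e, f]) (l₂ := [a, b, c, d])).nodup_iff.2 hnd)
  have hS : ([p, q] ++ ([r, s] ++ [t, u])).Perm ([a, b] ++ ([c, d] ++ [e, f])) :=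
    (perm_pair hpq).append ((perm_pair hrs).append (perm_pair htu))
  refine exists_of_closed hA (a := p) (b := q) (c := r) (d := s) (e := t) (f := u)
    (adj_of_pair hab hpq) (adj_of_pair hcd hrs) (adj_of_pair hef htu) (hS.nodup_iff.2 hnd)
    (fun w hw => hS.mem_iff.2 (hq w hw)) (fun w hw => hS.mem_iff.2 ?_)
    (fun w hw => hS.mem_iff.2 ?_)
  · exact (List.Perm.append_right [e, f]
      (List.perm_append_comm (l₁ := [c, d]) (l₂ := [a, b]))).mem_iff.1 (hs w hw)
  · exact (List.perm_append_comm (l₁ := [e, f]) (l₂ := [a, b, c, d])).mem_iff.1 (hu w hw)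

/-- The two intermediate subgraphs are treated in this order so that each search may exclude the
subgraphs settled before. -/
theorem exists_pattern (hB : Bu G) (hG : ∀ v, ∃ w, G.Adj v w) (h7 : ¬ HasCopy G 7 cycleSeven) :
    ∃ X ∈ catalogue, X.Realizes G := by
  by_cases h5 : HasCopy G 7 cycleFiveEdge
  · exact exists_of_hasCopy_five ⟨hB, hG, h7, by simp, by simp⟩ h5
  by_cases h3 : HasCopy G 7 triangleEdges
  · exact exists_of_hasCopy_triangle ⟨hB, hG, h7, fun _ => h5, by simp⟩ h3
  · exact exists_of_level_two ⟨hB, hG, h7, fun _ => h5, fun _ => h3⟩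

lemma isContained_of_hasCopy (h : HasCopy G 7 cycleSeven) :
    (SimpleGraph.cycleGraph 7).IsContained G := by
  obtain ⟨g, hg, hadj⟩ := h
  have hcycle : ∀ i j : Fin 7, (SimpleGraph.cycleGraph 7).Adj i j →
      ((i : ℕ), (j : ℕ)) ∈ cycleSeven ∨ ((j : ℕ), (i : ℕ)) ∈ cycleSeven := by decide
  refine ⟨⟨⟨fun i : Fin 7 => g i, fun {i j} hij => ?_⟩, fun i j e => Fin.ext (hg i i.2 j j.2 e)⟩⟩
  rcases hcycle i j hij with h | h
  · exact hadj _ h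
  · exact (hadj _ h).symm

end MatchingBuchsbaum

/-! ### The classification. -/

theorem mainTheorem1 {V : Type*} [Finite V] [DecidableEq V] (G : SimpleGraph V)
    (hG : ∀ v : V, ∃ w : V, G.Adj v w) :
    IsTwoDimBuchsbaum (matchingComplex G) ↔
      (FamilyC7 G ∨ FamilyPetal G ∨
        diagB1.Family G ∨ diagB2.Family G ∨ diagB3.Family G ∨ diagB4.Family G ∨
        diagB5.Family G ∨ diagB6.Family G ∨ diagB7.Family G ∨ diagB8.Family G ∨
        diagB9.Family G) ∨
      (diagE1.Family G ∨ diagE2.Family G) ∨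
      (ThreeComponents G ∨ TwoComponents G) := by
  rw [or_assoc, ← Pattern.exists_mem_catalogue_iff, isTwoDimBuchsbaum_iff]
  constructor
  · intro hB
    -- The graphs with a seven-cycle form a family defined by the property itself, so nothing
    -- remains to be shown for them.
    by_cases h7 : HasCopy G 7 Search.cycleSeven
    · exact .inl ⟨isContained_of_hasCopy h7, isTwoDimBuchsbaum_iff.2 hB⟩
    · exact .inr (exists_pattern hB hG h7)
  · rintro (h | ⟨X, hX, h⟩)
    · exact isTwoDimBuchsbaum_iff.1 h.2
    · exact X.bu_of_good (Pattern.good_of_mem_catalogue X hX) h
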